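/- For $s\ge 0$ and $1\le p<\infty$ let $H^{s,p}(\mathbb R^d)$ be the space of the complex-valued $f\in L^p(\mathbb R^d)$ for which the tempered distribution $(1-\Delta)^{s/2}f$ (the Fourier multiplier with symbol $(1+|\xi|^2)^{s/2}$, where $-\Delta$ has symbol $|\xi|^2$) belongs to $L^p(\mathbb R^d)$, with norm $\|f\|_{H^{s,p}}=\|(1-\Delta)^{s/2}f\|_{L^p}$, and let $H^1=H^{1,2}$. For $\sigma>0$ let $F(u)=|u|^{2\sigma}u$. (i) Let $d=2$. For every $\sigma>0$ put $p=\frac{2}{2\sigma+1}$ if $0<\sigma<\frac12$ and $p=\frac43$ if $\sigma\ge\frac12$. Then $p\in(1,2)$, and there is a constant $C$ depending only on $\sigma$ such that for all $u\in H^1(\mathbb R^2)$ one has $F(u)\in H^{1,p}(\mathbb R^2)$ and $$\|F(u)\|_{H^{1,p}(\mathbb R^2)}\le C\,\|u\|_{H^1(\mathbb R^2)}^{2\sigma+1}.$$ (ii) Let $d=3$. For every $\sigma\in(0,\frac32]$ there is a constant $C$ depending only on $\sigma$ such that for all $u\in H^1(\mathbb R^3)$ one has $F(u)\in H^{1,\frac{6}{2\sigma+3}}(\mathbb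 R^3)$ and $$\|F(u)\|_{H^{1,\frac{6}{2\sigma+3}}(\mathbb R^3)}\le C\,\|u\|_{H^1(\mathbb R^3)}^{2\sigma+1}.$$ (iii) Let $d=3$. For every $\sigma\in[1,\frac32]$ there is a constant $C$ depending only on $\sigma$ such that for all $u\in H^1(\mathbb R^3)$ one has $F(u)\in H^{2-\sigma,\frac65}(\mathbb R^3)$ and $$\|F(u)\|_{H^{2-\sigma,\frac65}(\mathbb R^3)}\le C\,\|u\|_{H^1(\mathbb R^3)}^{2\sigma+1}.$$ -/

import Mathlib

open MeasureTheory
open scoped SchwartzMap ENNReal NNReal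

noncomputable section

namespace BesselSobolev

/-- The Euclidean space `ℝᵈ`. -/
abbrev Eu (d : ℕ) : Type := EuclideanSpace ℝ (Fin d)

/-- The Fourier symbol of `(1 - Δ) ^ (s / 2)`. Mathlib's Fourier transform has the kernel
`exp (-2 π i ⟪x, ξ⟫)`, so that `-Δ` has the symbol `(2 π ‖ξ‖) ^ 2`. -/
def symbol (d : ℕ) (s : ℝ) (ξ : Eu d) : ℝ :=
  (1 + (2 * Real.pi * ‖ξ‖) ^ 2) ^ (s / 2)

/-- The symbol is smooth with polynomially bounded derivatives, so it is a multiplier of the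
tempered distributions (outside of this class `fourierMultiplierCLM` would be a junk value). -/
theorem symbol_hasTemperateGrowth (d : ℕ) (s : ℝ) :
    (fun ξ : Eu d ↦ (symbol d s ξ : ℂ)).HasTemperateGrowth := by
  have h1 : (fun ξ : Eu d ↦ (1 + ‖ξ‖ ^ 2) ^ (s / 2)).HasTemperateGrowth :=
    Function.hasTemperateGrowth_one_add_norm_sq_rpow (Eu d) (s / 2)
  have h2 : (fun ξ : Eu d ↦ (2 * Real.pi) • ξ).HasTemperateGrowth :=
    ((2 * Real.pi) • ContinuousLinearMap.id ℝ (Eu d)).hasTemperateGrowth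
  have h3 := Function.Complex.hasTemperateGrowth_ofReal.comp (h1.comp h2)
  refine (congrArg Function.HasTemperateGrowth (funext fun ξ ↦ ?_)).mp h3
  simp only [Function.comp, symbol, norm_smul, Real.norm_eq_abs,
    abs_of_pos (mul_pos two_pos Real.pi_pos)]

/-- The operator `(1 - Δ) ^ (s / 2)` on the tempered distributions of `ℝᵈ`. -/
def besselPow (d : ℕ) (s : ℝ) : 𝓢'(Eu d, ℂ) →L[ℂ] 𝓢'(Eu d, ℂ) :=
  TemperedDistribution.fourierMultiplierCLM ℂ (fun ξ : Eu d ↦ (symbol d s ξ : ℂ))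

/-- The tempered distribution `T` is (integration against) the function `f`. -/
def IsGivenBy {d : ℕ} (T : 𝓢'(Eu d, ℂ)) (f : Eu d → ℂ) : Prop :=
  ∀ φ : 𝓢(Eu d, ℂ), Integrable (fun x ↦ φ x * f x) ∧ T φ = ∫ x, φ x * f x

/-- `g = (1 - Δ) ^ (s / 2) f` as tempered distributions, for functions `f` and `g` on `ℝᵈ`. -/
def IsBesselPow {d : ℕ} (s : ℝ) (f g : Eu d → ℂ) : Prop :=
  ∃ T : 𝓢'(Eu d, ℂ), IsGivenBy T f ∧ IsGivenBy (besselPow d s T) g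

/-- `f` belongs to `H^{s,p}(ℝᵈ)` (for `s ≥ 0` and `p ≥ 1`): `f` and `(1 - Δ) ^ (s / 2) f`
are in `L^p(ℝᵈ)`. -/
def MemH {d : ℕ} (s : ℝ) (p : ℝ≥0∞) (f : Eu d → ℂ) : Prop :=
  MemLp f p volume ∧ ∃ g : Eu d → ℂ, IsBesselPow s f g ∧ MemLp g p volume

/-- The norm `‖(1 - Δ) ^ (s / 2) f‖_{L^p}` of `H^{s,p}(ℝᵈ)`. The function
`g = (1 - Δ) ^ (s / 2) f` is unique up to null sets, so the infimum runs over a single value,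
and it is `∞` if there is no such function. -/
def normH {d : ℕ} (s : ℝ) (p : ℝ≥0∞) (f : Eu d → ℂ) : ℝ≥0∞ :=
  ⨅ (g : Eu d → ℂ) (_ : IsBesselPow s f g), eLpNorm g p volume

/-- The power nonlinearity `F(u) = |u| ^ (2 σ) u`. -/
def powerF {d : ℕ} (σ : ℝ) (u : Eu d → ℂ) : Eu d → ℂ :=
  fun x ↦ ((‖u x‖ ^ (2 * σ) : ℝ) : ℂ) * u x

/-- The integrability exponent used in dimension two. -/
def exponentTwo (σ : ℝ) : ℝ :=
  if σ < 1 / 2 then 2 / (2 * σ + 1) else 4 / 3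

end BesselSobolev

end

/-! The proof goes through the jump process with generator `1 - (1 - Δ) ^ (s / 2)` rather than
through paraproducts or singular integrals. For `0 < s < 2` subordination (the function
`a ↦ (1 + a) ^ (s / 2) - 1` is the Laplace exponent of a subordinator) gives a Lévy–Khintchine
formula, `lintegral_one_sub_phase_levy`, in which the symbol of `(1 - Δ) ^ (s / 2) - 1` is the
integral of `1 - cos (2 π ⟪z, ξ⟫)` over the jumps `z` of a symmetric Lévy measure. Hence, in the
sense of distributions and as a limit over truncations of the Lévy measure,
`((1 - Δ) ^ (s / 2) - 1) f (x) = ∫ (f x - f (x + z))`.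

For `f = F(u)` the integrand is expanded to first order in the difference `δ = u (x + z) - u x`, the
real differential of `F` at `w` being `h ↦ a(w) h + b(w) conj h` with
`|a(w)|, |b(w)| ≲ |w| ^ (2 σ)`. With `v = ((1 - Δ) ^ (s / 2) - 1) u` this yields the chain rule
`isBesselPow_powerFun`:
`(1 - Δ) ^ (s / 2) F(u) = F(u) + a(u) v + b(u) conj v - ∫ R(u x, u (x + z) - u x)`. The first three
terms are bounded by Hölder's inequality and the Sobolev embedding (`exists_lnorm_le_energy`, proved
by splitting frequencies at each level of the distribution function). All that remains is the
integral of the remainder, for which `|R| ≲ (|u x| + |u (x + z)|) ^ (2 σ - α) |δ| ^ (1 + α)` for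
every `α ∈ (0, 1]` with `α ≤ 2 σ` (`exists_norm_remainder_le`). The reduction to this bound is
`exists_eLpNorm_bessel_powerFun_le`.

The differences are measured by a Gagliardo type bound that follows from the Lévy–Khintchine
formula: the Lévy measure of order `s` integrates `‖δ‖ ^ 2` in the Sobolev space of order
`1 - s / 2` (`exists_lintegral_lnorm_diff_sq_le`). Three cases cover the theorem.
* In dimension three with `σ ≥ 1 / 2` one takes `α = 1`, and Minkowski's and Hölder's inequalities
  suffice (`exists_lnorm_remainderBound_le_of_half_le`).
* In dimension two, where `s = 1`, one takes some `α < 1` and keeps the differences in `L²`. The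
  missing power of `‖δ‖` is gained by comparison with the Lévy measure of an order between `1` and
  `2` (`exists_lnorm_remainderBound_le_of_lt_one`).
* In dimension three with `σ < 1 / 2` one takes the largest order allowed, `α = 2 σ < 1`. Then
  `∫ |δ| ^ (1 + α)` is interpolated pointwise in `x` between two square functions of `u`
  (`exists_lintegral_rpow_levy_le`), whose `L^p` norms are bounded by Minkowski's inequality
  (`exists_lnorm_remainderBound_le_three`).
-/

namespace BesselSobolev

open FourierTransform Filter Topology

/-! ### Square-integrable functions and their Fourier transforms -/

/-- The Hilbert space `L²(ℝᵈ)`. -/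
abbrev L2 (d : ℕ) : Type := Lp ℂ 2 (volume : Measure (Eu d))

variable {d : ℕ}

theorem integrable_schwartz_mul {p : ℝ≥0∞} (hp : 1 ≤ p) {f : Eu d → ℂ} (hf : MemLp f p volume)
    (φ : 𝓢(Eu d, ℂ)) : Integrable (fun x ↦ φ x * f x) := by
  have h := ENNReal.HolderConjugate.inv_one_sub_inv' hp
  have : ENNReal.HolderTriple (1 - p⁻¹)⁻¹ p 1 := h.symm
  exact (φ.memLp (1 - p⁻¹)⁻¹ volume).integrable_mul hf

theorem integral_schwartz_mul_fourier (f : L2 d) (φ : 𝓢(Eu d, ℂ)) :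
    ∫ x, φ x * (𝓕 f : L2 d) x = ∫ x, (𝓕 φ) x * f x := by
  have h := DFunLike.congr_fun (Lp.fourier_toTemperedDistribution_eq f) φ
  simpa [TemperedDistribution.fourier_apply, Lp.toTemperedDistribution_apply] using h.symm

theorem ae_eq_of_integral_schwartz_mul_eq {f g : Eu d → ℂ} (hf : LocallyIntegrable f)
    (hg : LocallyIntegrable g) (h : ∀ φ : 𝓢(Eu d, ℂ), ∫ x, φ x * f x = ∫ x, φ x * g x) :
    f =ᵐ[volume] g := by
  refine ae_eq_of_integral_contDiff_smul_eq hf hg fun η hη hc ↦ ?_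
  have hc' : HasCompactSupport (Complex.ofRealCLM ∘ η) := hc.comp_left rfl
  have hη' : ContDiff ℝ (⊤ : ℕ∞) (Complex.ofRealCLM ∘ η) := Complex.ofRealCLM.contDiff.comp hη
  simpa using h (hc'.toSchwartzMap hη')

/-- Near each point, a function agrees with its product with a bump function. -/
theorem locallyIntegrable_of_integrable_schwartz_mul {f : Eu d → ℂ}
    (h : ∀ φ : 𝓢(Eu d, ℂ), Integrable (fun x ↦ φ x * f x)) : LocallyIntegrable f := by
  intro x
  let b : ContDiffBump x := ⟨1, 2, one_pos, one_lt_two⟩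
  have hc' : HasCompactSupport (Complex.ofRealCLM ∘ b) := b.hasCompactSupport.comp_left rfl
  have hη' : ContDiff ℝ (⊤ : ℕ∞) (Complex.ofRealCLM ∘ b) :=
    Complex.ofRealCLM.contDiff.comp b.contDiff
  refine ⟨Metric.closedBall x 1, Metric.closedBall_mem_nhds x one_pos, ?_⟩
  refine ((h (hc'.toSchwartzMap hη')).integrableOn (s := Metric.closedBall x 1)).congr_fun
    (fun y hy ↦ ?_) measurableSet_closedBall
  have : b y = 1 := b.one_of_mem_closedBall hy
  simp [this]

theorem L2.locallyIntegrable (f : L2 d) : LocallyIntegrable f :=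
  (Lp.memLp f).locallyIntegrable one_le_two

/-- **Plancherel's theorem** -/
theorem lintegral_enorm_fourier_sq (f : L2 d) :
    ∫⁻ ξ, ‖(𝓕 f : L2 d) ξ‖ₑ ^ (2 : ℝ) = ∫⁻ x, ‖f x‖ₑ ^ (2 : ℝ) := by
  have h : eLpNorm (𝓕 f : L2 d) 2 volume = eLpNorm f 2 volume := by
    rw [← Lp.enorm_def, ← Lp.enorm_def, ← ofReal_norm, ← ofReal_norm,
      Lp.norm_fourier_eq]
  have h2 := congrArg (· ^ (2 : ℝ)) h
  simp only [eLpNorm_eq_lintegral_rpow_enorm_toReal two_ne_zero ENNReal.ofNat_ne_top,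
    ← ENNReal.rpow_mul] at h2
  simpa using h2

/-- **Parseval's identity** -/
theorem integral_mul_conj_fourier (f h : L2 d) :
    ∫ ξ, (𝓕 f : L2 d) ξ * starRingEnd ℂ ((𝓕 h : L2 d) ξ) = ∫ x, f x * starRingEnd ℂ (h x) := by
  have := Lp.inner_fourier_eq h f
  rw [MeasureTheory.L2.inner_def, MeasureTheory.L2.inner_def] at this
  simpa [RCLike.inner_apply] using this

/-- The phase `ξ ↦ exp (2 π i ⟪z, ξ⟫)`, the Fourier multiplier of the translation by `z`. -/
noncomputable def phase (z ξ : Eu d) : ℂ := Complex.exp ((2 * Real.pi * inner ℝ z ξ : ℝ) * Complex.I)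

theorem norm_phase (z ξ : Eu d) : ‖phase z ξ‖ = 1 := Complex.norm_exp_ofReal_mul_I _

theorem continuous_phase : Continuous fun q : Eu d × Eu d ↦ phase q.1 q.2 := by
  unfold phase; fun_prop

theorem conj_phase (z ξ : Eu d) : starRingEnd ℂ (phase z ξ) = phase (-z) ξ := by
  rw [phase, phase, ← Complex.exp_conj, map_mul, Complex.conj_I, Complex.conj_ofReal,
    inner_neg_left]
  push_cast
  ring_nf

/-- The translate `x ↦ f (x + z)`. -/
noncomputable def translate (z : Eu d) (f : L2 d) : L2 d :=
  Lp.compMeasurePreserving (· + z) (measurePreserving_add_right volume z) f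

theorem coeFn_translate (z : Eu d) (f : L2 d) : translate z f =ᵐ[volume] fun x ↦ f (x + z) :=
  Lp.coeFn_compMeasurePreserving f _

/-- The function `ξ ↦ exp (2 π i ⟪z, ξ⟫) φ(ξ)` as a Schwartz function: the conjugate of a
translation by the Fourier transform. -/
noncomputable def phaseMul (z : Eu d) (φ : 𝓢(Eu d, ℂ)) : 𝓢(Eu d, ℂ) :=
  𝓕⁻ (SchwartzMap.compSubConstCLM ℂ z (𝓕 φ))

theorem phaseMul_apply (z : Eu d) (φ : 𝓢(Eu d, ℂ)) (ξ : Eu d) :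
    phaseMul z φ ξ = phase z ξ * φ ξ := by
  have h1 : φ ξ = (𝓕⁻ (𝓕 φ)) ξ := by simp
  rw [h1, phaseMul, SchwartzMap.fourierInv_coe, SchwartzMap.fourierInv_coe, Real.fourierInv_eq',
    Real.fourierInv_eq', ← integral_const_mul, ← integral_add_right_eq_self _ z]
  congr 1 with x
  rw [SchwartzMap.compSubConstCLM_apply, add_sub_cancel_right, smul_eq_mul, smul_eq_mul,
    ← mul_assoc, phase, ← Complex.exp_add]
  congr 2
  rw [inner_add_left]
  push_cast
  ring

theorem fourier_phaseMul (z : Eu d) (φ : 𝓢(Eu d, ℂ)) (x : Eu d) :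
    (𝓕 (phaseMul z φ)) x = (𝓕 φ) (x - z) := by
  rw [phaseMul, FourierTransform.fourier_fourierInv_eq, SchwartzMap.compSubConstCLM_apply]

theorem fourier_translate (z : Eu d) (f : L2 d) :
    (𝓕 (translate z f) : L2 d) =ᵐ[volume] fun ξ ↦ phase z ξ * (𝓕 f : L2 d) ξ := by
  have hcont : Continuous (phase z) := continuous_phase.comp (by fun_prop : Continuous fun ξ ↦ (z, ξ))
  refine ae_eq_of_integral_schwartz_mul_eq (L2.locallyIntegrable _) ?_ fun φ ↦ ?_
  · exact (L2.locallyIntegrable _).continuous_mul hcont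
  · rw [integral_schwartz_mul_fourier]
    calc ∫ x, (𝓕 φ) x * translate z f x = ∫ x, (𝓕 φ) x * f (x + z) :=
          integral_congr_ae ((coeFn_translate z f).mono fun x hx ↦ by simp only [hx])
      _ = ∫ x, (𝓕 φ) (x - z) * f x := by
          have := integral_add_right_eq_self (fun x ↦ (𝓕 φ) (x - z) * f x) z
            (μ := (volume : Measure (Eu d)))
          simpa only [add_sub_cancel_right] using this
      _ = ∫ x, (𝓕 (phaseMul z φ)) x * f x := by simp_rw [fourier_phaseMul]
      _ = ∫ x, φ x * (phase z x * (𝓕 f : L2 d) x) := by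
          rw [← integral_schwartz_mul_fourier]
          congr 1 with x
          rw [phaseMul_apply]; ring

/-- The difference `x ↦ f (x + z) - f x`. -/
noncomputable def diff (z : Eu d) (f : L2 d) : L2 d := translate z f - f

theorem coeFn_diff (z : Eu d) (f : L2 d) : diff z f =ᵐ[volume] fun x ↦ f (x + z) - f x := by
  filter_upwards [Lp.coeFn_sub (translate z f) f, coeFn_translate z f] with x h1 h2
  rw [diff, h1, Pi.sub_apply, h2]

theorem fourier_diff (z : Eu d) (f : L2 d) :
    (𝓕 (diff z f) : L2 d) =ᵐ[volume] fun ξ ↦ (phase z ξ - 1) * (𝓕 f : L2 d) ξ := by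
  have h : (𝓕 (diff z f) : L2 d) = 𝓕 (translate z f) - 𝓕 f :=
    (Lp.fourierTransformₗᵢ (Eu d) ℂ).map_sub _ _
  rw [h]
  filter_upwards [Lp.coeFn_sub (𝓕 (translate z f)) (𝓕 f), fourier_translate z f] with x h1 h2
  rw [h1, Pi.sub_apply, h2, sub_mul, one_mul]

/-- A function with an integrable Fourier transform is bounded by the inversion formula. -/
theorem ae_enorm_le_lintegral_fourier (f : L2 d) (h : Integrable (𝓕 f : L2 d)) :
    ∀ᵐ x, ‖f x‖ₑ ≤ ∫⁻ ξ, ‖(𝓕 f : L2 d) ξ‖ₑ := by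
  have hb : ∀ x, ‖𝓕⁻ (⇑(𝓕 f : L2 d)) x‖ₑ ≤ ∫⁻ ξ, ‖(𝓕 f : L2 d) ξ‖ₑ := fun x ↦ by
    rw [Real.fourierInv_eq']
    refine (enorm_integral_le_lintegral_enorm _).trans (le_of_eq ?_)
    congr 1 with ξ
    rw [enorm_smul, ← ofReal_norm (Complex.exp _), Complex.norm_exp_ofReal_mul_I]
    simp
  have hcont : Continuous (𝓕⁻ (⇑(𝓕 f : L2 d))) := by
    have : 𝓕⁻ (⇑(𝓕 f : L2 d)) = fun x ↦ 𝓕 (⇑(𝓕 f : L2 d)) (-x) :=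
      funext fun x ↦ Real.fourierInv_eq_fourier_neg _ x
    rw [this]
    exact (VectorFourier.fourierIntegral_continuous Real.continuous_fourierChar
      (by simp only [innerₗ_apply_apply]; fun_prop :
        Continuous fun p : Eu d × Eu d ↦ innerₗ (Eu d) p.1 p.2) h).comp continuous_neg
  have key : f =ᵐ[volume] 𝓕⁻ (⇑(𝓕 f : L2 d)) := by
    refine ae_eq_of_integral_schwartz_mul_eq (L2.locallyIntegrable _) hcont.locallyIntegrable
      fun φ ↦ ?_
    obtain ⟨ψ, rfl⟩ : ∃ ψ : 𝓢(Eu d, ℂ), 𝓕 ψ = φ := ⟨𝓕⁻ φ, by simp⟩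
    rw [← integral_schwartz_mul_fourier]
    have h1 := VectorFourier.integral_fourierIntegral_smul_eq_flip (L := -innerₗ (Eu d))
      (μ := (volume : Measure (Eu d))) (ν := (volume : Measure (Eu d)))
      Real.continuous_fourierChar (by simp only [LinearMap.neg_apply, innerₗ_apply_apply]; fun_prop) h
      (𝓕 ψ).integrable
    have h2 : ∀ x, VectorFourier.fourierIntegral Real.fourierChar volume (-innerₗ (Eu d))
        (⇑(𝓕 f : L2 d)) x = 𝓕⁻ (⇑(𝓕 f : L2 d)) x := fun x ↦ rfl
    have h3 : ∀ x, VectorFourier.fourierIntegral Real.fourierChar volume (-innerₗ (Eu d)).flip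
        (⇑(𝓕 ψ : 𝓢(Eu d, ℂ))) x = ψ x := fun x ↦ by
      have h4 : ψ x = (𝓕⁻ (𝓕 ψ : 𝓢(Eu d, ℂ)) : 𝓢(Eu d, ℂ)) x := by simp
      rw [h4, SchwartzMap.fourierInv_coe, Real.fourierInv_eq]
      simp [VectorFourier.fourierIntegral, real_inner_comm]
    simp only [h2, h3, smul_eq_mul] at h1
    simp only [mul_comm] at h1 ⊢
    rw [h1]
  filter_upwards [key] with x hx
  rw [hx]
  exact hb x

/-! ### The Lévy measure of `(1 - Δ) ^ (s / 2)` -/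

/-- The singularity at `0` is integrable because `s < 2`, and the tail because `0 < s`. -/
theorem integrableOn_one_sub_exp_mul_rpow {s : ℝ} (hs0 : 0 < s) (hs2 : s < 2) {b : ℝ} (hb : 0 ≤ b) :
    IntegrableOn (fun t : ℝ ↦ (1 - Real.exp (-(b * t))) * t ^ (-1 - s / 2)) (Set.Ioi 0) := by
  have hm : AEStronglyMeasurable (fun t : ℝ ↦ (1 - Real.exp (-(b * t))) * t ^ (-1 - s / 2)) volume := by
    apply Measurable.aestronglyMeasurable; fun_prop
  rw [← Set.Ioc_union_Ioi_eq_Ioi zero_le_one]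
  refine IntegrableOn.union ?_ ?_
  · have h1 : IntegrableOn (fun t : ℝ ↦ b * t ^ (- (s / 2))) (Set.Ioc 0 1) := by
      refine Integrable.const_mul ?_ b
      have := intervalIntegral.intervalIntegrable_rpow' (a := 0) (b := 1) (r := -(s / 2))
        (by linarith)
      rwa [intervalIntegrable_iff_integrableOn_Ioc_of_le zero_le_one] at this
    refine Integrable.mono' h1 hm.restrict ((ae_restrict_iff' measurableSet_Ioc).2 (ae_of_all _ ?_))
    rintro t ⟨ht, -⟩
    have e1 : 0 ≤ 1 - Real.exp (-(b * t)) := by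
      have : Real.exp (-(b * t)) ≤ 1 := Real.exp_le_one_iff.2 (by nlinarith)
      linarith
    have e2 : 1 - Real.exp (-(b * t)) ≤ b * t := by
      have := Real.add_one_le_exp (-(b * t)); linarith
    have e3 : t * t ^ (-1 - s / 2) = t ^ (-(s / 2)) := by
      rw [← Real.rpow_one_add' ht.le (by linarith)]; ring_nf
    rw [Real.norm_of_nonneg (mul_nonneg e1 (Real.rpow_nonneg ht.le _)), ← e3, ← mul_assoc]
    exact mul_le_mul_of_nonneg_right e2 (Real.rpow_nonneg ht.le _)
  · have h1 : IntegrableOn (fun t : ℝ ↦ t ^ (-1 - s / 2)) (Set.Ioi 1) :=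
      integrableOn_Ioi_rpow_of_lt (by linarith) one_pos
    refine Integrable.mono' h1 hm.restrict ((ae_restrict_iff' measurableSet_Ioi).2 (ae_of_all _ ?_))
    intro t ht
    have ht : 1 < t := ht
    have e1 : 0 ≤ 1 - Real.exp (-(b * t)) := by
      have : Real.exp (-(b * t)) ≤ 1 := Real.exp_le_one_iff.2 (by nlinarith)
      linarith
    have e2 : 1 - Real.exp (-(b * t)) ≤ 1 := by linarith [Real.exp_pos (-(b * t))]
    have e3 : 0 ≤ t ^ (-1 - s / 2) := Real.rpow_nonneg (by linarith) _
    rw [Real.norm_of_nonneg (mul_nonneg e1 e3)]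
    nlinarith

/-- The normalising constant of the subordinator. The integral converges for `0 < s < 2`. -/
noncomputable def subConst (s : ℝ) : ℝ := ∫ t in Set.Ioi (0 : ℝ), (1 - Real.exp (-t)) * t ^ (-1 - s / 2)

theorem subConst_pos {s : ℝ} (hs0 : 0 < s) (hs2 : s < 2) : 0 < subConst s := by
  have hi := integrableOn_one_sub_exp_mul_rpow hs0 hs2 zero_le_one
  simp only [one_mul] at hi
  have hp : ∀ t ∈ Set.Ioi (0 : ℝ), 0 < (1 - Real.exp (-t)) * t ^ (-1 - s / 2) := fun t ht ↦ by
    have : Real.exp (-t) < 1 := by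
      rw [← Real.exp_zero]; exact Real.exp_lt_exp.2 (by simpa using ht)
    exact mul_pos (by linarith) (Real.rpow_pos_of_pos ht _)
  rw [subConst, setIntegral_pos_iff_support_of_nonneg_ae _ hi]
  · refine lt_of_lt_of_le ?_ (measure_mono (s := Set.Ioi (0 : ℝ)) fun t ht ↦ ⟨(hp t ht).ne', ht⟩)
    simp
  · exact (ae_restrict_iff' measurableSet_Ioi).2 (ae_of_all _ fun t ht ↦ (hp t ht).le)

theorem integral_one_sub_exp_mul_rpow (s : ℝ) {b : ℝ} (hb : 0 < b) :
    ∫ t in Set.Ioi (0 : ℝ), (1 - Real.exp (-(b * t))) * t ^ (-1 - s / 2) =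
      b ^ (s / 2) * subConst s := by
  have h := integral_comp_mul_left_Ioi (fun t ↦ (1 - Real.exp (-t)) * t ^ (-1 - s / 2)) 0 hb
  rw [mul_zero, smul_eq_mul] at h
  have h2 : b ^ (1 + s / 2) * b⁻¹ = b ^ (s / 2) := by
    rw [← Real.rpow_neg_one, ← Real.rpow_add hb]; ring_nf
  rw [subConst, ← h2, mul_assoc, ← h, ← integral_const_mul]
  refine setIntegral_congr_fun measurableSet_Ioi fun t ht ↦ ?_
  have ht : 0 < t := ht
  have h3 : b ^ (1 + s / 2) * b ^ (-1 - s / 2) = 1 := by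
    rw [← Real.rpow_add hb]; ring_nf; simp
  rw [Real.mul_rpow hb.le ht.le]
  linear_combination (-(1 - Real.exp (-(b * t))) * t ^ (-1 - s / 2)) * h3

/-- The Lévy measure of the subordinator with Laplace exponent `(1 + a) ^ (s / 2) - 1`. -/
noncomputable def subordinator (s : ℝ) : Measure ℝ :=
  (volume.restrict (Set.Ioi 0)).withDensity
    fun t ↦ ENNReal.ofReal (Real.exp (-t) * t ^ (-1 - s / 2) / subConst s)

instance (s : ℝ) : SigmaFinite (subordinator s) := by
  unfold subordinator
  exact SigmaFinite.withDensity_ofReal _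

theorem lintegral_subordinator (s : ℝ) {f : ℝ → ℝ≥0∞} (hf : Measurable f) :
    ∫⁻ t, f t ∂subordinator s =
      ∫⁻ t in Set.Ioi 0, ENNReal.ofReal (Real.exp (-t) * t ^ (-1 - s / 2) / subConst s) * f t := by
  rw [subordinator, lintegral_withDensity_eq_lintegral_mul _ (by fun_prop) hf]
  rfl

/-- The Laplace exponent of the subordinator, from
`(1 - exp (-a t)) exp (-t) = (1 - exp (-(1 + a) t)) - (1 - exp (-t))`. -/
theorem lintegral_one_sub_exp_subordinator {s : ℝ} (hs0 : 0 < s) (hs2 : s < 2) {a : ℝ} (ha : 0 ≤ a) :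
    ∫⁻ t, ENNReal.ofReal (1 - Real.exp (-(a * t))) ∂subordinator s =
      ENNReal.ofReal ((1 + a) ^ (s / 2) - 1) := by
  have hc := subConst_pos hs0 hs2
  have hi1 := integrableOn_one_sub_exp_mul_rpow hs0 hs2 (b := 1 + a) (by linarith)
  have hi2 := integrableOn_one_sub_exp_mul_rpow hs0 hs2 (b := 1) (by linarith)
  have h1 := integral_one_sub_exp_mul_rpow s (b := 1 + a) (by linarith)
  have h2 := integral_one_sub_exp_mul_rpow s (b := 1) (by linarith)
  rw [lintegral_subordinator s (by fun_prop)]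
  have hcongr : ∀ t ∈ Set.Ioi (0 : ℝ),
      ENNReal.ofReal (Real.exp (-t) * t ^ (-1 - s / 2) / subConst s) *
        ENNReal.ofReal (1 - Real.exp (-(a * t))) =
      ENNReal.ofReal (((1 - Real.exp (-((1 + a) * t))) * t ^ (-1 - s / 2) -
        (1 - Real.exp (-(1 * t))) * t ^ (-1 - s / 2)) / subConst s) := fun t ht ↦ by
    have ht : 0 < t := ht
    rw [← ENNReal.ofReal_mul (by positivity)]
    congr 1
    have : Real.exp (-((1 + a) * t)) = Real.exp (-t) * Real.exp (-(a * t)) := by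
      rw [← Real.exp_add]; ring_nf
    rw [this]
    field_simp
    ring_nf
  rw [setLIntegral_congr_fun measurableSet_Ioi hcongr, ← ofReal_integral_eq_lintegral_ofReal]
  · rw [integral_div, integral_sub hi1 hi2, h1, h2, Real.one_rpow]
    congr 1
    field_simp
  · exact (hi1.sub hi2).div_const _
  · refine (ae_restrict_iff' measurableSet_Ioi).2 (ae_of_all _ fun t ht ↦ ?_)
    have ht : 0 < t := ht
    have : Real.exp (-((1 + a) * t)) ≤ Real.exp (-(1 * t)) :=
      Real.exp_le_exp.2 (by nlinarith)
    refine div_nonneg ?_ hc.le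
    rw [← sub_mul]
    exact mul_nonneg (by linarith) (by positivity)

/-- The Lévy measure of `(1 - Δ) ^ (s / 2)`, presented as a product measure: the jump
belonging to `(y, t)` is the Gaussian vector `√(2 t) • y` at the time `t` of the subordinator. -/
noncomputable def levy (d : ℕ) (s : ℝ) : Measure (Eu d × ℝ) :=
  (ProbabilityTheory.stdGaussian (Eu d)).prod (subordinator s)

instance (s : ℝ) : SigmaFinite (levy d s) := by unfold levy; infer_instance

/-- The jump belonging to `(y, t)`. -/
noncomputable def step (q : Eu d × ℝ) : Eu d := √(2 * q.2) • q.1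

theorem measurable_step : Measurable (step : Eu d × ℝ → Eu d) := by
  unfold step; fun_prop

theorem measurable_phase_step (ξ : Eu d) : Measurable fun q : Eu d × ℝ ↦ phase (step q) ξ :=
  have h : Continuous fun z ↦ phase z ξ := by unfold phase; fun_prop
  h.measurable.comp measurable_step

/-- The jump at the time `t` is a Gaussian vector of covariance `2 t`, whose characteristic function
is the heat multiplier `exp (-t |2 π ξ| ^ 2)`. -/
theorem integral_phase_gaussian (ξ : Eu d) {t : ℝ} (ht : 0 ≤ t) :
    ∫ y, phase (step (y, t)) ξ ∂(ProbabilityTheory.stdGaussian (Eu d)) =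
      Real.exp (-((2 * Real.pi * ‖ξ‖) ^ 2 * t)) := by
  have h := ProbabilityTheory.charFun_stdGaussian (E := Eu d) ((2 * Real.pi * √(2 * t)) • ξ)
  rw [charFun_apply] at h
  have h1 : ∀ y : Eu d, phase (step (y, t)) ξ =
      Complex.exp ((inner ℝ y ((2 * Real.pi * √(2 * t)) • ξ) : ℝ) * Complex.I) := fun y ↦ by
    rw [phase, step, inner_smul_left, inner_smul_right]
    congr 3
    simp only [conj_trivial]; ring
  simp_rw [h1]
  rw [h]
  push_cast
  congr 1
  have h2 : ‖(2 * Real.pi * √(2 * t)) • ξ‖ ^ 2 = (2 * Real.pi) ^ 2 * (2 * t) * ‖ξ‖ ^ 2 := by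
    rw [norm_smul, mul_pow, Real.norm_eq_abs, sq_abs, mul_pow, Real.sq_sqrt (by linarith)]
  rw [← Complex.ofReal_pow, h2]
  push_cast
  ring

theorem one_sub_re_phase_nonneg (z ξ : Eu d) : 0 ≤ 1 - (phase z ξ).re := by
  have := (Complex.re_le_norm (phase z ξ)).trans_eq (norm_phase z ξ)
  linarith

theorem integrable_phase_gaussian (ξ : Eu d) (t : ℝ) :
    Integrable (fun y ↦ phase (step (y, t)) ξ) (ProbabilityTheory.stdGaussian (Eu d)) := by
  refine Integrable.of_bound ?_ 1 (ae_of_all _ fun y ↦ (norm_phase _ _).le)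
  exact ((measurable_phase_step ξ).comp (measurable_id.prodMk measurable_const)).aestronglyMeasurable

theorem lintegral_one_sub_phase_gaussian (ξ : Eu d) {t : ℝ} (ht : 0 ≤ t) :
    ∫⁻ y, ENNReal.ofReal (1 - (phase (step (y, t)) ξ).re) ∂(ProbabilityTheory.stdGaussian (Eu d)) =
      ENNReal.ofReal (1 - Real.exp (-((2 * Real.pi * ‖ξ‖) ^ 2 * t))) := by
  have hi := integrable_phase_gaussian ξ t
  have hr : Integrable (fun y ↦ (phase (step (y, t)) ξ).re)
      (ProbabilityTheory.stdGaussian (Eu d)) := hi.re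
  rw [← ofReal_integral_eq_lintegral_ofReal (f := fun y ↦ 1 - (phase (step (y, t)) ξ).re)
    ((integrable_const _).sub hr) (ae_of_all _ fun y ↦ one_sub_re_phase_nonneg _ _),
    integral_sub (integrable_const _) hr]
  congr 1
  have := integral_re hi
  simp only [RCLike.re_to_complex] at this
  rw [this, integral_phase_gaussian ξ ht, Complex.ofReal_re]
  simp

theorem ae_pos_subordinator (s : ℝ) : ∀ᵐ t ∂subordinator s, 0 < t :=
  (withDensity_absolutelyContinuous _ _).ae_le
    ((ae_restrict_iff' measurableSet_Ioi).2 (ae_of_all _ fun _ ht ↦ ht))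

theorem continuous_symbol (s : ℝ) : Continuous (symbol d s) := by
  unfold symbol
  exact Continuous.rpow_const (by fun_prop) fun ξ ↦ Or.inl (by positivity)

theorem one_le_symbol {s : ℝ} (hs : 0 ≤ s) (ξ : Eu d) : 1 ≤ symbol d s ξ :=
  Real.one_le_rpow (by nlinarith [sq_nonneg (2 * Real.pi * ‖ξ‖)]) (by linarith)

theorem symbol_pos (s : ℝ) (ξ : Eu d) : 0 < symbol d s ξ :=
  Real.rpow_pos_of_pos (by positivity) _

theorem symbol_mul (s t : ℝ) (ξ : Eu d) : symbol d s ξ * symbol d t ξ = symbol d (s + t) ξ := by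
  rw [symbol, symbol, symbol, ← Real.rpow_add (by positivity)]; ring_nf

theorem symbol_mono {s t : ℝ} (h : s ≤ t) (ξ : Eu d) : symbol d s ξ ≤ symbol d t ξ :=
  Real.rpow_le_rpow_of_exponent_le (by nlinarith [sq_nonneg (2 * Real.pi * ‖ξ‖)]) (by linarith)

/-- The Lévy–Khintchine formula for the symbol of `(1 - Δ) ^ (s / 2)`. -/
theorem lintegral_one_sub_phase_levy {s : ℝ} (hs0 : 0 < s) (hs2 : s < 2) (ξ : Eu d) :
    ∫⁻ q, ENNReal.ofReal (1 - (phase (step q) ξ).re) ∂levy d s =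
      ENNReal.ofReal (symbol d s ξ - 1) := by
  have hm : Measurable fun q : Eu d × ℝ ↦ ENNReal.ofReal (1 - (phase (step q) ξ).re) :=
    (measurable_const.sub (Complex.measurable_re.comp (measurable_phase_step ξ))).ennreal_ofReal
  rw [levy, lintegral_prod_symm _ hm.aemeasurable, symbol,
    ← lintegral_one_sub_exp_subordinator hs0 hs2 (sq_nonneg _)]
  refine lintegral_congr_ae ((ae_pos_subordinator s).mono fun t ht ↦ ?_)
  exact lintegral_one_sub_phase_gaussian ξ ht.le

theorem norm_phase_sub_one_sq (z ξ : Eu d) : ‖phase z ξ - 1‖ ^ 2 = 2 * (1 - (phase z ξ).re) := by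
  have h := norm_phase z ξ
  rw [← Complex.normSq_eq_norm_sq, Complex.normSq_sub]
  rw [Complex.normSq_eq_norm_sq, h]
  simp; ring

/-- The form of the Lévy–Khintchine formula used for square-integrated differences. -/
theorem lintegral_phase_sub_one_sq_levy {s : ℝ} (hs0 : 0 < s) (hs2 : s < 2) (ξ : Eu d) :
    ∫⁻ q, ‖phase (step q) ξ - 1‖ₑ ^ (2 : ℝ) ∂levy d s ≤
      2 * ENNReal.ofReal (symbol d s ξ) := by
  have h : ∀ q : Eu d × ℝ, ‖phase (step q) ξ - 1‖ₑ ^ (2 : ℝ) =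
      2 * ENNReal.ofReal (1 - (phase (step q) ξ).re) := fun q ↦ by
    rw [← ofReal_norm, ENNReal.ofReal_rpow_of_nonneg (norm_nonneg _) two_pos.le, Real.rpow_two,
      norm_phase_sub_one_sq, ENNReal.ofReal_mul two_pos.le, ENNReal.ofReal_ofNat]
  simp_rw [h]
  rw [lintegral_const_mul' _ _ ENNReal.ofNat_ne_top, lintegral_one_sub_phase_levy hs0 hs2]
  gcongr
  linarith

/-! ### Truncation of the Lévy measure -/

/-- The Lévy measure restricted to the jumps at times larger than `1 / (n + 1)`. -/
noncomputable def levyTrunc (d : ℕ) (s : ℝ) (n : ℕ) : Measure (Eu d × ℝ) :=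
  (levy d s).restrict (Set.univ ×ˢ Set.Ioi (1 / ((n : ℝ) + 1)))

theorem levyTrunc_eq (s : ℝ) (n : ℕ) : levyTrunc d s n =
    (ProbabilityTheory.stdGaussian (Eu d)).prod
      ((subordinator s).restrict (Set.Ioi (1 / ((n : ℝ) + 1)))) := by
  rw [levyTrunc, levy, ← Measure.prod_restrict, Measure.restrict_univ]

theorem isFiniteMeasure_restrict_subordinator {s : ℝ} (hs0 : 0 < s) (hs2 : s < 2) {r : ℝ} (hr : 0 < r) :
    IsFiniteMeasure ((subordinator s).restrict (Set.Ioi r)) := by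
  refine ⟨?_⟩
  rw [Measure.restrict_apply_univ]
  have hc := subConst_pos hs0 hs2
  rw [subordinator, withDensity_apply _ measurableSet_Ioi, Measure.restrict_restrict measurableSet_Ioi,
    Set.inter_eq_self_of_subset_left (Set.Ioi_subset_Ioi hr.le)]
  have hi : IntegrableOn (fun t : ℝ ↦ t ^ (-1 - s / 2)) (Set.Ioi r) :=
    integrableOn_Ioi_rpow_of_lt (by linarith) hr
  refine lt_of_le_of_lt ?_ (hi.div_const (subConst s)).lintegral_lt_top
  refine setLIntegral_mono (by fun_prop) fun t ht ↦ ENNReal.ofReal_le_ofReal ?_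
  have ht : 0 < t := hr.trans ht
  gcongr
  have : Real.exp (-t) ≤ 1 := Real.exp_le_one_iff.2 (by linarith)
  nlinarith [Real.rpow_nonneg ht.le (-1 - s / 2)]

theorem isFiniteMeasure_levyTrunc {s : ℝ} (hs0 : 0 < s) (hs2 : s < 2) (n : ℕ) :
    IsFiniteMeasure (levyTrunc d s n) := by
  have := isFiniteMeasure_restrict_subordinator hs0 hs2 (r := 1 / ((n : ℝ) + 1)) (by positivity)
  rw [levyTrunc_eq]
  infer_instance

/-- The symbol of the truncated operator. -/
noncomputable def symbolTrunc (d : ℕ) (s : ℝ) (n : ℕ) (ξ : Eu d) : ℝ :=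
  ∫ q, (1 - (phase (step q) ξ).re) ∂levyTrunc d s n

theorem integrable_one_sub_re_phase {s : ℝ} (hs0 : 0 < s) (hs2 : s < 2) (ξ : Eu d) :
    Integrable (fun q ↦ 1 - (phase (step q) ξ).re) (levy d s) := by
  have hm : Measurable fun q : Eu d × ℝ ↦ 1 - (phase (step q) ξ).re :=
    measurable_const.sub (Complex.measurable_re.comp (measurable_phase_step ξ))
  refine ⟨hm.aestronglyMeasurable, ?_⟩
  rw [hasFiniteIntegral_iff_ofReal (ae_of_all _ fun q ↦ one_sub_re_phase_nonneg _ _),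
    lintegral_one_sub_phase_levy hs0 hs2]
  exact ENNReal.ofReal_lt_top

theorem integral_one_sub_re_phase {s : ℝ} (hs0 : 0 < s) (hs2 : s < 2) (ξ : Eu d) :
    ∫ q, (1 - (phase (step q) ξ).re) ∂levy d s = symbol d s ξ - 1 := by
  rw [integral_eq_lintegral_of_nonneg_ae (ae_of_all _ fun q ↦ one_sub_re_phase_nonneg _ _)
    (integrable_one_sub_re_phase hs0 hs2 ξ).1, lintegral_one_sub_phase_levy hs0 hs2,
    ENNReal.toReal_ofReal]
  linarith [one_le_symbol hs0.le ξ]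

theorem symbolTrunc_nonneg (s : ℝ) (n : ℕ) (ξ : Eu d) : 0 ≤ symbolTrunc d s n ξ :=
  integral_nonneg fun _ ↦ one_sub_re_phase_nonneg _ _

theorem symbolTrunc_le {s : ℝ} (hs0 : 0 < s) (hs2 : s < 2) (n : ℕ) (ξ : Eu d) :
    symbolTrunc d s n ξ ≤ symbol d s ξ - 1 := by
  rw [← integral_one_sub_re_phase hs0 hs2]
  exact setIntegral_le_integral (integrable_one_sub_re_phase hs0 hs2 ξ)
    (ae_of_all _ fun q ↦ one_sub_re_phase_nonneg _ _)

/-- The truncated integrals exhaust the integral against the Lévy measure. -/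
theorem tendsto_integral_levyTrunc {G : Type*} [NormedAddCommGroup G] [NormedSpace ℝ G]
    (s : ℝ) {f : Eu d × ℝ → G} (hf : Integrable f (levy d s)) :
    Tendsto (fun n ↦ ∫ q, f q ∂levyTrunc d s n) atTop (𝓝 (∫ q, f q ∂levy d s)) := by
  have hU : ∀ᵐ q ∂levy d s, q ∈ ⋃ n : ℕ,
      (Set.univ ×ˢ Set.Ioi (1 / ((n : ℝ) + 1)) : Set (Eu d × ℝ)) := by
    have h0 : ∀ᵐ q ∂levy d s, 0 < q.2 :=
      Measure.quasiMeasurePreserving_snd.ae (ae_pos_subordinator s)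
    filter_upwards [h0] with q hq
    obtain ⟨n, hn⟩ := exists_nat_one_div_lt hq
    exact Set.mem_iUnion.2 ⟨n, ⟨trivial, hn⟩⟩
  have h := tendsto_setIntegral_of_monotone (μ := levy d s) (f := f)
    (s := fun n : ℕ ↦ (Set.univ ×ˢ Set.Ioi (1 / ((n : ℝ) + 1)) : Set (Eu d × ℝ)))
    (fun n ↦ MeasurableSet.univ.prod measurableSet_Ioi)
    (fun m n hmn ↦ Set.prod_mono le_rfl (Set.Ioi_subset_Ioi (by
      have : (m : ℝ) ≤ n := Nat.cast_le.2 hmn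
      gcongr)))
    hf.integrableOn
  rwa [← setIntegral_univ (f := f), ← setIntegral_congr_set
    (s := ⋃ n : ℕ, (Set.univ ×ˢ Set.Ioi (1 / ((n : ℝ) + 1)) : Set (Eu d × ℝ)))
    (t := Set.univ) (eventuallyEq_univ.2 hU)]

theorem tendsto_symbolTrunc {s : ℝ} (hs0 : 0 < s) (hs2 : s < 2) (ξ : Eu d) :
    Tendsto (fun n ↦ symbolTrunc d s n ξ) atTop (𝓝 (symbol d s ξ - 1)) := by
  rw [← integral_one_sub_re_phase hs0 hs2]
  exact tendsto_integral_levyTrunc s (integrable_one_sub_re_phase hs0 hs2 ξ)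

theorem measurePreserving_neg_levyTrunc (s : ℝ) (n : ℕ) :
    MeasurePreserving (fun q : Eu d × ℝ ↦ (-q.1, q.2)) (levyTrunc d s n) (levyTrunc d s n) := by
  rw [levyTrunc_eq]
  refine MeasurePreserving.prod ⟨measurable_neg, ?_⟩ (MeasurePreserving.id _)
  have : IsProbabilityMeasure ((ProbabilityTheory.stdGaussian (Eu d)).map (fun y ↦ -y)) :=
    Measure.isProbabilityMeasure_map measurable_neg.aemeasurable
  refine Measure.ext_of_charFun (funext fun t ↦ ?_)
  rw [charFun_apply, integral_map measurable_neg.aemeasurable (by fun_prop)]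
  have := ProbabilityTheory.charFun_stdGaussian (E := Eu d) (-t)
  rw [norm_neg, ← ProbabilityTheory.charFun_stdGaussian, charFun_apply] at this
  rw [← this]
  simp

theorem step_neg (q : Eu d × ℝ) : step (-q.1, q.2) = -step q := by simp [step]

theorem integral_step_neg (s : ℝ) (n : ℕ) (f : Eu d → ℂ) :
    ∫ q, f (-step q) ∂levyTrunc d s n = ∫ q, f (step q) ∂levyTrunc d s n := by
  have he : MeasurableEmbedding (fun q : Eu d × ℝ ↦ (-q.1, q.2)) :=
    ((MeasurableEquiv.neg (Eu d)).prodCongr (MeasurableEquiv.refl ℝ)).measurableEmbedding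
  rw [← (measurePreserving_neg_levyTrunc s n).integral_comp he (fun q ↦ f (step q))]
  simp_rw [step_neg]

theorem integral_one_sub_phase_levyTrunc {s : ℝ} (hs0 : 0 < s) (hs2 : s < 2) (n : ℕ) (ξ : Eu d) :
    ∫ q, (1 - phase (step q) ξ) ∂levyTrunc d s n = symbolTrunc d s n ξ := by
  have := isFiniteMeasure_levyTrunc (d := d) hs0 hs2 n
  have hi : Integrable (fun q ↦ 1 - phase (step q) ξ) (levyTrunc d s n) := by
    refine Integrable.of_bound (measurable_const.sub
      (measurable_phase_step ξ)).aestronglyMeasurable 2 (ae_of_all _ fun y ↦ ?_)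
    refine (norm_sub_le _ _).trans ?_
    rw [norm_phase]; norm_num
  -- the imaginary part vanishes because the measure is symmetric
  have hconj : starRingEnd ℂ (∫ q, (1 - phase (step q) ξ) ∂levyTrunc d s n) =
      ∫ q, (1 - phase (step q) ξ) ∂levyTrunc d s n := by
    rw [← integral_conj, ← integral_step_neg s n (fun z ↦ 1 - phase z ξ)]
    simp [conj_phase]
  rw [← Complex.conj_eq_iff_re.1 hconj, symbolTrunc]
  congr 1
  have := integral_re hi
  simp only [RCLike.re_to_complex] at this
  rw [← this]
  simp

/-! ### Hölder's and Minkowski's inequalities for nonnegative functions -/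

section lnorm

variable {α β : Type*} [MeasurableSpace α] [MeasurableSpace β] {μ : Measure α} {ν : Measure β}

/-- The `Lᵖ` norm of a nonnegative function, for a real exponent `p > 0`. -/
noncomputable def lnorm (p : ℝ) (f : α → ℝ≥0∞) (μ : Measure α) : ℝ≥0∞ :=
  (∫⁻ x, f x ^ p ∂μ) ^ (1 / p)

theorem eLpNorm_ofReal_eq_lnorm {p : ℝ} (hp : 0 < p) (f : α → ℂ) :
    eLpNorm f (ENNReal.ofReal p) μ = lnorm p (fun x ↦ ‖f x‖ₑ) μ := by
  rw [eLpNorm_eq_lintegral_rpow_enorm_toReal (by simpa using hp) ENNReal.ofReal_ne_top,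
    ENNReal.toReal_ofReal hp.le, lnorm]

theorem eLpNorm_two_eq_lnorm (f : α → ℂ) : eLpNorm f 2 μ = lnorm 2 (fun x ↦ ‖f x‖ₑ) μ := by
  rw [← eLpNorm_ofReal_eq_lnorm two_pos, ENNReal.ofReal_ofNat]

theorem lnorm_two_rpow (f : α → ℝ≥0∞) : lnorm 2 f μ ^ (2 : ℝ) = ∫⁻ x, f x ^ (2 : ℝ) ∂μ := by
  rw [lnorm, ← ENNReal.rpow_mul]; norm_num

theorem lnorm_mono_ae {p : ℝ} (hp : 0 < p) {f g : α → ℝ≥0∞} (h : ∀ᵐ x ∂μ, f x ≤ g x) :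
    lnorm p f μ ≤ lnorm p g μ := by
  refine ENNReal.rpow_le_rpow (lintegral_mono_ae (h.mono fun x hx ↦ ?_)) (by positivity)
  exact ENNReal.rpow_le_rpow hx hp.le

theorem lnorm_mono {p : ℝ} (hp : 0 < p) {f g : α → ℝ≥0∞} (h : ∀ x, f x ≤ g x) :
    lnorm p f μ ≤ lnorm p g μ := lnorm_mono_ae hp (ae_of_all _ h)

theorem lnorm_congr_ae {p : ℝ} {f g : α → ℝ≥0∞} (h : f =ᵐ[μ] g) : lnorm p f μ = lnorm p g μ := by
  have h' : (fun x ↦ f x ^ p) =ᵐ[μ] fun x ↦ g x ^ p := h.mono fun x hx ↦ by simp only [hx]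
  rw [lnorm, lnorm, lintegral_congr_ae h']

theorem lnorm_const_mul {p : ℝ} (hp : 0 < p) {c : ℝ≥0∞} (hc : c ≠ ∞) (f : α → ℝ≥0∞) :
    lnorm p (fun x ↦ c * f x) μ = c * lnorm p f μ := by
  simp_rw [lnorm, ENNReal.mul_rpow_of_nonneg _ _ hp.le]
  rw [lintegral_const_mul' _ _ (by simp [hc, hp.le]), ENNReal.mul_rpow_of_nonneg _ _ (by positivity),
    ← ENNReal.rpow_mul, mul_one_div_cancel hp.ne', ENNReal.rpow_one]

theorem lnorm_add_le {p : ℝ} (hp : 1 ≤ p) {f g : α → ℝ≥0∞} (hf : AEMeasurable f μ)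
    (hg : AEMeasurable g μ) : lnorm p (fun x ↦ f x + g x) μ ≤ lnorm p f μ + lnorm p g μ :=
  ENNReal.lintegral_Lp_add_le hf hg hp

theorem lnorm_rpow {p r : ℝ} (hp : 0 < p) (hr : 0 < r) (f : α → ℝ≥0∞) :
    lnorm p (fun x ↦ f x ^ r) μ = lnorm (p * r) f μ ^ r := by
  simp_rw [lnorm, ← ENNReal.rpow_mul]
  rw [mul_comm r p]
  congr 1
  field_simp

/-- **Hölder's inequality** for a product of powers. -/
theorem lnorm_rpow_mul_rpow_le {p a b i j : ℝ} (hp : 0 < p) (ha : 0 < a) (hb : 0 < b) (hi : 0 ≤ i)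
    (hj : 0 ≤ j) (h : i / a + j / b = 1 / p) {f g : α → ℝ≥0∞} (hf : AEMeasurable f μ)
    (hg : AEMeasurable g μ) :
    lnorm p (fun x ↦ f x ^ i * g x ^ j) μ ≤ lnorm a f μ ^ i * lnorm b g μ ^ j := by
  have h1 : p * (i / a) + p * (j / b) = 1 := by
    rw [← mul_add, h]; field_simp
  have h2 := ENNReal.lintegral_mul_norm_pow_le (hf.pow_const a) (hg.pow_const b)
    (p := p * (i / a)) (q := p * (j / b)) (by positivity) (by positivity) h1
  have h3 : ∀ x, (f x ^ i * g x ^ j) ^ p = (f x ^ a) ^ (p * (i / a)) * (g x ^ b) ^ (p * (j / b)) :=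
    fun x ↦ by
    rw [ENNReal.mul_rpow_of_nonneg _ _ hp.le, ← ENNReal.rpow_mul, ← ENNReal.rpow_mul,
      ← ENNReal.rpow_mul, ← ENNReal.rpow_mul]
    congr 2 <;> field_simp
  unfold lnorm
  simp_rw [h3]
  refine (ENNReal.rpow_le_rpow h2 (by positivity)).trans (le_of_eq ?_)
  rw [ENNReal.mul_rpow_of_nonneg _ _ (by positivity), ← ENNReal.rpow_mul, ← ENNReal.rpow_mul,
    ← ENNReal.rpow_mul, ← ENNReal.rpow_mul]
  congr 2 <;> field_simp

/-- Hölder's inequality, in the form in which it is used for the dual exponent in Minkowski's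
inequality. -/
theorem lintegral_mul_le_lnorm {p : ℝ} (hp : 1 < p) {f g : α → ℝ≥0∞} (hf : AEMeasurable f μ)
    (hg : AEMeasurable g μ) :
    ∫⁻ x, f x ^ (p - 1) * g x ∂μ ≤ (∫⁻ x, f x ^ p ∂μ) ^ (1 - 1 / p) * lnorm p g μ := by
  have hp0 : 0 < p := by linarith
  have h := lnorm_rpow_mul_rpow_le (μ := μ) (p := 1) (a := p) (b := p) (i := p - 1) (j := 1) one_pos
    hp0 hp0 (by linarith) zero_le_one (by field_simp; ring) hf hg
  have h1 : lnorm p f μ ^ (p - 1) = (∫⁻ x, f x ^ p ∂μ) ^ (1 - 1 / p) := by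
    rw [lnorm, ← ENNReal.rpow_mul]; congr 1; field_simp
  rw [h1] at h
  simpa [lnorm] using h

/-- **Minkowski's integral inequality** -/
theorem lnorm_lintegral_le [SigmaFinite μ] [SFinite ν] {p : ℝ} (hp : 1 ≤ p) {f : α → β → ℝ≥0∞}
    (hf : Measurable (Function.uncurry f)) :
    lnorm p (fun x ↦ ∫⁻ y, f x y ∂ν) μ ≤ ∫⁻ y, lnorm p (fun x ↦ f x y) μ ∂ν := by
  rcases hp.eq_or_lt with rfl | hp1
  · simp only [lnorm, ENNReal.rpow_one, div_one]
    exact (lintegral_lintegral_swap hf.aemeasurable).le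
  have hp0 : 0 < p := by linarith
  set H : α → ℝ≥0∞ := fun x ↦ ∫⁻ y, f x y ∂ν with hH
  have hHm : Measurable H := hf.lintegral_prod_right'
  set I := ∫⁻ y, lnorm p (fun x ↦ f x y) μ ∂ν with hI
  -- truncations of `H`, which have a finite norm
  let Hn : ℕ → α → ℝ≥0∞ := fun n ↦ (spanningSets μ n).indicator fun x ↦ min (H x) n
  have hHn : ∀ n, Measurable (Hn n) := fun n ↦
    (hHm.min measurable_const).indicator (measurableSet_spanningSets μ n)
  have hle : ∀ n x, Hn n x ≤ H x := fun n x ↦ by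
    by_cases hx : x ∈ spanningSets μ n <;> simp [Hn, hx]
  have hfin : ∀ n, ∫⁻ x, Hn n x ^ p ∂μ ≠ ∞ := fun n ↦ by
    have h1 : ∫⁻ x, Hn n x ^ p ∂μ ≤ ∫⁻ x in spanningSets μ n, (n : ℝ≥0∞) ^ p ∂μ := by
      rw [← lintegral_indicator (measurableSet_spanningSets μ n)]
      refine lintegral_mono fun x ↦ ?_
      by_cases hx : x ∈ spanningSets μ n
      · simp only [Hn, hx, Set.indicator_of_mem]
        exact ENNReal.rpow_le_rpow (min_le_right _ _) hp0.le
      · simp [Hn, hx, hp0]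
    refine (h1.trans_lt ?_).ne
    rw [setLIntegral_const]
    exact ENNReal.mul_lt_top (ENNReal.rpow_lt_top_of_nonneg hp0.le (by simp))
      (measure_spanningSets_lt_top μ n)
  have key : ∀ n, ∫⁻ x, Hn n x ^ p ∂μ ≤ I ^ p := fun n ↦ by
    set K := ∫⁻ x, Hn n x ^ p ∂μ with hK
    have h1 : K ≤ K ^ (1 - 1 / p) * I := calc
      K ≤ ∫⁻ x, Hn n x ^ (p - 1) * H x ∂μ := by
          refine lintegral_mono fun x ↦ ?_
          have : Hn n x ^ p = Hn n x ^ (p - 1) * Hn n x := by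
            have h2 := ENNReal.rpow_add_of_nonneg (x := Hn n x) (p - 1) 1 (by linarith) zero_le_one
            rwa [sub_add_cancel, ENNReal.rpow_one] at h2
          simp only [this]
          gcongr
          exact hle n x
      _ = ∫⁻ x, ∫⁻ y, Hn n x ^ (p - 1) * f x y ∂ν ∂μ := by
          refine lintegral_congr fun x ↦ ?_
          exact (lintegral_const_mul _ (hf.comp measurable_prodMk_left)).symm
      _ = ∫⁻ y, ∫⁻ x, Hn n x ^ (p - 1) * f x y ∂μ ∂ν :=
          lintegral_lintegral_swap ((((hHn n).pow_const _).comp measurable_fst).mul hf).aemeasurable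
      _ ≤ ∫⁻ y, K ^ (1 - 1 / p) * lnorm p (fun x ↦ f x y) μ ∂ν :=
          lintegral_mono fun y ↦ lintegral_mul_le_lnorm hp1 (hHn n).aemeasurable
            (hf.comp measurable_prodMk_right).aemeasurable
      _ = K ^ (1 - 1 / p) * I := by
          rw [lintegral_const_mul' _ _ (ENNReal.rpow_ne_top_of_nonneg (by
            rw [sub_nonneg, div_le_one hp0]; exact hp) (hfin n))]
    by_cases hK0 : K = 0
    · rw [hK0]; exact zero_le
    have h2 : K = K ^ (1 - 1 / p) * K ^ (1 / p) := by
      rw [← ENNReal.rpow_add _ _ hK0 (hfin n)]; simp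
    have h3 : K ^ (1 / p) ≤ I := by
      have hne0 : K ^ (1 - 1 / p) ≠ 0 := by
        simp only [ne_eq, ENNReal.rpow_eq_zero_iff, not_or, not_and]
        exact ⟨fun h ↦ absurd h hK0, fun h ↦ absurd h (hfin n)⟩
      have hnet : K ^ (1 - 1 / p) ≠ ∞ := ENNReal.rpow_ne_top_of_nonneg (by
            rw [sub_nonneg, div_le_one hp0]; exact hp) (hfin n)
      rw [← ENNReal.mul_le_mul_iff_right hne0 hnet, ← h2]
      exact h1
    calc K = (K ^ (1 / p)) ^ p := by
          rw [← ENNReal.rpow_mul, one_div_mul_cancel hp0.ne', ENNReal.rpow_one]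
      _ ≤ I ^ p := ENNReal.rpow_le_rpow h3 hp0.le
  have hmono : ∀ x, Monotone fun n ↦ Hn n x := fun x m n hmn ↦ by
    by_cases hx : x ∈ spanningSets μ m
    · have hx' := monotone_spanningSets μ hmn hx
      simp only [Hn, hx, hx', Set.indicator_of_mem]
      gcongr
    · simp [Hn, hx]
  have hsup : ∀ x, H x ^ p = ⨆ n, Hn n x ^ p := fun x ↦ by
    refine le_antisymm ?_ (iSup_le fun n ↦ ENNReal.rpow_le_rpow (hle n x) hp0.le)
    have ht : Tendsto (fun n : ℕ ↦ Hn n x ^ p) atTop (𝓝 (H x ^ p)) := by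
      refine (ENNReal.continuous_rpow_const.tendsto _).comp ?_
      have h1 : Tendsto (fun n : ℕ ↦ min (H x) (n : ℝ≥0∞)) atTop (𝓝 (min (H x) ∞)) :=
        tendsto_const_nhds.min ENNReal.tendsto_nat_nhds_top
      rw [min_eq_left le_top] at h1
      refine h1.congr' ?_
      filter_upwards [eventually_ge_atTop (spanningSetsIndex μ x)] with n hn
      have : x ∈ spanningSets μ n :=
        monotone_spanningSets μ hn (mem_spanningSetsIndex μ x)
      simp [Hn, this]
    exact le_of_tendsto' ht fun n ↦ le_iSup (fun n ↦ Hn n x ^ p) n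
  have hfinal : ∫⁻ x, H x ^ p ∂μ ≤ I ^ p := by
    simp_rw [hsup]
    rw [lintegral_iSup (fun n ↦ (hHn n).pow_const p)
      fun m n hmn x ↦ ENNReal.rpow_le_rpow (hmono x hmn) hp0.le]
    exact iSup_le key
  calc lnorm p H μ ≤ (I ^ p) ^ (1 / p) := ENNReal.rpow_le_rpow hfinal (by positivity)
    _ = I := by rw [← ENNReal.rpow_mul, mul_one_div_cancel hp0.ne', ENNReal.rpow_one]

end lnorm

/-! ### The Sobolev embedding -/

/-- The squared norm `‖(1 - Δ) ^ (τ / 2) f‖²` in `L²(ℝᵈ)`, computed on the Fourier side. -/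
noncomputable def energy (τ : ℝ) (f : L2 d) : ℝ≥0∞ :=
  ∫⁻ ξ, ENNReal.ofReal (symbol d (2 * τ) ξ) * ‖(𝓕 f : L2 d) ξ‖ₑ ^ (2 : ℝ)

theorem energy_mono {τ τ' : ℝ} (h : τ ≤ τ') (f : L2 d) : energy τ f ≤ energy τ' f := by
  unfold energy
  gcongr
  exact symbol_mono (by linarith) _

theorem lintegral_enorm_sq_le_energy {τ : ℝ} (h : 0 ≤ τ) (f : L2 d) :
    ∫⁻ x, ‖f x‖ₑ ^ (2 : ℝ) ≤ energy τ f := by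
  rw [← lintegral_enorm_fourier_sq]
  refine lintegral_mono fun ξ ↦ ?_
  have : 1 ≤ ENNReal.ofReal (symbol d (2 * τ) ξ) := by
    rw [← ENNReal.ofReal_one]; exact ENNReal.ofReal_le_ofReal (one_le_symbol (by linarith) ξ)
  exact le_mul_of_one_le_left zero_le this

theorem integral_closedBall_rpow (τ : ℝ) {N : ℝ} (hN : 0 < N) :
    ∫ ξ in Metric.closedBall (0 : Eu d) N, ‖ξ‖ ^ (-(2 * τ)) =
      N ^ ((d : ℝ) - 2 * τ) * ∫ ξ in Metric.closedBall (0 : Eu d) 1, ‖ξ‖ ^ (-(2 * τ)) := by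
  have h := Measure.setIntegral_comp_smul_of_pos (volume : Measure (Eu d))
    (fun ξ ↦ ‖ξ‖ ^ (-(2 * τ))) (Metric.closedBall (0 : Eu d) 1) hN
  rw [smul_unitClosedBall_of_nonneg hN.le, finrank_euclideanSpace_fin, smul_eq_mul] at h
  simp_rw [norm_smul, Real.norm_of_nonneg hN.le, Real.mul_rpow hN.le (norm_nonneg _)] at h
  rw [integral_const_mul] at h
  have h2 : N ^ ((d : ℝ) - 2 * τ) = N ^ d * N ^ (-(2 * τ)) := by
    rw [← Real.rpow_natCast, ← Real.rpow_add hN]; ring_nf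
  rw [h2, mul_assoc, h, ← mul_assoc, mul_inv_cancel₀ (by positivity), one_mul]

theorem integrableOn_closedBall_rpow (hd : 0 < d) {τ : ℝ} (hτ : 2 * τ < d) (N : ℝ) :
    IntegrableOn (fun ξ : Eu d ↦ ‖ξ‖ ^ (-(2 * τ))) (Metric.closedBall 0 N) := by
  have h := locallyIntegrable_of_norm_le_rpow (μ := (volume : Measure (Eu d))) (C := 1) (α := 2 * τ)
    (f := fun ξ : Eu d ↦ ‖ξ‖ ^ (-(2 * τ)))
    (by simpa [Nat.succ_le_iff] using hd) (by simpa using hτ) (ae_of_all _ fun x ↦ by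
      rw [Real.norm_of_nonneg (by positivity), one_mul]) (by
      apply Measurable.aestronglyMeasurable; fun_prop)
  exact h.integrableOn_isCompact (isCompact_closedBall _ _)

/-- The decomposition of a function into its low and its high frequencies. -/
theorem exists_low_high (f : L2 d) {S : Set (Eu d)} (hS : MeasurableSet S) :
    ∃ g h : L2 d, f = g + h ∧ (𝓕 g : L2 d) =ᵐ[volume] S.indicator (𝓕 f : L2 d) ∧
      (𝓕 h : L2 d) =ᵐ[volume] Sᶜ.indicator (𝓕 f : L2 d) := by
  have h1 := (Lp.memLp (𝓕 f : L2 d)).indicator hS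
  have h2 := (Lp.memLp (𝓕 f : L2 d)).indicator hS.compl
  refine ⟨𝓕⁻ (h1.toLp _), 𝓕⁻ (h2.toLp _), ?_, ?_, ?_⟩
  · have h3 : (𝓕 f : L2 d) = h1.toLp _ + h2.toLp _ := by
      refine Lp.ext ?_
      filter_upwards [Lp.coeFn_add (h1.toLp _) (h2.toLp _), h1.coeFn_toLp, h2.coeFn_toLp]
        with x e1 e2 e3
      rw [e1, Pi.add_apply, e2, e3, Set.indicator_self_add_compl_apply]
    have h4 : f = 𝓕⁻ (𝓕 f : L2 d) := (FourierTransform.fourierInv_fourier_eq f).symm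
    refine h4.trans ((congrArg _ h3).trans ?_)
    exact (Lp.fourierTransformₗᵢ (Eu d) ℂ).symm.map_add _ _
  · rw [FourierTransform.fourier_fourierInv_eq]; exact h1.coeFn_toLp
  · rw [FourierTransform.fourier_fourierInv_eq]; exact h2.coeFn_toLp

theorem ae_norm_ne_zero (hd : 0 < d) : ∀ᵐ ξ : Eu d, 0 < ‖ξ‖ := by
  have : Nontrivial (Eu d) := by
    have : Nonempty (Fin d) := ⟨⟨0, hd⟩⟩
    infer_instance
  have h : ∀ᵐ ξ : Eu d, ξ ≠ 0 := by simp [ae_iff]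
  exact h.mono fun ξ hξ ↦ norm_pos_iff.2 hξ

/-- The contribution of the low frequencies, by the Cauchy-Schwarz inequality. -/
theorem lintegral_low_le (hd : 0 < d) {τ : ℝ} (hτ : 2 * τ < d) (f : L2 d) {J A N : ℝ}
    (hJ : 0 ≤ J) (hA : 0 ≤ A) (hN : 0 < N)
    (hI : ∫⁻ ξ, ENNReal.ofReal (‖ξ‖ ^ (2 * τ)) * ‖(𝓕 f : L2 d) ξ‖ₑ ^ (2 : ℝ) ≤ ENNReal.ofReal (J ^ 2))
    (hA2 : ∫ ξ in Metric.closedBall (0 : Eu d) 1, ‖ξ‖ ^ (-(2 * τ)) ≤ A ^ 2) :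
    ∫⁻ ξ in Metric.closedBall 0 N, ‖(𝓕 f : L2 d) ξ‖ₑ ≤
      ENNReal.ofReal (J * (A * N ^ ((d : ℝ) / 2 - τ))) := by
  set F := (𝓕 f : L2 d)
  have hFm : AEMeasurable (fun ξ ↦ ‖F ξ‖ₑ) := (Lp.aestronglyMeasurable F).enorm
  have h1 : ∫⁻ ξ in Metric.closedBall 0 N, ‖F ξ‖ₑ =
      ∫⁻ ξ in Metric.closedBall 0 N, (ENNReal.ofReal (‖ξ‖ ^ (2 * τ)) * ‖F ξ‖ₑ ^ (2 : ℝ)) ^ (1 / 2 : ℝ) *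
        ENNReal.ofReal (‖ξ‖ ^ (-(2 * τ))) ^ (1 / 2 : ℝ) := by
    refine lintegral_congr_ae (ae_restrict_of_ae ((ae_norm_ne_zero hd).mono fun ξ hξ ↦ ?_))
    simp only
    rw [← ENNReal.mul_rpow_of_nonneg _ _ (by positivity), mul_right_comm,
      ← ENNReal.ofReal_mul (by positivity), ← Real.rpow_add hξ, add_neg_cancel, Real.rpow_zero,
      ENNReal.ofReal_one, one_mul, ← ENNReal.rpow_mul]
    norm_num
  have h2 : ∫⁻ ξ in Metric.closedBall (0 : Eu d) N, ENNReal.ofReal (‖ξ‖ ^ (-(2 * τ))) ≤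
      ENNReal.ofReal ((A * N ^ ((d : ℝ) / 2 - τ)) ^ 2) := by
    rw [← ofReal_integral_eq_lintegral_ofReal (integrableOn_closedBall_rpow hd hτ N)
      (ae_of_all _ fun ξ ↦ by positivity), integral_closedBall_rpow τ hN]
    refine ENNReal.ofReal_le_ofReal ?_
    have : (N ^ ((d : ℝ) / 2 - τ)) ^ 2 = N ^ ((d : ℝ) - 2 * τ) := by
      rw [← Real.rpow_natCast, ← Real.rpow_mul hN.le]; push_cast; ring_nf
    rw [mul_pow, this, mul_comm (A ^ 2)]
    gcongr
  rw [h1]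
  refine (ENNReal.lintegral_mul_norm_pow_le ?_ ?_ (by positivity) (by positivity)
    (by norm_num)).trans ?_
  · exact ((Measurable.aemeasurable (by fun_prop)).mul (hFm.pow_const _)).restrict
  · exact Measurable.aemeasurable (by fun_prop)
  calc _ ≤ ENNReal.ofReal (J ^ 2) ^ (1 / 2 : ℝ) *
        ENNReal.ofReal ((A * N ^ ((d : ℝ) / 2 - τ)) ^ 2) ^ (1 / 2 : ℝ) := by
        gcongr
        exact (setLIntegral_le_lintegral _ _).trans hI
    _ = _ := by
        rw [ENNReal.ofReal_rpow_of_nonneg (by positivity) (by positivity),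
          ENNReal.ofReal_rpow_of_nonneg (by positivity) (by positivity), ← Real.sqrt_eq_rpow,
          ← Real.sqrt_eq_rpow, Real.sqrt_sq hJ, Real.sqrt_sq (by positivity),
          ENNReal.ofReal_mul hJ]

/-- The size of the level sets is controlled by the high frequencies, since the low frequencies
contribute a function that is bounded by half of the level. -/
theorem meas_lt_norm_le (f : L2 d) {l : ℝ} (hl : 0 < l) {S : Set (Eu d)} (hS : MeasurableSet S)
    (hlow : ∫⁻ ξ in S, ‖(𝓕 f : L2 d) ξ‖ₑ ≤ ENNReal.ofReal (l / 2)) :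
    volume {x | l < ‖f x‖} ≤
      ENNReal.ofReal (4 / l ^ 2) * ∫⁻ ξ in Sᶜ, ‖(𝓕 f : L2 d) ξ‖ₑ ^ (2 : ℝ) := by
  obtain ⟨g, h, hf, hg, hh⟩ := exists_low_high f hS
  have hgl : ∫⁻ ξ, ‖(𝓕 g : L2 d) ξ‖ₑ ≤ ENNReal.ofReal (l / 2) := by
    rw [lintegral_congr_ae (hg.mono fun ξ hξ ↦ show ‖(𝓕 g : L2 d) ξ‖ₑ =
      S.indicator (fun ξ ↦ ‖(𝓕 f : L2 d) ξ‖ₑ) ξ by rw [hξ, enorm_indicator_eq_indicator_enorm]),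
      lintegral_indicator hS]
    exact hlow
  have hgi : Integrable (𝓕 g : L2 d) :=
    ⟨Lp.aestronglyMeasurable _, hgl.trans_lt ENNReal.ofReal_lt_top⟩
  have hhl : ∫⁻ x, ‖h x‖ₑ ^ (2 : ℝ) = ∫⁻ ξ in Sᶜ, ‖(𝓕 f : L2 d) ξ‖ₑ ^ (2 : ℝ) := by
    rw [← lintegral_enorm_fourier_sq, ← lintegral_indicator hS.compl]
    refine lintegral_congr_ae (hh.mono fun ξ hξ ↦ ?_)
    simp only [hξ]
    by_cases hx : ξ ∈ Sᶜ <;> simp [hx]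
  have hsub : volume {x | l < ‖f x‖} ≤
      volume {x | ENNReal.ofReal (l / 2) ^ (2 : ℝ) ≤ ‖h x‖ₑ ^ (2 : ℝ)} := by
    refine measure_mono_ae ?_
    have hsum := Lp.coeFn_add g h
    rw [← hf] at hsum
    filter_upwards [ae_enorm_le_lintegral_fourier g hgi, hsum] with x hx hx2 hx3
    have hx3 : l < ‖f x‖ := hx3
    change ENNReal.ofReal (l / 2) ^ (2 : ℝ) ≤ ‖h x‖ₑ ^ (2 : ℝ)
    gcongr
    have hx4 := hx.trans hgl
    rw [← ofReal_norm, ENNReal.ofReal_le_ofReal_iff (by positivity)] at hx4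
    rw [← ofReal_norm]
    refine ENNReal.ofReal_le_ofReal ?_
    rw [hx2, Pi.add_apply] at hx3
    linarith [norm_add_le (g x) (h x)]
  refine hsub.trans ?_
  have hm := mul_meas_ge_le_lintegral₀ (μ := (volume : Measure (Eu d)))
    (((Lp.aestronglyMeasurable h).enorm).pow_const (2 : ℝ)) (ENNReal.ofReal (l / 2) ^ (2 : ℝ))
  rw [hhl] at hm
  have hc : ENNReal.ofReal (4 / l ^ 2) * ENNReal.ofReal (l / 2) ^ (2 : ℝ) = 1 := by
    rw [ENNReal.ofReal_rpow_of_nonneg (by positivity) two_pos.le, Real.rpow_two,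
      ← ENNReal.ofReal_mul (by positivity), ← ENNReal.ofReal_one]
    congr 1
    field_simp
    norm_num
  calc _ = ENNReal.ofReal (4 / l ^ 2) * (ENNReal.ofReal (l / 2) ^ (2 : ℝ) *
        volume {x | ENNReal.ofReal (l / 2) ^ (2 : ℝ) ≤ ‖h x‖ₑ ^ (2 : ℝ)}) := by
        rw [← mul_assoc, hc, one_mul]
    _ ≤ _ := by gcongr

theorem lintegral_Ioo_rpow {r : ℝ} (hr : -1 < r) {K : ℝ} (hK : 0 ≤ K) :
    ∫⁻ l in Set.Ioo 0 K, ENNReal.ofReal (l ^ r) = ENNReal.ofReal (K ^ (r + 1) / (r + 1)) := by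
  have hi : IntegrableOn (fun l : ℝ ↦ l ^ r) (Set.Ioc 0 K) := by
    have := intervalIntegral.intervalIntegrable_rpow' (a := 0) (b := K) hr
    rwa [intervalIntegrable_iff_integrableOn_Ioc_of_le hK] at this
  rw [setLIntegral_congr Ioo_ae_eq_Ioc, ← ofReal_integral_eq_lintegral_ofReal hi
    ((ae_restrict_iff' measurableSet_Ioc).2 (ae_of_all _ fun l hl ↦ Real.rpow_nonneg hl.1.le _)),
    ← intervalIntegral.integral_of_le hK, integral_rpow (Or.inl hr),
    Real.zero_rpow (by linarith), sub_zero]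

/-- The Sobolev inequality in its homogeneous form. The proof compares, at each level `l`, the level
set of `f` with the part of `f` of frequencies above a threshold depending on `l`, and integrates
over the levels. -/
theorem lintegral_rpow_le_of_homogeneous (hd : 0 < d) {τ b : ℝ} (hτ : 0 < τ) (hb : 0 < b)
    (hbτ : 1 / b = 1 / 2 - τ / d) :
    ∃ C : ℝ, 0 < C ∧ ∀ (f : L2 d) (J : ℝ), 0 < J →
      ∫⁻ ξ, ENNReal.ofReal (‖ξ‖ ^ (2 * τ)) * ‖(𝓕 f : L2 d) ξ‖ₑ ^ (2 : ℝ) ≤ ENNReal.ofReal (J ^ 2) →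
      ∫⁻ x, ‖f x‖ₑ ^ b ≤ ENNReal.ofReal (C * J ^ b) := by
  have hd' : (0 : ℝ) < d := Nat.cast_pos.2 hd
  set γ : ℝ := (d : ℝ) / 2 - τ with hγ
  have hbγ : b * γ = d := by
    have : b * (1 / b) = 1 := by field_simp
    rw [hbτ] at this
    rw [hγ]; field_simp at this ⊢; linarith
  have hγ0 : 0 < γ := by
    by_contra hcon
    have : b * γ ≤ 0 := mul_nonpos_of_nonneg_of_nonpos hb.le (not_lt.1 hcon)
    linarith
  have hb2 : γ * (b - 2) = 2 * τ := by rw [mul_sub, mul_comm γ b, hbγ, hγ]; ring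
  have hb2' : 0 < b - 2 := by
    by_contra hcon
    have : γ * (b - 2) ≤ 0 := mul_nonpos_of_nonneg_of_nonpos hγ0.le (not_lt.1 hcon)
    linarith
  have hτd : 2 * τ < d := by rw [hγ] at hγ0; linarith
  set A : ℝ := √(∫ ξ in Metric.closedBall (0 : Eu d) 1, ‖ξ‖ ^ (-(2 * τ))) + 1 with hA
  have hA0 : 0 < A := by positivity
  have hA2 : ∫ ξ in Metric.closedBall (0 : Eu d) 1, ‖ξ‖ ^ (-(2 * τ)) ≤ A ^ 2 := by
    have h0 : 0 ≤ ∫ ξ in Metric.closedBall (0 : Eu d) 1, ‖ξ‖ ^ (-(2 * τ)) :=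
      integral_nonneg fun ξ ↦ by positivity
    have h1 := Real.sq_sqrt h0
    have h2 := Real.sqrt_nonneg (∫ ξ in Metric.closedBall (0 : Eu d) 1, ‖ξ‖ ^ (-(2 * τ)))
    nlinarith
  refine ⟨b * (4 * ((2 * A) ^ (b - 2) / (b - 2))), by positivity, fun f J hJ hI ↦ ?_⟩
  set F := (𝓕 f : L2 d)
  have hFm : AEMeasurable (fun ξ ↦ ‖F ξ‖ₑ ^ (2 : ℝ)) :=
    (Lp.aestronglyMeasurable F).enorm.pow_const _
  -- the set of the frequencies that are low at the level `l`
  let S : ℝ → Set (Eu d) := fun l ↦ {ξ | 2 * A * J * ‖ξ‖ ^ γ ≤ l}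
  have hSball : ∀ l, 0 < l → S l = Metric.closedBall 0 ((l / (2 * A * J)) ^ (1 / γ)) := by
    intro l hl
    ext ξ
    rw [mem_closedBall_zero_iff, Set.mem_ofPred_eq, one_div,
      Real.le_rpow_inv_iff_of_pos (norm_nonneg _) (by positivity) hγ0, le_div_iff₀ (by positivity),
      mul_comm]
  have hSm : ∀ l, MeasurableSet (S l) := fun l ↦
    measurableSet_le (by fun_prop) measurable_const
  have hlevel : ∀ l : ℝ, 0 < l → volume {x | l < ‖f x‖} ≤
      ENNReal.ofReal (4 / l ^ 2) * ∫⁻ ξ in (S l)ᶜ, ‖F ξ‖ₑ ^ (2 : ℝ) := fun l hl ↦ by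
    refine meas_lt_norm_le f hl (hSm l) ?_
    rw [hSball l hl]
    refine (lintegral_low_le hd hτd f hJ.le hA0.le (by positivity) hI hA2).trans (le_of_eq ?_)
    congr 1
    rw [← hγ, ← Real.rpow_mul (by positivity), one_div_mul_cancel hγ0.ne', Real.rpow_one]
    field_simp
  have hlc := lintegral_rpow_eq_lintegral_meas_lt_mul (volume : Measure (Eu d))
    (f := fun x ↦ ‖f x‖) (ae_of_all _ fun x ↦ norm_nonneg _)
    (Lp.aestronglyMeasurable f).norm.aemeasurable hb
  have hstart : ∫⁻ x, ‖f x‖ₑ ^ b = ∫⁻ x, ENNReal.ofReal (‖f x‖ ^ b) := by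
    refine lintegral_congr fun x ↦ ?_
    rw [← ofReal_norm, ENNReal.ofReal_rpow_of_nonneg (norm_nonneg _) hb.le]
  -- the double integral over the levels and the high frequencies
  let G : ℝ → Eu d → ℝ≥0∞ := fun l ξ ↦
    {q : ℝ × Eu d | 0 < q.1 ∧ q.1 < 2 * A * J * ‖q.2‖ ^ γ}.indicator
      (fun q ↦ ENNReal.ofReal (4 * q.1 ^ (b - 3)) * ‖F q.2‖ₑ ^ (2 : ℝ)) (l, ξ)
  have hset : MeasurableSet {q : ℝ × Eu d | 0 < q.1 ∧ q.1 < 2 * A * J * ‖q.2‖ ^ γ} :=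
    (measurableSet_lt measurable_const measurable_fst).inter
      (measurableSet_lt measurable_fst (by fun_prop))
  have hGm : AEMeasurable (Function.uncurry G) ((volume : Measure ℝ).prod volume) := by
    refine AEMeasurable.indicator (AEMeasurable.mul (Measurable.aemeasurable (by fun_prop)) ?_) hset
    exact hFm.comp_quasiMeasurePreserving Measure.quasiMeasurePreserving_snd
  have h1 : ∫⁻ l in Set.Ioi (0 : ℝ), volume {x | l < ‖f x‖} * ENNReal.ofReal (l ^ (b - 1)) ≤
      ∫⁻ l, ∫⁻ ξ, G l ξ := by
    rw [← lintegral_indicator measurableSet_Ioi]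
    refine lintegral_mono fun l ↦ ?_
    by_cases hl : l ∈ Set.Ioi (0 : ℝ)
    · have hl0 : 0 < l := hl
      rw [Set.indicator_of_mem hl]
      have hGl : ∀ ξ, G l ξ = (S l)ᶜ.indicator
          (fun ξ ↦ ENNReal.ofReal (4 * l ^ (b - 3)) * ‖F ξ‖ₑ ^ (2 : ℝ)) ξ := fun ξ ↦ by
        by_cases hξ : ξ ∈ S l
        · have h' : ¬ (l < 2 * A * J * ‖ξ‖ ^ γ) := not_lt.2 hξ
          simp [G, hξ, h']
        · have h' : l < 2 * A * J * ‖ξ‖ ^ γ := not_le.1 hξ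
          simp [G, hξ, h', hl0]
      simp_rw [hGl]
      rw [lintegral_indicator (hSm l).compl, lintegral_const_mul' _ _ ENNReal.ofReal_ne_top]
      refine (mul_le_mul_left (hlevel l hl0) _).trans (le_of_eq ?_)
      rw [mul_right_comm, ← ENNReal.ofReal_mul (by positivity)]
      congr 2
      have : l ^ (b - 1) = l ^ (b - 3) * l ^ 2 := by
        rw [← Real.rpow_natCast, ← Real.rpow_add hl0]; push_cast; ring_nf
      rw [this]; field_simp
    · simp [hl]
  have h2 : ∀ ξ : Eu d, ∫⁻ l, G l ξ =
      ENNReal.ofReal (4 * ((2 * A) ^ (b - 2) / (b - 2)) * J ^ (b - 2)) *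
        (ENNReal.ofReal (‖ξ‖ ^ (2 * τ)) * ‖F ξ‖ₑ ^ (2 : ℝ)) := fun ξ ↦ by
    have hGl : ∀ l, G l ξ = (Set.Ioo 0 (2 * A * J * ‖ξ‖ ^ γ)).indicator
        (fun l ↦ ENNReal.ofReal (l ^ (b - 3)) * (4 * ‖F ξ‖ₑ ^ (2 : ℝ))) l := fun l ↦ by
      by_cases hl : 0 < l ∧ l < 2 * A * J * ‖ξ‖ ^ γ
      · rw [Set.indicator_of_mem (Set.mem_Ioo.2 hl)]
        have hm : ((l, ξ) : ℝ × Eu d) ∈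
            {q : ℝ × Eu d | 0 < q.1 ∧ q.1 < 2 * A * J * ‖q.2‖ ^ γ} := hl
        simp only [G]
        rw [Set.indicator_of_mem hm, ENNReal.ofReal_mul (by norm_num)]
        simp only [ENNReal.ofReal_ofNat]
        ring
      · have hm' : l ∉ Set.Ioo 0 (2 * A * J * ‖ξ‖ ^ γ) := hl
        rw [Set.indicator_of_notMem hm']
        have hm : ((l, ξ) : ℝ × Eu d) ∉
            {q : ℝ × Eu d | 0 < q.1 ∧ q.1 < 2 * A * J * ‖q.2‖ ^ γ} := hl
        exact Set.indicator_of_notMem hm _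
    have e4 : (4 : ℝ≥0∞) = ENNReal.ofReal 4 := by simp
    simp_rw [hGl]
    rw [lintegral_indicator measurableSet_Ioo, lintegral_mul_const _ (by fun_prop),
      lintegral_Ioo_rpow (by linarith) (by positivity), ← mul_assoc, ← mul_assoc,
      ← ENNReal.ofReal_mul (by positivity), e4, ← ENNReal.ofReal_mul
      (div_nonneg (by positivity) (by linarith))]
    congr 2
    rw [← hb2, Real.rpow_mul (norm_nonneg _), show b - 3 + 1 = b - 2 by ring,
      Real.mul_rpow (by positivity) (by positivity), Real.mul_rpow (by positivity) hJ.le]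
    ring
  rw [hstart, hlc]
  calc _ ≤ ENNReal.ofReal b * ∫⁻ l, ∫⁻ ξ, G l ξ := by gcongr
    _ = ENNReal.ofReal b * ∫⁻ ξ, ∫⁻ l, G l ξ := by rw [lintegral_lintegral_swap hGm]
    _ = ENNReal.ofReal b * (ENNReal.ofReal (4 * ((2 * A) ^ (b - 2) / (b - 2)) * J ^ (b - 2)) *
          ∫⁻ ξ, ENNReal.ofReal (‖ξ‖ ^ (2 * τ)) * ‖F ξ‖ₑ ^ (2 : ℝ)) := by
        simp_rw [h2]
        rw [lintegral_const_mul' _ _ ENNReal.ofReal_ne_top]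
    _ ≤ ENNReal.ofReal b * (ENNReal.ofReal (4 * ((2 * A) ^ (b - 2) / (b - 2)) * J ^ (b - 2)) *
          ENNReal.ofReal (J ^ 2)) := by gcongr
    _ = _ := by
        rw [← ENNReal.ofReal_mul (by positivity), ← ENNReal.ofReal_mul hb.le]
        congr 1
        have : J ^ b = J ^ (b - 2) * J ^ 2 := by
          rw [← Real.rpow_natCast, ← Real.rpow_add hJ]; push_cast; ring_nf
        rw [this]; ring

/-- The **Sobolev embedding** `H^τ(ℝᵈ) ⊆ L^b(ℝᵈ)`. -/
theorem exists_lnorm_le_energy (hd : 0 < d) {τ b : ℝ} (hτ : 0 ≤ τ) (hb : 0 < b)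
    (hbτ : 1 / b = 1 / 2 - τ / d) :
    ∃ C : ℝ≥0, ∀ f : L2 d, lnorm b (fun x ↦ ‖f x‖ₑ) volume ≤ C * energy τ f ^ (1 / 2 : ℝ) := by
  rcases hτ.eq_or_lt with rfl | hτ
  · have hb2 : b = 2 := by
      rw [zero_div, sub_zero] at hbτ
      field_simp at hbτ; linarith
    refine ⟨1, fun f ↦ ?_⟩
    rw [hb2, ENNReal.coe_one, one_mul, lnorm]
    exact ENNReal.rpow_le_rpow (lintegral_enorm_sq_le_energy le_rfl f) (by positivity)
  obtain ⟨C, hC0, hC⟩ := lintegral_rpow_le_of_homogeneous hd hτ hb hbτ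
  refine ⟨Real.toNNReal (C ^ (1 / b)) + 1, fun f ↦ ?_⟩
  by_cases h0 : energy τ f = 0
  · have h1 : ∫⁻ x, ‖f x‖ₑ ^ (2 : ℝ) = 0 :=
      le_antisymm ((lintegral_enorm_sq_le_energy hτ.le f).trans h0.le) zero_le
    rw [lintegral_eq_zero_iff' ((Lp.aestronglyMeasurable f).enorm.pow_const _)] at h1
    have h2 : (fun x ↦ ‖f x‖ₑ) =ᵐ[volume] fun _ ↦ 0 := h1.mono fun x hx ↦ by simpa using hx
    rw [lnorm_congr_ae h2, lnorm]
    simp [hb]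
  by_cases ht : energy τ f = ∞
  · rw [ht, ENNReal.top_rpow_of_pos (by positivity), ENNReal.mul_top]
    · exact le_top
    · simp
  set J : ℝ := √(energy τ f).toReal with hJ
  have hJ0 : 0 < J := Real.sqrt_pos.2 (ENNReal.toReal_pos h0 ht)
  have hJ2 : ENNReal.ofReal (J ^ 2) = energy τ f := by
    rw [hJ, Real.sq_sqrt ENNReal.toReal_nonneg, ENNReal.ofReal_toReal ht]
  have hI : ∫⁻ ξ, ENNReal.ofReal (‖ξ‖ ^ (2 * τ)) * ‖(𝓕 f : L2 d) ξ‖ₑ ^ (2 : ℝ) ≤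
      ENNReal.ofReal (J ^ 2) := by
    rw [hJ2, energy]
    gcongr with ξ
    rw [symbol, show 2 * τ / 2 = τ by ring, Real.rpow_mul (norm_nonneg _), Real.rpow_two]
    refine Real.rpow_le_rpow (by positivity) ?_ hτ.le
    have : 1 ≤ 2 * Real.pi := by linarith [Real.pi_gt_three]
    have h1 : ‖ξ‖ ≤ 2 * Real.pi * ‖ξ‖ := le_mul_of_one_le_left (norm_nonneg ξ) this
    nlinarith [norm_nonneg ξ]
  have h := hC f J hJ0 hI
  calc lnorm b (fun x ↦ ‖f x‖ₑ) volume ≤ ENNReal.ofReal (C * J ^ b) ^ (1 / b) :=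
        ENNReal.rpow_le_rpow h (by positivity)
    _ = ENNReal.ofReal (C ^ (1 / b)) * energy τ f ^ (1 / 2 : ℝ) := by
        rw [ENNReal.ofReal_rpow_of_nonneg (by positivity) (by positivity),
          Real.mul_rpow hC0.le (by positivity), ← Real.rpow_mul hJ0.le, mul_one_div_cancel hb.ne',
          Real.rpow_one, ENNReal.ofReal_mul (by positivity), ← hJ2,
          ENNReal.ofReal_rpow_of_nonneg (by positivity) (by positivity), ← Real.sqrt_eq_rpow,
          Real.sqrt_sq hJ0.le]
    _ ≤ _ := by
        gcongr
        push_cast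
        exact le_self_add

/-! ### First-order expansion of the power nonlinearity -/

/-- The second-order Taylor bound for `r ^ σ` at `1`, uniformly for `r` between `(1 / 2) ^ 2` and
`(3 / 2) ^ 2`. -/
theorem exists_abs_rpow_sub_le (σ : ℝ) :
    ∃ C : ℝ, 0 ≤ C ∧ ∀ r ∈ Set.Icc (1 / 4 : ℝ) (9 / 4),
      |r ^ σ - 1 - σ * (r - 1)| ≤ C * (r - 1) ^ 2 := by
  have hpos : ∀ {x : ℝ}, x ∈ Set.Icc (1 / 4 : ℝ) (9 / 4) → x ≠ 0 := fun hx ↦ by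
    have := hx.1; intro h; rw [h] at this; norm_num at this
  obtain ⟨C₀, hC₀⟩ := (isCompact_Icc (a := (1 / 4 : ℝ)) (b := 9 / 4)).exists_bound_of_continuousOn
    (f := fun x : ℝ ↦ (σ - 1) * x ^ (σ - 1 - 1))
    (continuousOn_const.mul (continuousOn_id.rpow_const fun x hx ↦ Or.inl (hpos hx)))
  have h1mem : (1 : ℝ) ∈ Set.Icc (1 / 4 : ℝ) (9 / 4) := by norm_num
  have hC₀' : 0 ≤ C₀ := (norm_nonneg _).trans (hC₀ 1 h1mem)
  have h1 : ∀ r ∈ Set.Icc (1 / 4 : ℝ) (9 / 4), |r ^ (σ - 1) - 1| ≤ C₀ * |r - 1| := fun r hr ↦ by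
    have := (convex_Icc (1 / 4 : ℝ) (9 / 4)).norm_image_sub_le_of_norm_hasDerivWithin_le
      (f := fun x : ℝ ↦ x ^ (σ - 1)) (f' := fun x ↦ (σ - 1) * x ^ (σ - 1 - 1)) (C := C₀)
      (fun x hx ↦ (Real.hasDerivAt_rpow_const (Or.inl (hpos hx))).hasDerivWithinAt) hC₀ h1mem hr
    simpa using this
  refine ⟨|σ| * C₀, by positivity, fun r hr ↦ ?_⟩
  have hsub : Set.uIcc 1 r ⊆ Set.Icc (1 / 4 : ℝ) (9 / 4) := Set.uIcc_subset_Icc h1mem hr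
  have hd : ∀ x ∈ Set.uIcc 1 r, HasDerivWithinAt (fun x : ℝ ↦ x ^ σ - 1 - σ * (x - 1))
      (σ * x ^ (σ - 1) - σ * 1) (Set.uIcc 1 r) x := fun x hx ↦
    (((Real.hasDerivAt_rpow_const (Or.inl (hpos (hsub hx)))).sub_const 1).sub
      (((hasDerivAt_id x).sub_const 1).const_mul σ)).hasDerivWithinAt
  have hb : ∀ x ∈ Set.uIcc 1 r, ‖σ * x ^ (σ - 1) - σ * 1‖ ≤ |σ| * C₀ * |r - 1| := fun x hx ↦ by
    rw [← mul_sub, norm_mul, Real.norm_eq_abs, Real.norm_eq_abs, mul_assoc]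
    refine mul_le_mul_of_nonneg_left ((h1 x (hsub hx)).trans ?_) (abs_nonneg _)
    exact mul_le_mul_of_nonneg_left (Set.abs_sub_left_of_mem_uIcc hx) hC₀'
  have := (convex_uIcc 1 r).norm_image_sub_le_of_norm_hasDerivWithin_le hd hb
    Set.left_mem_uIcc Set.right_mem_uIcc
  simp only [Real.norm_eq_abs, sub_self, mul_zero, Real.one_rpow, sub_zero] at this
  rw [← sq_abs, sq, ← mul_assoc]
  exact this

/-- The function `w ↦ |w| ^ (2 σ) w` on the complex numbers. -/
noncomputable def powerFun (σ : ℝ) (w : ℂ) : ℂ := ((‖w‖ ^ (2 * σ) : ℝ) : ℂ) * w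

/-- The complex linear part of the real differential of `powerFun`. -/
noncomputable def derivLin (σ : ℝ) (w : ℂ) : ℂ := (((1 + σ) * ‖w‖ ^ (2 * σ) : ℝ) : ℂ)

/-- The conjugate linear part of the real differential of `powerFun`. For `σ < 1` the first factor
is singular at the origin; the value there is `0`, because of `w ^ 2`. -/
noncomputable def derivConj (σ : ℝ) (w : ℂ) : ℂ := ((σ * ‖w‖ ^ (2 * σ - 2) : ℝ) : ℂ) * w ^ 2

/-- The remainder of the first-order expansion of `powerFun` at `w`. -/
noncomputable def remainder (σ : ℝ) (w h : ℂ) : ℂ :=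
  powerFun σ (w + h) - powerFun σ w - (derivLin σ w * h + derivConj σ w * starRingEnd ℂ h)

theorem norm_powerFun {σ : ℝ} (hσ : 0 < σ) (w : ℂ) : ‖powerFun σ w‖ = ‖w‖ ^ (2 * σ + 1) := by
  rw [powerFun, norm_mul, Complex.norm_real, Real.norm_of_nonneg (by positivity),
    Real.rpow_add_of_nonneg (norm_nonneg _) (by positivity) zero_le_one, Real.rpow_one]

theorem norm_derivLin {σ : ℝ} (hσ : 0 < σ) (w : ℂ) : ‖derivLin σ w‖ = (1 + σ) * ‖w‖ ^ (2 * σ) := by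
  rw [derivLin, Complex.norm_real, Real.norm_of_nonneg (by positivity)]

theorem norm_derivConj {σ : ℝ} (hσ : 0 < σ) (w : ℂ) : ‖derivConj σ w‖ = σ * ‖w‖ ^ (2 * σ) := by
  rw [derivConj, norm_mul, Complex.norm_real, Real.norm_of_nonneg (by positivity), norm_pow]
  rcases (norm_nonneg w).eq_or_lt with h | h
  · rw [← h, Real.zero_rpow (by positivity : 2 * σ ≠ 0)]; simp
  · rw [mul_assoc, ← Real.rpow_natCast, ← Real.rpow_add h]; norm_num

/-- The exact form of the remainder in terms of the ratio `r = |w + h|² / |w|²`. -/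
theorem remainder_eq {σ : ℝ} {w h : ℂ} (hw : w ≠ 0) {r : ℝ} (hr : r = ‖w + h‖ ^ 2 / ‖w‖ ^ 2) :
    remainder σ w h = ((‖w‖ ^ (2 * σ) : ℝ) : ℂ) * (((r ^ σ - 1 - σ * (r - 1) : ℝ) : ℂ) * (w + h) +
      ((σ * (r - 1) : ℝ) : ℂ) * h + ((σ * (‖h‖ ^ 2 / ‖w‖ ^ 2) : ℝ) : ℂ) * w) := by
  have hw' : 0 < ‖w‖ := norm_pos_iff.2 hw
  have h1 : ‖w + h‖ ^ (2 * σ) = ‖w‖ ^ (2 * σ) * r ^ σ := by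
    rw [hr, Real.div_rpow (by positivity) (by positivity), ← Real.rpow_natCast, ← Real.rpow_natCast,
      ← Real.rpow_mul (norm_nonneg _), ← Real.rpow_mul (norm_nonneg _)]
    push_cast
    field_simp
  have h2 : ‖w‖ ^ (2 * σ - 2) = ‖w‖ ^ (2 * σ) / ‖w‖ ^ 2 := by
    rw [Real.rpow_sub hw', Real.rpow_two]
  have h3 : ((‖w‖ : ℝ) : ℂ) ^ 2 = w * starRingEnd ℂ w := (Complex.mul_conj' w).symm
  have h4 : ((‖h‖ : ℝ) : ℂ) ^ 2 = h * starRingEnd ℂ h := (Complex.mul_conj' h).symm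
  have h5 : ((‖w + h‖ : ℝ) : ℂ) ^ 2 = (w + h) * (starRingEnd ℂ w + starRingEnd ℂ h) := by
    rw [← map_add]; exact (Complex.mul_conj' (w + h)).symm
  have hwc : starRingEnd ℂ w ≠ 0 := by simpa using hw
  have h6 : (r : ℂ) - 1 =
      ((w + h) * (starRingEnd ℂ w + starRingEnd ℂ h)) / (w * starRingEnd ℂ w) - 1 := by
    rw [hr]; push_cast; rw [h5, h3]
  unfold remainder powerFun derivLin derivConj
  rw [h1, h2]
  push_cast
  rw [h6, h3, h4]
  field_simp
  ring

/-- The first-order expansion of `powerFun`, with a remainder of any order `1 + α ≤ 2` for which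
the homogeneity `2 σ + 1` allows it. -/
theorem exists_norm_remainder_le {σ α : ℝ} (hσ : 0 < σ) (hα : 0 < α) (hα1 : α ≤ 1)
    (hασ : α ≤ 2 * σ) : ∃ C : ℝ≥0, ∀ w h : ℂ,
      ‖remainder σ w h‖ ≤ C * ((‖w‖ + ‖w + h‖) ^ (2 * σ - α) * ‖h‖ ^ (1 + α)) := by
  obtain ⟨C₁, hC₁, hC⟩ := exists_abs_rpow_sub_le σ
  have hK : 0 ≤ max (9 + 4 + 2 * (1 + 2 * σ)) (C₁ * (25 / 4) * (3 / 2) + σ * (5 / 2) + σ) :=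
    le_max_of_le_left (by positivity)
  refine ⟨Real.toNNReal
    (max (9 + 4 + 2 * (1 + 2 * σ)) (C₁ * (25 / 4) * (3 / 2) + σ * (5 / 2) + σ)), fun w h ↦ ?_⟩
  rw [Real.coe_toNNReal _ hK]
  set N := ‖w‖ + ‖w + h‖ with hN
  have hwN : ‖w‖ ≤ N := by rw [hN]; linarith [norm_nonneg (w + h)]
  have hwhN : ‖w + h‖ ≤ N := by rw [hN]; linarith [norm_nonneg w]
  have hN0 : 0 ≤ N := (norm_nonneg _).trans hwN
  set P := N ^ (2 * σ - α) * ‖h‖ ^ (1 + α) with hP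
  have hP0 : 0 ≤ P := by positivity
  -- For `|w| ≤ 2 |h|` each term of the remainder is bounded separately; for `|h| < |w| / 2` the
  -- ratio `r = |w + h|² / |w|²` stays in `[1 / 4, 9 / 4]`, where `r ^ σ` is expanded.
  rcases le_or_gt (‖w‖ / 2) ‖h‖ with hcase | hcase
  · have hw2 : ‖w‖ ≤ 2 * ‖h‖ := by linarith
    have hwh3 : ‖w + h‖ ≤ 3 * ‖h‖ := (norm_add_le _ _).trans (by linarith)
    have hpow : ∀ {x c : ℝ}, 0 ≤ x → x ≤ N → x ≤ c * ‖h‖ → 1 ≤ c →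
        x ^ (2 * σ + 1) ≤ c ^ 2 * P := fun {x c} hx hxN hxc hc ↦ by
      have e1 : x ^ (2 * σ + 1) = x ^ (2 * σ - α) * x ^ (1 + α) := by
        rw [← Real.rpow_add_of_nonneg hx (by linarith) (by linarith)]; ring_nf
      have e2 : x ^ (1 + α) ≤ c ^ 2 * ‖h‖ ^ (1 + α) := by
        refine (Real.rpow_le_rpow hx hxc (by linarith)).trans ?_
        rw [Real.mul_rpow (by linarith) (norm_nonneg _), ← Real.rpow_two]
        gcongr
        linarith
      rw [e1, hP]
      calc _ ≤ N ^ (2 * σ - α) * (c ^ 2 * ‖h‖ ^ (1 + α)) := by gcongr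
        _ = _ := by ring
    have hlin : ‖w‖ ^ (2 * σ) * ‖h‖ ≤ 2 * P := by
      have e1 : ‖w‖ ^ (2 * σ) = ‖w‖ ^ (2 * σ - α) * ‖w‖ ^ α := by
        rw [← Real.rpow_add_of_nonneg (norm_nonneg _) (by linarith) (by linarith)]; ring_nf
      have e2 : ‖w‖ ^ α ≤ 2 * ‖h‖ ^ α := by
        refine (Real.rpow_le_rpow (norm_nonneg _) hw2 hα.le).trans ?_
        rw [Real.mul_rpow two_pos.le (norm_nonneg _)]
        gcongr
        calc (2 : ℝ) ^ α ≤ 2 ^ (1 : ℝ) := Real.rpow_le_rpow_of_exponent_le one_le_two hα1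
          _ = 2 := Real.rpow_one 2
      have e3 : ‖h‖ ^ (1 + α) = ‖h‖ ^ α * ‖h‖ := by
        rw [add_comm, Real.rpow_add_of_nonneg (norm_nonneg _) hα.le zero_le_one, Real.rpow_one]
      rw [e1, hP, e3]
      calc _ ≤ N ^ (2 * σ - α) * (2 * ‖h‖ ^ α) * ‖h‖ := by gcongr
        _ = _ := by ring
    have t1 := hpow (norm_nonneg _) hwhN hwh3 (by norm_num)
    have t2 := hpow (norm_nonneg _) hwN hw2 (by norm_num)
    rw [← norm_powerFun hσ] at t1 t2
    have t3 : ‖derivLin σ w * h‖ ≤ (1 + σ) * (2 * P) := by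
      rw [norm_mul, norm_derivLin hσ, mul_assoc]
      exact mul_le_mul_of_nonneg_left hlin (by linarith)
    have t4 : ‖derivConj σ w * starRingEnd ℂ h‖ ≤ σ * (2 * P) := by
      rw [norm_mul, norm_derivConj hσ, mul_assoc, RCLike.norm_conj]
      exact mul_le_mul_of_nonneg_left hlin (by linarith)
    have t5 : ‖remainder σ w h‖ ≤ (9 + 4 + 2 * (1 + 2 * σ)) * P := by
      refine (norm_sub_le _ _).trans ((add_le_add (norm_sub_le _ _) (norm_add_le _ _)).trans ?_)
      linarith
    exact t5.trans (mul_le_mul_of_nonneg_right (le_max_left _ _) hP0)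
  · have hw' : 0 < ‖w‖ := by linarith [norm_nonneg h]
    have hw : w ≠ 0 := norm_pos_iff.1 hw'
    set q := ‖h‖ / ‖w‖ with hq
    have hq0 : 0 ≤ q := by positivity
    have hq1 : q ≤ 1 / 2 := by rw [hq, div_le_iff₀ hw']; linarith
    have hhq : ‖h‖ = q * ‖w‖ := by rw [hq]; field_simp
    have hr0 : ∃ r : ℝ, r = ‖w + h‖ ^ 2 / ‖w‖ ^ 2 := ⟨_, rfl⟩
    obtain ⟨r, hr⟩ := hr0
    have hup : ‖w + h‖ ≤ (1 + q) * ‖w‖ := (norm_add_le _ _).trans (by rw [hhq]; linarith)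
    have hlo : (1 - q) * ‖w‖ ≤ ‖w + h‖ := by
      have := norm_sub_le (w + h) h
      rw [add_sub_cancel_right] at this
      rw [hhq] at this; linarith
    have hrup : r ≤ (1 + q) ^ 2 := by
      rw [hr, div_le_iff₀ (by positivity), ← mul_pow]
      gcongr
    have hrlo : (1 - q) ^ 2 ≤ r := by
      rw [hr, le_div_iff₀ (by positivity), ← mul_pow]
      have : 0 ≤ (1 - q) * ‖w‖ := mul_nonneg (by linarith) hw'.le
      gcongr
    have hrmem : r ∈ Set.Icc (1 / 4 : ℝ) (9 / 4) := ⟨by nlinarith, by nlinarith⟩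
    have hr1 : |r - 1| ≤ 5 / 2 * q := abs_le.2 ⟨by nlinarith, by nlinarith⟩
    have hr2 : (r - 1) ^ 2 ≤ 25 / 4 * q ^ 2 := by
      rw [← sq_abs]; nlinarith [abs_nonneg (r - 1)]
    have hb := hC r hrmem
    have t1 : ‖((r ^ σ - 1 - σ * (r - 1) : ℝ) : ℂ) * (w + h)‖ ≤
        C₁ * (25 / 4 * q ^ 2) * (3 / 2 * ‖w‖) := by
      rw [norm_mul, Complex.norm_real, Real.norm_eq_abs]
      refine mul_le_mul (hb.trans ?_) (hup.trans ?_) (norm_nonneg _) (by positivity)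
      · gcongr
      · gcongr; linarith
    have t2 : ‖((σ * (r - 1) : ℝ) : ℂ) * h‖ ≤ σ * (5 / 2 * q) * (q * ‖w‖) := by
      rw [norm_mul, Complex.norm_real, norm_mul, Real.norm_eq_abs, Real.norm_eq_abs, abs_of_pos hσ,
        ← hhq]
      gcongr
    have t3 : ‖((σ * (‖h‖ ^ 2 / ‖w‖ ^ 2) : ℝ) : ℂ) * w‖ = σ * q ^ 2 * ‖w‖ := by
      rw [norm_mul, Complex.norm_real, Real.norm_of_nonneg (by positivity), hq, div_pow]
    have t4 : ‖remainder σ w h‖ ≤ ‖w‖ ^ (2 * σ) *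
        ((C₁ * (25 / 4) * (3 / 2) + σ * (5 / 2) + σ) * (q ^ 2 * ‖w‖)) := by
      rw [remainder_eq hw hr, norm_mul, Complex.norm_real, Real.norm_of_nonneg (by positivity)]
      gcongr
      refine (norm_add_le _ _).trans ((add_le_add_left (norm_add_le _ _) _).trans ?_)
      rw [t3]
      linarith
    have t5 : ‖w‖ ^ (2 * σ) * (q ^ 2 * ‖w‖) ≤ P := by
      -- a remainder of second order is also one of order `1 + α`, as `q ≤ 1 / 2`
      have e1 : q ^ 2 ≤ q ^ (1 + α) := by
        rcases hq0.eq_or_lt with h0 | h0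
        · rw [← h0, Real.zero_rpow (by linarith)]; norm_num
        · rw [← Real.rpow_two]
          exact Real.rpow_le_rpow_of_exponent_ge h0 (by linarith) (by linarith)
      have e2 : ‖w‖ ^ (2 * σ) * ‖w‖ = ‖w‖ ^ (2 * σ - α) * ‖w‖ ^ (1 + α) := by
        rw [← Real.rpow_add_one hw'.ne', ← Real.rpow_add hw']; ring_nf
      calc _ = q ^ 2 * (‖w‖ ^ (2 * σ) * ‖w‖) := by ring
        _ ≤ q ^ (1 + α) * (‖w‖ ^ (2 * σ - α) * ‖w‖ ^ (1 + α)) := by rw [e2]; gcongr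
        _ = ‖w‖ ^ (2 * σ - α) * (q * ‖w‖) ^ (1 + α) := by
            rw [Real.mul_rpow hq0 hw'.le]; ring
        _ ≤ P := by rw [← hhq, hP]; gcongr
    calc _ ≤ _ := t4
      _ = (C₁ * (25 / 4) * (3 / 2) + σ * (5 / 2) + σ) * (‖w‖ ^ (2 * σ) * (q ^ 2 * ‖w‖)) := by ring
      _ ≤ (C₁ * (25 / 4) * (3 / 2) + σ * (5 / 2) + σ) * P := by gcongr
      _ ≤ _ := mul_le_mul_of_nonneg_right (le_max_right _ _) hP0

/-! ### The operator `(1 - Δ) ^ (s / 2)` as the limit of truncated difference operators -/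

/-- Existence of `v = ((1 - Δ) ^ (s / 2) - 1) u` as a square-integrable function. -/
theorem exists_fourier_eq_symbol_sub_one_mul {s : ℝ} (hs : 0 ≤ s) (u : L2 d)
    (hu : energy s u ≠ ∞) :
    ∃ v : L2 d, (𝓕 v : L2 d) =ᵐ[volume] fun ξ ↦ ((symbol d s ξ - 1 : ℝ) : ℂ) * (𝓕 u : L2 d) ξ := by
  have hm : MemLp (fun ξ ↦ ((symbol d s ξ - 1 : ℝ) : ℂ) * (𝓕 u : L2 d) ξ) 2 volume := by
    refine ⟨(Complex.continuous_ofReal.comp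
      ((continuous_symbol s).sub continuous_const)).aestronglyMeasurable.mul
      (Lp.aestronglyMeasurable _), ?_⟩
    rw [eLpNorm_two_eq_lnorm, lnorm]
    refine ENNReal.rpow_lt_top_of_nonneg (by positivity) (ne_top_of_le_ne_top hu ?_)
    refine lintegral_mono fun ξ ↦ ?_
    have h1 := one_le_symbol (d := d) hs ξ
    rw [enorm_mul, ENNReal.mul_rpow_of_nonneg _ _ two_pos.le, ← ofReal_norm, Complex.norm_real,
      Real.norm_of_nonneg (by linarith), ENNReal.ofReal_rpow_of_nonneg (by linarith) two_pos.le,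
      Real.rpow_two, two_mul, ← symbol_mul]
    gcongr
    nlinarith
  exact ⟨𝓕⁻ (hm.toLp _), by rw [FourierTransform.fourier_fourierInv_eq]; exact hm.coeFn_toLp⟩

/-- The pairing of a difference of `u` with `h`, on the Fourier side. -/
theorem integral_mul_conj_sub_translate (u h : L2 d) (z : Eu d) :
    ∫ x, (u x - u (x + z)) * starRingEnd ℂ (h x) =
      ∫ ξ, (1 - phase z ξ) * ((𝓕 u : L2 d) ξ * starRingEnd ℂ ((𝓕 h : L2 d) ξ)) := by
  have h1 := integral_mul_conj_fourier (diff z u) h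
  have h2 : ∫ x, diff z u x * starRingEnd ℂ (h x) = ∫ x, (u (x + z) - u x) * starRingEnd ℂ (h x) :=
    integral_congr_ae ((coeFn_diff z u).mono fun x hx ↦ by simp only [hx])
  have h3 : ∫ ξ, (𝓕 (diff z u) : L2 d) ξ * starRingEnd ℂ ((𝓕 h : L2 d) ξ) =
      ∫ ξ, (phase z ξ - 1) * (𝓕 u : L2 d) ξ * starRingEnd ℂ ((𝓕 h : L2 d) ξ) :=
    integral_congr_ae ((fourier_diff z u).mono fun x hx ↦ by simp only [hx])
  rw [h2, h3] at h1
  rw [← neg_inj, ← integral_neg, ← integral_neg]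
  convert h1.symm using 3 <;> ring

theorem integrable_mul_conj (f h : L2 d) :
    Integrable fun ξ ↦ f ξ * starRingEnd ℂ (h ξ) := by
  have h1 : MemLp (fun ξ ↦ starRingEnd ℂ (h ξ)) 2 volume := (Lp.memLp h).star
  exact (Lp.memLp f).integrable_mul h1

theorem measurable_phase {α : Type*} [MeasurableSpace α] {f g : α → Eu d} (hf : Measurable f)
    (hg : Measurable g) : Measurable fun a ↦ phase (f a) (g a) := by
  have h : Measurable fun a ↦ inner ℝ (f a) (g a) := hf.inner hg
  unfold phase
  fun_prop

theorem measurable_one_sub_phase_step :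
    Measurable fun p : (Eu d × ℝ) × Eu d ↦ 1 - phase (step p.1) p.2 := by
  exact measurable_const.sub (measurable_phase (measurable_step.comp measurable_fst) measurable_snd)

theorem stronglyMeasurable_symbolTrunc {s : ℝ} (hs0 : 0 < s) (hs2 : s < 2) (n : ℕ) :
    StronglyMeasurable (symbolTrunc d s n) := by
  have := isFiniteMeasure_levyTrunc (d := d) hs0 hs2 n
  refine StronglyMeasurable.integral_prod_right (f := fun (ξ : Eu d) (q : Eu d × ℝ) ↦
    1 - (phase (step q) ξ).re) (Measurable.stronglyMeasurable ?_)
  have h : Measurable fun p : Eu d × (Eu d × ℝ) ↦ phase (step p.2) p.1 :=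
    measurable_phase (measurable_step.comp measurable_snd) measurable_fst
  exact measurable_const.sub (Complex.measurable_re.comp h)

/-- The truncated difference operators converge weakly in `L²`. -/
theorem tendsto_integral_mul_sub_translate {s : ℝ} (hs0 : 0 < s) (hs2 : s < 2) {u v : L2 d}
    (hv : (𝓕 v : L2 d) =ᵐ[volume] fun ξ ↦ ((symbol d s ξ - 1 : ℝ) : ℂ) * (𝓕 u : L2 d) ξ)
    {w : Eu d → ℂ} (hw : MemLp w 2 volume) :
    Tendsto (fun n ↦ ∫ q, (∫ x, w x * (u x - u (x + step q))) ∂levyTrunc d s n) atTop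
      (𝓝 (∫ x, w x * v x)) := by
  have hwc : MemLp (fun x ↦ starRingEnd ℂ (w x)) 2 volume := hw.star
  set h : L2 d := hwc.toLp _ with hh
  have hhw : ∀ᵐ x, starRingEnd ℂ (h x) = w x := hwc.coeFn_toLp.mono fun x hx ↦ by
    rw [hx, Complex.conj_conj]
  have h1 : ∀ z, ∫ x, w x * (u x - u (x + z)) =
      ∫ ξ, (1 - phase z ξ) * ((𝓕 u : L2 d) ξ * starRingEnd ℂ ((𝓕 h : L2 d) ξ)) := fun z ↦ by
    rw [← integral_mul_conj_sub_translate]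
    exact integral_congr_ae (hhw.mono fun x hx ↦ by simp only [hx, mul_comm])
  have h2 : ∫ x, w x * v x =
      ∫ ξ, ((symbol d s ξ - 1 : ℝ) : ℂ) * ((𝓕 u : L2 d) ξ * starRingEnd ℂ ((𝓕 h : L2 d) ξ)) := by
    calc _ = ∫ x, v x * starRingEnd ℂ (h x) :=
          integral_congr_ae (hhw.mono fun x hx ↦ by simp only [hx, mul_comm])
      _ = ∫ ξ, (𝓕 v : L2 d) ξ * starRingEnd ℂ ((𝓕 h : L2 d) ξ) :=
          (integral_mul_conj_fourier v h).symm
      _ = _ := integral_congr_ae (hv.mono fun x hx ↦ by simp only [hx, mul_assoc])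
  have hint := integrable_mul_conj (𝓕 u : L2 d) (𝓕 h : L2 d)
  have h3 : ∀ n, ∫ q, (∫ x, w x * (u x - u (x + step q))) ∂levyTrunc d s n =
      ∫ ξ, ((symbolTrunc d s n ξ : ℝ) : ℂ) *
        ((𝓕 u : L2 d) ξ * starRingEnd ℂ ((𝓕 h : L2 d) ξ)) := fun n ↦ by
    have := isFiniteMeasure_levyTrunc (d := d) hs0 hs2 n
    simp_rw [h1]
    rw [integral_integral_swap]
    · congr 1 with ξ
      rw [integral_mul_const, integral_one_sub_phase_levyTrunc hs0 hs2]
    · refine (hint.comp_snd (levyTrunc d s n)).bdd_mul (c := 2) ?_ (ae_of_all _ fun q ↦ ?_)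
      · exact measurable_one_sub_phase_step.aestronglyMeasurable
      · refine (norm_sub_le _ _).trans ?_
        rw [norm_phase]; norm_num
  simp_rw [h3]
  rw [h2]
  have hbound := integrable_mul_conj (𝓕 v : L2 d) (𝓕 h : L2 d)
  have hsm : ∀ n, AEStronglyMeasurable (fun ξ ↦ ((symbolTrunc d s n ξ : ℝ) : ℂ)) volume := fun n ↦
    (Complex.continuous_ofReal.comp_stronglyMeasurable
      (stronglyMeasurable_symbolTrunc hs0 hs2 n)).aestronglyMeasurable
  -- the truncated symbols are dominated by `symbol d s ξ - 1`, which makes `𝓕 v` out of `𝓕 u`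
  refine tendsto_integral_of_dominated_convergence _ (fun n ↦ (hsm n).mul hint.1) hbound.norm
    (fun n ↦ ?_) (ae_of_all _ fun ξ ↦ ?_)
  · filter_upwards [hv] with ξ hξ
    rw [hξ, mul_assoc, norm_mul, norm_mul _ (_ * _), Complex.norm_real, Complex.norm_real,
      Real.norm_of_nonneg (symbolTrunc_nonneg s n ξ), Real.norm_of_nonneg
      (by linarith [one_le_symbol hs0.le ξ])]
    gcongr
    exact symbolTrunc_le hs0 hs2 n ξ
  · exact ((Complex.continuous_ofReal.tendsto _).comp (tendsto_symbolTrunc hs0 hs2 ξ)).mul_const _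

/-! ### Action on Schwartz functions -/

/-- The function `(1 - Δ) ^ (s / 2) φ`, in the form in which it occurs in the definition of
`besselPow` by duality. -/
noncomputable def besselSchwartz (s : ℝ) (φ : 𝓢(Eu d, ℂ)) : 𝓢(Eu d, ℂ) :=
  𝓕 (SchwartzMap.smulLeftCLM ℂ (fun ξ : Eu d ↦ (symbol d s ξ : ℂ)) (𝓕⁻ φ))

theorem besselPow_apply (s : ℝ) (T : 𝓢'(Eu d, ℂ)) (φ : 𝓢(Eu d, ℂ)) :
    besselPow d s T φ = T (besselSchwartz s φ) := rfl

theorem smulLeftCLM_symbol_apply (s : ℝ) (ψ : 𝓢(Eu d, ℂ)) (ξ : Eu d) :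
    SchwartzMap.smulLeftCLM ℂ (fun ξ : Eu d ↦ (symbol d s ξ : ℂ)) ψ ξ = (symbol d s ξ : ℂ) * ψ ξ := by
  rw [SchwartzMap.smulLeftCLM_apply_apply (symbol_hasTemperateGrowth d s), smul_eq_mul]

theorem fourier_fourier_apply (g : 𝓢(Eu d, ℂ)) (ξ : Eu d) :
    (𝓕 (𝓕 g : 𝓢(Eu d, ℂ)) : 𝓢(Eu d, ℂ)) ξ = g (-ξ) := by
  have h1 : g (-ξ) = (𝓕⁻ (𝓕 g : 𝓢(Eu d, ℂ)) : 𝓢(Eu d, ℂ)) (-ξ) := by simp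
  rw [h1, SchwartzMap.fourierInv_coe, SchwartzMap.fourier_coe (𝓕 g), Real.fourierInv_eq_fourier_neg,
    neg_neg]

theorem symbol_neg (s : ℝ) (ξ : Eu d) : symbol d s (-ξ) = symbol d s ξ := by
  rw [symbol, symbol, norm_neg]

theorem fourier_besselSchwartz_apply (s : ℝ) (φ : 𝓢(Eu d, ℂ)) (ξ : Eu d) :
    (𝓕 (besselSchwartz s φ) : 𝓢(Eu d, ℂ)) ξ = (symbol d s ξ : ℂ) * (𝓕 φ : 𝓢(Eu d, ℂ)) ξ := by
  rw [besselSchwartz, fourier_fourier_apply, smulLeftCLM_symbol_apply, symbol_neg,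
    SchwartzMap.fourierInv_coe, Real.fourierInv_eq_fourier_neg, neg_neg, SchwartzMap.fourier_coe]

theorem fourier_apply_eq_integral_phase (ψ : 𝓢(Eu d, ℂ)) (x : Eu d) :
    (𝓕 ψ : 𝓢(Eu d, ℂ)) x = ∫ ξ, phase (-x) ξ * ψ ξ := by
  rw [SchwartzMap.fourier_coe, Real.fourier_eq']
  congr 1 with ξ
  rw [phase, inner_neg_left, real_inner_comm, smul_eq_mul]
  congr 3
  push_cast
  ring

/-- The truncated operator acts on the Schwartz function `𝓕 ψ` as the multiplier `symbolTrunc`. -/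
theorem integral_sub_translate_schwartz {s : ℝ} (hs0 : 0 < s) (hs2 : s < 2) (n : ℕ)
    (ψ : 𝓢(Eu d, ℂ)) (x : Eu d) :
    ∫ q, ((𝓕 ψ : 𝓢(Eu d, ℂ)) x - (𝓕 ψ : 𝓢(Eu d, ℂ)) (x - step q)) ∂levyTrunc d s n =
      ∫ ξ, ((symbolTrunc d s n ξ : ℝ) : ℂ) * (phase (-x) ξ * ψ ξ) := by
  have := isFiniteMeasure_levyTrunc (d := d) hs0 hs2 n
  have hphi : ∀ (y : Eu d) (χ : 𝓢(Eu d, ℂ)), Integrable fun ξ ↦ phase y ξ * χ ξ := fun y χ ↦ by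
    refine χ.integrable.bdd_mul (c := 1) ?_ (ae_of_all _ fun ξ ↦ (norm_phase _ _).le)
    exact (measurable_phase measurable_const measurable_id).aestronglyMeasurable
  have h1 : ∀ q : Eu d × ℝ, (𝓕 ψ : 𝓢(Eu d, ℂ)) x - (𝓕 ψ : 𝓢(Eu d, ℂ)) (x - step q) =
      ∫ ξ, (1 - phase (step q) ξ) * (phase (-x) ξ * ψ ξ) := fun q ↦ by
    rw [← fourier_phaseMul, fourier_apply_eq_integral_phase, fourier_apply_eq_integral_phase,
      ← integral_sub (hphi _ _) (hphi _ _)]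
    congr 1 with ξ
    rw [phaseMul_apply]; ring
  simp_rw [h1]
  rw [integral_integral_swap]
  · congr 1 with ξ
    rw [integral_mul_const, integral_one_sub_phase_levyTrunc hs0 hs2]
  · refine ((hphi (-x) ψ).comp_snd (levyTrunc d s n)).bdd_mul (c := 2) ?_ (ae_of_all _ fun q ↦ ?_)
    · exact measurable_one_sub_phase_step.aestronglyMeasurable
    · refine (norm_sub_le _ _).trans ?_
      rw [norm_phase]; norm_num

theorem integrable_symbol_mul (s : ℝ) (ψ : 𝓢(Eu d, ℂ)) :
    Integrable fun ξ ↦ (symbol d s ξ : ℂ) * ψ ξ := by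
  refine (SchwartzMap.smulLeftCLM ℂ (fun ξ : Eu d ↦ (symbol d s ξ : ℂ)) ψ).integrable.congr
    (ae_of_all _ fun ξ ↦ smulLeftCLM_symbol_apply s ψ ξ)

theorem exists_norm_schwartz_le (φ : 𝓢(Eu d, ℂ)) : ∃ C : ℝ, ∀ x, ‖φ x‖ ≤ C :=
  ⟨_, fun x ↦ φ.toBoundedContinuousFunction.norm_coe_le_norm x⟩

/-- The pairing of `f` with the truncated operators applied to a Schwartz function, for
integrable `f`. -/
theorem tendsto_integral_mul_schwartz_of_integrable {s : ℝ} (hs0 : 0 < s) (hs2 : s < 2)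
    (φ : 𝓢(Eu d, ℂ)) {f : Eu d → ℂ} (hf : Integrable f) :
    Tendsto (fun n ↦ ∫ q, (∫ x, f x * (φ x - φ (x - step q))) ∂levyTrunc d s n) atTop
      (𝓝 (∫ x, f x * (besselSchwartz s φ x - φ x))) := by
  obtain ⟨ψ, rfl⟩ : ∃ ψ : 𝓢(Eu d, ℂ), 𝓕 ψ = φ := ⟨𝓕⁻ φ, by simp⟩
  have hswap : ∀ n, ∫ q, (∫ x, f x * ((𝓕 ψ : 𝓢(Eu d, ℂ)) x -
      (𝓕 ψ : 𝓢(Eu d, ℂ)) (x - step q))) ∂levyTrunc d s n =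
      ∫ x, f x * ∫ ξ, ((symbolTrunc d s n ξ : ℝ) : ℂ) * (phase (-x) ξ * ψ ξ) := by
    intro n
    have := isFiniteMeasure_levyTrunc (d := d) hs0 hs2 n
    rw [integral_integral_swap]
    · congr 1 with x
      rw [integral_const_mul, integral_sub_translate_schwartz hs0 hs2]
    · obtain ⟨C, hC'⟩ := exists_norm_schwartz_le (𝓕 ψ : 𝓢(Eu d, ℂ))
      refine (hf.comp_snd (levyTrunc d s n)).mul_bdd (c := C + C) ?_ (ae_of_all _ fun q ↦ ?_)
      · have hc : Measurable fun x ↦ (𝓕 ψ : 𝓢(Eu d, ℂ)) x := (𝓕 ψ : 𝓢(Eu d, ℂ)).continuous.measurable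
        exact ((hc.comp measurable_snd).sub (hc.comp (measurable_snd.sub
          (measurable_step.comp measurable_fst)))).aestronglyMeasurable
      · exact (norm_sub_le _ _).trans (add_le_add (hC' _) (hC' _))
  simp_rw [hswap]
  have hsymb := integrable_symbol_mul s ψ
  have hbd : ∀ n x ξ, ‖((symbolTrunc d s n ξ : ℝ) : ℂ) * (phase (-x) ξ * ψ ξ)‖ ≤
      ‖(symbol d s ξ : ℂ) * ψ ξ‖ := fun n x ξ ↦ by
    rw [norm_mul, norm_mul, norm_mul, norm_phase, one_mul, Complex.norm_real, Complex.norm_real,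
      Real.norm_of_nonneg (symbolTrunc_nonneg s n ξ), Real.norm_of_nonneg (symbol_pos s ξ).le]
    gcongr
    linarith [symbolTrunc_le hs0 hs2 n ξ]
  have hmeas : ∀ n, StronglyMeasurable (fun q : Eu d × Eu d ↦
      ((symbolTrunc d s n q.2 : ℝ) : ℂ) * (phase (-q.1) q.2 * ψ q.2)) := fun n ↦ by
    refine ((Complex.continuous_ofReal.comp_stronglyMeasurable
      ((stronglyMeasurable_symbolTrunc hs0 hs2 n).comp_measurable measurable_snd))).mul ?_
    refine Measurable.stronglyMeasurable (Measurable.mul ?_ ?_)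
    · exact measurable_phase measurable_fst.neg measurable_snd
    · exact ψ.continuous.measurable.comp measurable_snd
  have hpt : ∀ x, Tendsto (fun n ↦ ∫ ξ, ((symbolTrunc d s n ξ : ℝ) : ℂ) * (phase (-x) ξ * ψ ξ)) atTop
      (𝓝 (besselSchwartz s (𝓕 ψ) x - (𝓕 ψ : 𝓢(Eu d, ℂ)) x)) := fun x ↦ by
    have hlim : besselSchwartz s (𝓕 ψ) x - (𝓕 ψ : 𝓢(Eu d, ℂ)) x =
        ∫ ξ, ((symbol d s ξ - 1 : ℝ) : ℂ) * (phase (-x) ξ * ψ ξ) := by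
      have hph : ∀ χ : 𝓢(Eu d, ℂ), Integrable fun ξ ↦ phase (-x) ξ * χ ξ := fun χ ↦ by
        refine χ.integrable.bdd_mul (c := 1) ?_ (ae_of_all _ fun ξ ↦ (norm_phase _ _).le)
        exact (measurable_phase measurable_const measurable_id).aestronglyMeasurable
      rw [besselSchwartz, FourierTransform.fourierInv_fourier_eq, fourier_apply_eq_integral_phase,
        fourier_apply_eq_integral_phase, ← integral_sub (hph _) (hph _)]
      congr 1 with ξ
      rw [smulLeftCLM_symbol_apply]
      push_cast
      ring
    rw [hlim]
    refine tendsto_integral_of_dominated_convergence _ (fun n ↦ ?_) hsymb.norm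
      (fun n ↦ ae_of_all _ (hbd n x)) (ae_of_all _ fun ξ ↦ ?_)
    · exact ((hmeas n).comp_measurable (measurable_const.prodMk measurable_id)).aestronglyMeasurable
    · exact ((Complex.continuous_ofReal.tendsto _).comp (tendsto_symbolTrunc hs0 hs2 ξ)).mul_const _
  refine tendsto_integral_of_dominated_convergence
    (fun x ↦ ‖f x‖ * ∫ ξ, ‖(symbol d s ξ : ℂ) * ψ ξ‖) (fun n ↦ ?_) (hf.norm.mul_const _)
    (fun n ↦ ae_of_all _ fun x ↦ ?_) (ae_of_all _ fun x ↦ (hpt x).const_mul _)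
  · exact hf.1.mul (StronglyMeasurable.integral_prod_right (f := fun (x ξ : Eu d) ↦
      ((symbolTrunc d s n ξ : ℝ) : ℂ) * (phase (-x) ξ * ψ ξ)) (hmeas n)).aestronglyMeasurable
  · rw [norm_mul]
    gcongr
    exact norm_integral_le_of_norm_le hsymb.norm (ae_of_all _ (hbd n x))

/-- The pairing of `f` with the truncated operators applied to a Schwartz function, for
square-integrable `f`. -/
theorem tendsto_integral_mul_schwartz_of_memLp_two {s : ℝ} (hs0 : 0 < s) (hs2 : s < 2)
    (φ : 𝓢(Eu d, ℂ)) {f : Eu d → ℂ} (hf : MemLp f 2 volume) :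
    Tendsto (fun n ↦ ∫ q, (∫ x, f x * (φ x - φ (x - step q))) ∂levyTrunc d s n) atTop
      (𝓝 (∫ x, f x * (besselSchwartz s φ x - φ x))) := by
  obtain ⟨v, hv⟩ : ∃ v : 𝓢(Eu d, ℂ), v = besselSchwartz s φ - φ := ⟨_, rfl⟩
  obtain ⟨a, ha⟩ : ∃ a : L2 d, a = φ.toLp 2 volume := ⟨_, rfl⟩
  obtain ⟨b, hb⟩ : ∃ b : L2 d, b = v.toLp 2 volume := ⟨_, rfl⟩
  have hF : (𝓕 b : L2 d) =ᵐ[volume]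
      fun ξ ↦ ((symbol d s ξ - 1 : ℝ) : ℂ) * (𝓕 a : L2 d) ξ := by
    rw [ha, hb, SchwartzMap.toLp_fourier_eq, SchwartzMap.toLp_fourier_eq]
    filter_upwards [(𝓕 v : 𝓢(Eu d, ℂ)).coeFn_toLp 2 volume,
      (𝓕 φ : 𝓢(Eu d, ℂ)).coeFn_toLp 2 volume] with ξ h1 h2
    have h3 : (𝓕 v : 𝓢(Eu d, ℂ)) = 𝓕 (besselSchwartz s φ) - 𝓕 φ := by
      rw [hv]; exact (FourierTransform.fourierCLM ℂ 𝓢(Eu d, ℂ)).map_sub _ _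
    rw [h1, h2, h3, sub_apply, fourier_besselSchwartz_apply]
    push_cast
    ring
  have h := tendsto_integral_mul_sub_translate hs0 hs2 hF hf
  have hφ : a =ᵐ[volume] φ := by rw [ha]; exact φ.coeFn_toLp 2 volume
  have hvv : b =ᵐ[volume] v := by rw [hb]; exact v.coeFn_toLp 2 volume
  have e1 : ∀ z : Eu d, ∫ x, f x * (a x - a (x + z)) = ∫ x, f x * (φ x - φ (x + z)) := fun z ↦ by
    have hφz := (measurePreserving_add_right (volume : Measure (Eu d)) z).quasiMeasurePreserving.ae hφ
    refine integral_congr_ae ?_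
    filter_upwards [hφ, hφz] with x h1 h2
    rw [h1, h2]
  have e2 : ∫ x, f x * b x = ∫ x, f x * (besselSchwartz s φ x - φ x) :=
    integral_congr_ae (hvv.mono fun x hx ↦ by simp only [hx, hv, sub_apply])
  rw [e2] at h
  refine h.congr fun n ↦ ?_
  simp_rw [e1]
  rw [← integral_step_neg s n (fun z ↦ ∫ x, f x * (φ x - φ (x + z)))]
  simp_rw [← sub_eq_add_neg]

/-! ### The chain rule with an integral remainder -/

theorem measurePreserving_shear {ν : Measure (Eu d × ℝ)} [SFinite ν] {g : Eu d × ℝ → Eu d}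
    (hg : Measurable g) :
    MeasurePreserving (fun r : (Eu d × ℝ) × Eu d ↦ (r.1, r.2 + g r.1)) (ν.prod volume)
      (ν.prod volume) := by
  refine (MeasurePreserving.id ν).skew_product (g := fun q x ↦ x + g q)
    (measurable_snd.add (hg.comp measurable_fst)) (ae_of_all _ fun q ↦ ?_)
  exact (measurePreserving_add_right volume (g q)).map_eq

theorem integrable_mul_translate_of_memLp_two {ν : Measure (Eu d × ℝ)} [IsFiniteMeasure ν]
    {g : Eu d × ℝ → Eu d} (hg : Measurable g) {w h : Eu d → ℂ} (hw : MemLp w 2 volume)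
    (hh : MemLp h 2 volume) :
    Integrable (fun r : (Eu d × ℝ) × Eu d ↦ w r.2 * h (r.2 + g r.1)) (ν.prod volume) := by
  have h1 : Integrable (fun r : (Eu d × ℝ) × Eu d ↦ ‖w r.2‖ ^ 2) (ν.prod volume) :=
    ((memLp_two_iff_integrable_sq_norm hw.1).1 hw).comp_snd ν
  have h2 : Integrable (fun r : (Eu d × ℝ) × Eu d ↦ ‖h (r.2 + g r.1)‖ ^ 2) (ν.prod volume) :=
    (measurePreserving_shear hg).integrable_comp_of_integrable
      (((memLp_two_iff_integrable_sq_norm hh.1).1 hh).comp_snd ν)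
  have hm : AEStronglyMeasurable (fun r : (Eu d × ℝ) × Eu d ↦ h (r.2 + g r.1)) (ν.prod volume) :=
    (hh.1.comp_snd (μ := ν)).comp_measurePreserving (measurePreserving_shear hg)
  refine (h1.add h2).mono' ((hw.1.comp_snd (μ := ν)).mul hm) (ae_of_all _ fun r ↦ ?_)
  simp only [norm_mul, Pi.add_apply]
  nlinarith [sq_nonneg (‖w r.2‖ - ‖h (r.2 + g r.1)‖), sq_nonneg ‖w r.2‖,
    sq_nonneg ‖h (r.2 + g r.1)‖]

/-- Truncation of the values: `f` is integrable where `1 < |f|`, and square-integrable elsewhere. -/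
theorem exists_integrable_add_memLp_two {p : ℝ} (hp1 : 1 ≤ p) (hp2 : p ≤ 2) {f : Eu d → ℂ}
    (hf : MemLp f (ENNReal.ofReal p) volume) :
    ∃ f₁ f₂ : Eu d → ℂ, f = f₁ + f₂ ∧ Integrable f₁ ∧ MemLp f₂ 2 volume := by
  have hp0 : 0 < p := by linarith
  have hi : Integrable fun x ↦ ‖f x‖ ^ p := by
    simpa [ENNReal.toReal_ofReal hp0.le] using
      hf.integrable_norm_rpow (by simpa using hp0) ENNReal.ofReal_ne_top
  set S : Set (Eu d) := {x | 1 < ‖f x‖}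
  have hS : NullMeasurableSet S volume :=
    nullMeasurableSet_lt aemeasurable_const hf.1.norm.aemeasurable
  have hm1 : AEStronglyMeasurable (S.indicator f) volume := hf.1.indicator₀ hS
  have hm2 : AEStronglyMeasurable (Sᶜ.indicator f) volume := hf.1.indicator₀ hS.compl
  refine ⟨S.indicator f, Sᶜ.indicator f, (Set.indicator_self_add_compl S f).symm, ?_, ?_⟩
  · refine hi.mono' hm1 (ae_of_all _ fun x ↦ ?_)
    by_cases hx : x ∈ S
    · rw [Set.indicator_of_mem hx]
      exact Real.self_le_rpow_of_one_le (le_of_lt hx) hp1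
    · rw [Set.indicator_of_notMem hx, norm_zero]; positivity
  · refine (memLp_two_iff_integrable_sq_norm hm2).2 (hi.mono' (hm2.norm.pow 2) (ae_of_all _ fun x ↦ ?_))
    rw [Real.norm_of_nonneg (by positivity)]
    by_cases hx : x ∈ S
    · rw [Set.indicator_of_notMem (by simpa using hx), norm_zero]; simp; positivity
    · rw [Set.indicator_of_mem (by simpa using hx), ← Real.rpow_natCast]
      rcases (norm_nonneg (f x)).eq_or_lt with h0 | h0
      · rw [← h0, Real.zero_rpow (by norm_num), Real.zero_rpow hp0.ne']
      · exact Real.rpow_le_rpow_of_exponent_ge h0 (not_lt.1 hx) (by exact_mod_cast hp2)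

/-- Integrability in both variables, which justifies the exchange of the integrals over the jumps
and over space. -/
theorem integrable_mul_schwartz_translate {p : ℝ} (hp1 : 1 ≤ p) (hp2 : p ≤ 2) {f : Eu d → ℂ}
    (hf : MemLp f (ENNReal.ofReal p) volume) {ν : Measure (Eu d × ℝ)} [IsFiniteMeasure ν]
    {g : Eu d × ℝ → Eu d} (hg : Measurable g) (φ : 𝓢(Eu d, ℂ)) :
    Integrable (fun r : (Eu d × ℝ) × Eu d ↦ f r.2 * φ (r.2 + g r.1)) (ν.prod volume) := by
  obtain ⟨f₁, f₂, rfl, h1, h2⟩ := exists_integrable_add_memLp_two hp1 hp2 hf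
  obtain ⟨C, hC⟩ := exists_norm_schwartz_le φ
  have hm : Measurable fun r : (Eu d × ℝ) × Eu d ↦ φ (r.2 + g r.1) :=
    φ.continuous.measurable.comp (measurable_snd.add (hg.comp measurable_fst))
  have i1 : Integrable (fun r : (Eu d × ℝ) × Eu d ↦ f₁ r.2 * φ (r.2 + g r.1)) (ν.prod volume) :=
    (h1.comp_snd ν).mul_bdd (c := C) hm.aestronglyMeasurable (ae_of_all _ fun r ↦ hC _)
  refine (i1.add (integrable_mul_translate_of_memLp_two hg h2 (φ.memLp 2 volume))).congr
    (ae_of_all _ fun r ↦ ?_)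
  simp only [Pi.add_apply, add_mul]

/-- For `f ∈ L^p`, `1 ≤ p ≤ 2`, the truncated operators converge to `(1 - Δ) ^ (s / 2) - 1` in the
sense of distributions. -/
theorem tendsto_integral_mul_schwartz {s : ℝ} (hs0 : 0 < s) (hs2 : s < 2) {p : ℝ} (hp1 : 1 ≤ p)
    (hp2 : p ≤ 2) {f : Eu d → ℂ} (hf : MemLp f (ENNReal.ofReal p) volume) (φ : 𝓢(Eu d, ℂ)) :
    Tendsto (fun n ↦ ∫ q, (∫ x, φ x * (f x - f (x + step q))) ∂levyTrunc d s n) atTop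
      (𝓝 (∫ x, f x * (besselSchwartz s φ x - φ x))) := by
  have hp : 1 ≤ ENNReal.ofReal p := by simpa using hp1
  have e1 : ∀ z : Eu d, ∫ x, φ x * (f x - f (x + z)) = ∫ x, f x * (φ x - φ (x - z)) := fun z ↦ by
    have hfz : MemLp (fun x ↦ f (x + z)) (ENNReal.ofReal p) volume :=
      hf.comp_measurePreserving (measurePreserving_add_right volume z)
    have hi := integrable_schwartz_mul hp hf φ
    have hi' := integrable_schwartz_mul hp hfz φ
    have hi2 : Integrable fun x ↦ f x * φ (x - z) := by
      have := hi'.comp_sub_right z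
      simpa only [sub_add_cancel, mul_comm] using this
    simp_rw [mul_sub]
    rw [integral_sub hi hi', integral_sub (by simpa only [mul_comm] using hi) hi2,
      ← integral_sub_right_eq_self (fun x ↦ φ x * f (x + z)) z]
    simp only [sub_add_cancel, mul_comm]
  simp_rw [e1]
  obtain ⟨f₁, f₂, rfl, h1, h2⟩ := exists_integrable_add_memLp_two hp1 hp2 hf
  have h1' : MemLp f₁ (ENNReal.ofReal 1) volume := by simpa [memLp_one_iff_integrable] using h1
  have h2' : MemLp f₂ (ENNReal.ofReal 2) volume := by simpa using h2
  have key : ∀ {r : ℝ}, 1 ≤ r → r ≤ 2 → ∀ {h : Eu d → ℂ}, MemLp h (ENNReal.ofReal r) volume →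
      ∀ n, Integrable (fun r : (Eu d × ℝ) × Eu d ↦ h r.2 * (φ r.2 - φ (r.2 - step r.1)))
        ((levyTrunc d s n).prod volume) := fun {r} hr1 hr2 {h} hh n ↦ by
    have := isFiniteMeasure_levyTrunc (d := d) hs0 hs2 n
    have j1 := integrable_mul_schwartz_translate hr1 hr2 hh (ν := levyTrunc d s n)
      (g := fun _ ↦ 0) measurable_const φ
    have j2 := integrable_mul_schwartz_translate hr1 hr2 hh (ν := levyTrunc d s n)
      (g := fun q ↦ -step q) measurable_step.neg φ
    refine (j1.sub j2).congr (ae_of_all _ fun r ↦ ?_)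
    simp only [Pi.sub_apply, add_zero, mul_sub, ← sub_eq_add_neg]
  have hpair : ∀ {r : ℝ}, 1 ≤ r → ∀ {h : Eu d → ℂ}, MemLp h (ENNReal.ofReal r) volume →
      ∀ χ : 𝓢(Eu d, ℂ), Integrable fun x ↦ h x * χ x := fun {r} hr {h} hh χ ↦ by
    simpa only [mul_comm] using integrable_schwartz_mul (by simpa using hr) hh χ
  have hlim := (tendsto_integral_mul_schwartz_of_integrable hs0 hs2 φ h1).add
    (tendsto_integral_mul_schwartz_of_memLp_two hs0 hs2 φ h2)
  have e2 : ∫ x, (f₁ + f₂) x * (besselSchwartz s φ x - φ x) =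
      (∫ x, f₁ x * (besselSchwartz s φ x - φ x)) + ∫ x, f₂ x * (besselSchwartz s φ x - φ x) := by
    have j1 := hpair le_rfl h1' (besselSchwartz s φ - φ)
    have j2 := hpair one_le_two h2' (besselSchwartz s φ - φ)
    simp only [sub_apply] at j1 j2
    rw [← integral_add j1 j2]
    simp only [Pi.add_apply, add_mul]
  rw [e2]
  refine hlim.congr fun n ↦ ?_
  have := isFiniteMeasure_levyTrunc (d := d) hs0 hs2 n
  have k1 := key le_rfl one_le_two h1' n
  have k2 := key one_le_two le_rfl h2' n
  have l1 := k1.integral_prod_left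
  have l2 := k2.integral_prod_left
  rw [← integral_add l1 l2]
  refine integral_congr_ae ?_
  filter_upwards [k1.prod_right_ae, k2.prod_right_ae] with q m1 m2
  rw [← integral_add m1 m2]
  simp only [Pi.add_apply, add_mul]

/-- **Chain rule.** If `v = ((1 - Δ) ^ (s / 2) - 1) u`, then `(1 - Δ) ^ (s / 2)` of `|u| ^ (2 σ) u`
is obtained by applying the differential of the power function to `v`, up to the integral of the
remainder of its first-order expansion against the Lévy measure. -/
theorem isBesselPow_powerFun {s σ p : ℝ} (hs0 : 0 < s) (hs2 : s < 2) (hp1 : 1 ≤ p) (hp2 : p ≤ 2)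
    {u v : L2 d}
    (hv : (𝓕 v : L2 d) =ᵐ[volume] fun ξ ↦ ((symbol d s ξ - 1 : ℝ) : ℂ) * (𝓕 u : L2 d) ξ)
    (hF : MemLp (fun x ↦ powerFun σ (u x)) (ENNReal.ofReal p) volume)
    (ha : ∀ φ : 𝓢(Eu d, ℂ), MemLp (fun x ↦ φ x * derivLin σ (u x)) 2 volume)
    (hb : ∀ φ : 𝓢(Eu d, ℂ), MemLp (fun x ↦ φ x * derivConj σ (u x)) 2 volume)
    (hR : ∀ φ : 𝓢(Eu d, ℂ), Integrable (fun r : (Eu d × ℝ) × Eu d ↦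
      φ r.2 * remainder σ (u r.2) (u (r.2 + step r.1) - u r.2)) ((levy d s).prod volume)) :
    IsBesselPow s (fun x ↦ powerFun σ (u x)) fun x ↦ powerFun σ (u x) +
      derivLin σ (u x) * v x + derivConj σ (u x) * starRingEnd ℂ (v x) -
      ∫ q, remainder σ (u x) (u (x + step q) - u x) ∂levy d s := by
  have hp : 1 ≤ ENNReal.ofReal p := by simpa using hp1
  have : Fact (1 ≤ ENNReal.ofReal p) := ⟨hp⟩
  have hvL := Lp.memLp v
  have huL := Lp.memLp u
  have i0 := fun φ : 𝓢(Eu d, ℂ) ↦ integrable_schwartz_mul hp hF φ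
  have i1 : ∀ φ : 𝓢(Eu d, ℂ), Integrable fun x ↦ φ x * derivLin σ (u x) * v x :=
    fun φ ↦ (ha φ).integrable_mul hvL
  have i2 : ∀ φ : 𝓢(Eu d, ℂ), Integrable fun x ↦ φ x * derivConj σ (u x) * starRingEnd ℂ (v x) :=
    fun φ ↦ (hb φ).integrable_mul hvL.star
  have i3 : ∀ φ : 𝓢(Eu d, ℂ), Integrable fun x ↦
      φ x * ∫ q, remainder σ (u x) (u (x + step q) - u x) ∂levy d s := fun φ ↦ by
    have := (hR φ).integral_prod_right
    simpa only [integral_const_mul] using this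
  have ig : ∀ φ : 𝓢(Eu d, ℂ), Integrable fun x ↦ φ x * (powerFun σ (u x) +
      derivLin σ (u x) * v x + derivConj σ (u x) * starRingEnd ℂ (v x) -
      ∫ q, remainder σ (u x) (u (x + step q) - u x) ∂levy d s) := fun φ ↦ by
    refine ((((i0 φ).add (i1 φ)).add (i2 φ)).sub (i3 φ)).congr (ae_of_all _ fun x ↦ ?_)
    simp only [Pi.add_apply, Pi.sub_apply]
    ring
  have hT : ∀ φ : 𝓢(Eu d, ℂ), (Lp.toTemperedDistribution (hF.toLp _) : 𝓢'(Eu d, ℂ)) φ =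
      ∫ x, φ x * powerFun σ (u x) := fun φ ↦ by
    rw [Lp.toTemperedDistribution_apply]
    exact integral_congr_ae (hF.coeFn_toLp.mono fun x hx ↦ by simp only [hx, smul_eq_mul])
  refine ⟨Lp.toTemperedDistribution (hF.toLp _), fun φ ↦ ⟨i0 φ, hT φ⟩, fun φ ↦ ⟨ig φ, ?_⟩⟩
  rw [besselPow_apply, hT]
  have hlim1 := tendsto_integral_mul_schwartz hs0 hs2 hp1 hp2 hF φ
  have hA := tendsto_integral_mul_sub_translate hs0 hs2 hv (ha φ)
  have hB' := tendsto_integral_mul_sub_translate hs0 hs2 hv (hb φ).star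
  -- the conjugate linear term is the conjugate of a pairing with `u` itself
  have hB : Tendsto (fun n ↦ ∫ q, (∫ x, φ x * derivConj σ (u x) *
      starRingEnd ℂ (u x - u (x + step q))) ∂levyTrunc d s n) atTop
      (𝓝 (∫ x, φ x * derivConj σ (u x) * starRingEnd ℂ (v x))) := by
    have := (Complex.continuous_conj.tendsto _).comp hB'
    simp only [Function.comp_def, ← integral_conj, map_mul, Pi.star_apply, RCLike.star_def,
      Complex.conj_conj] at this
    simpa only [map_mul] using this
  have hC := tendsto_integral_levyTrunc s (hR φ).integral_prod_left
  have hCs : ∫ q, (∫ x, φ x * remainder σ (u x) (u (x + step q) - u x)) ∂levy d s =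
      ∫ x, φ x * ∫ q, remainder σ (u x) (u (x + step q) - u x) ∂levy d s := by
    rw [integral_integral_swap (hR φ)]
    simp only [integral_const_mul]
  have hlim2 := (hA.add hB).sub hC
  -- the expansion of the difference of `powerFun` along `u`, integrated against the truncated
  -- measure, where all the terms are integrable separately
  have heq : ∀ n, ∫ q, (∫ x, φ x * derivLin σ (u x) * (u x - u (x + step q))) ∂levyTrunc d s n +
      ∫ q, (∫ x, φ x * derivConj σ (u x) * starRingEnd ℂ (u x - u (x + step q))) ∂levyTrunc d s n -
      ∫ q, (∫ x, φ x * remainder σ (u x) (u (x + step q) - u x)) ∂levyTrunc d s n =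
      ∫ q, (∫ x, φ x * (powerFun σ (u x) - powerFun σ (u (x + step q)))) ∂levyTrunc d s n := by
    intro n
    have := isFiniteMeasure_levyTrunc (d := d) hs0 hs2 n
    have kd : ∀ {w h : Eu d → ℂ}, MemLp w 2 volume → MemLp h 2 volume →
        Integrable (fun r : (Eu d × ℝ) × Eu d ↦ w r.2 * (h r.2 - h (r.2 + step r.1)))
          ((levyTrunc d s n).prod volume) := fun {w h} hw hh ↦ by
      have j1 := integrable_mul_translate_of_memLp_two (ν := levyTrunc d s n)
        (g := fun _ ↦ 0) measurable_const hw hh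
      have j2 := integrable_mul_translate_of_memLp_two (ν := levyTrunc d s n)
        (g := step) measurable_step hw hh
      refine (j1.sub j2).congr (ae_of_all _ fun r ↦ ?_)
      simp only [Pi.sub_apply, add_zero, mul_sub]
    have k1 := kd (ha φ) huL
    have k2 := kd (hb φ) huL.star
    have k3 : Integrable (fun r : (Eu d × ℝ) × Eu d ↦
        φ r.2 * remainder σ (u r.2) (u (r.2 + step r.1) - u r.2))
          ((levyTrunc d s n).prod volume) := by
      refine (hR φ).mono_measure ?_
      rw [levyTrunc]
      exact Measure.prod_mono Measure.restrict_le_self le_rfl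
    have k2' : Integrable (fun r : (Eu d × ℝ) × Eu d ↦
        φ r.2 * derivConj σ (u r.2) * starRingEnd ℂ (u r.2 - u (r.2 + step r.1)))
        ((levyTrunc d s n).prod volume) := by
      simpa only [map_sub, Pi.star_apply, RCLike.star_def] using k2
    have k12 : Integrable (fun q ↦ (∫ x, φ x * derivLin σ (u x) * (u x - u (x + step q))) +
        ∫ x, φ x * derivConj σ (u x) * starRingEnd ℂ (u x - u (x + step q))) (levyTrunc d s n) :=
      k1.integral_prod_left.add k2'.integral_prod_left
    rw [← integral_add k1.integral_prod_left k2'.integral_prod_left,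
      ← integral_sub k12 k3.integral_prod_left]
    refine integral_congr_ae ?_
    filter_upwards [k1.prod_right_ae, k2'.prod_right_ae, k3.prod_right_ae] with q m1 m2 m3
    rw [← integral_add' m1 m2, ← integral_sub' (m1.add m2) m3]
    congr 1 with x
    simp only [Pi.add_apply, Pi.sub_apply, remainder, add_sub_cancel, map_sub]
    ring
  have hfinal := tendsto_nhds_unique hlim1 (hlim2.congr heq)
  rw [hCs] at hfinal
  have n1 : ∫ x, powerFun σ (u x) * (besselSchwartz s φ x - φ x) =
      (∫ x, besselSchwartz s φ x * powerFun σ (u x)) - ∫ x, φ x * powerFun σ (u x) := by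
    rw [← integral_sub (i0 _) (i0 φ)]
    congr 1 with x
    ring
  have n2 : ∫ x, φ x * (powerFun σ (u x) +
      derivLin σ (u x) * v x + derivConj σ (u x) * starRingEnd ℂ (v x) -
      ∫ q, remainder σ (u x) (u (x + step q) - u x) ∂levy d s) =
      (∫ x, φ x * powerFun σ (u x)) + (∫ x, φ x * derivLin σ (u x) * v x) +
        (∫ x, φ x * derivConj σ (u x) * starRingEnd ℂ (v x)) -
        ∫ x, φ x * ∫ q, remainder σ (u x) (u (x + step q) - u x) ∂levy d s := by
    rw [← integral_add' (i0 φ) (i1 φ), ← integral_add' ((i0 φ).add (i1 φ)) (i2 φ),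
      ← integral_sub' (((i0 φ).add (i1 φ)).add (i2 φ)) (i3 φ)]
    congr 1 with x
    simp only [Pi.add_apply, Pi.sub_apply]
    ring
  rw [n1] at hfinal
  rw [n2]
  linear_combination hfinal

/-! ### Reduction to bounds for the remainder -/

theorem enorm_powerFun {σ : ℝ} (hσ : 0 < σ) (w : ℂ) : ‖powerFun σ w‖ₑ = ‖w‖ₑ ^ (2 * σ + 1) := by
  rw [← ofReal_norm, norm_powerFun hσ, ← ENNReal.ofReal_rpow_of_nonneg (norm_nonneg _) (by positivity),
    ofReal_norm]

theorem enorm_derivLin {σ : ℝ} (hσ : 0 < σ) (w : ℂ) :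
    ‖derivLin σ w‖ₑ = ENNReal.ofReal (1 + σ) * ‖w‖ₑ ^ (2 * σ) := by
  rw [← ofReal_norm, norm_derivLin hσ, ENNReal.ofReal_mul (by positivity),
    ← ENNReal.ofReal_rpow_of_nonneg (norm_nonneg _) (by positivity), ofReal_norm]

theorem enorm_derivConj {σ : ℝ} (hσ : 0 < σ) (w : ℂ) :
    ‖derivConj σ w‖ₑ = ENNReal.ofReal σ * ‖w‖ₑ ^ (2 * σ) := by
  rw [← ofReal_norm, norm_derivConj hσ, ENNReal.ofReal_mul (by positivity),
    ← ENNReal.ofReal_rpow_of_nonneg (norm_nonneg _) (by positivity), ofReal_norm]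

theorem exists_enorm_remainder_le {σ α : ℝ} (hσ : 0 < σ) (hα : 0 < α) (hα1 : α ≤ 1)
    (hασ : α ≤ 2 * σ) : ∃ C : ℝ≥0, ∀ w h : ℂ,
      ‖remainder σ w h‖ₑ ≤ C * ((‖w‖ₑ + ‖w + h‖ₑ) ^ (2 * σ - α) * ‖h‖ₑ ^ (1 + α)) := by
  obtain ⟨C, hC⟩ := exists_norm_remainder_le hσ hα hα1 hασ
  refine ⟨C, fun w h ↦ ?_⟩
  rw [← ofReal_norm, ← ofReal_norm, ← ofReal_norm, ← ofReal_norm,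
    ← ENNReal.ofReal_add (norm_nonneg _) (norm_nonneg _),
    ENNReal.ofReal_rpow_of_nonneg (by positivity) (by linarith),
    ENNReal.ofReal_rpow_of_nonneg (norm_nonneg _) (by linarith),
    ← ENNReal.ofReal_mul (by positivity), ← ENNReal.ofReal_coe_nnreal,
    ← ENNReal.ofReal_mul (by positivity)]
  exact ENNReal.ofReal_le_ofReal (hC w h)

theorem measurable_powerFun (σ : ℝ) : Measurable (powerFun σ) := by
  unfold powerFun; fun_prop

theorem measurable_derivLin (σ : ℝ) : Measurable (derivLin σ) := by
  unfold derivLin; fun_prop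

theorem measurable_derivConj (σ : ℝ) : Measurable (derivConj σ) := by
  unfold derivConj; fun_prop

theorem measurable_remainder {α : Type*} [MeasurableSpace α] (σ : ℝ) {f g : α → ℂ}
    (hf : Measurable f) (hg : Measurable g) : Measurable fun a ↦ remainder σ (f a) (g a) := by
  have h1 := (measurable_powerFun σ).comp (hf.add hg)
  have h2 := (measurable_powerFun σ).comp hf
  have h3 := (measurable_derivLin σ).comp hf
  have h4 := (measurable_derivConj σ).comp hf
  have h5 : Measurable fun a ↦ starRingEnd ℂ (g a) := Complex.continuous_conj.measurable.comp hg
  exact (h1.sub h2).sub ((h3.mul hg).add (h4.mul h5))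

/-- The pointwise majorant of the remainder in the chain rule. -/
noncomputable def remainderBound (s σ α : ℝ) (u : L2 d) (x : Eu d) : ℝ≥0∞ :=
  ∫⁻ q, (‖u x‖ₑ + ‖u (x + step q)‖ₑ) ^ (2 * σ - α) * ‖u (x + step q) - u x‖ₑ ^ (1 + α) ∂levy d s

theorem L2.measurable (u : L2 d) : Measurable u := (Lp.stronglyMeasurable u).measurable

theorem measurable_add_step : Measurable fun r : Eu d × (Eu d × ℝ) ↦ r.1 + step r.2 :=
  measurable_fst.add (measurable_step.comp measurable_snd)

theorem measurable_remainder_step {α : Type*} [MeasurableSpace α] (σ : ℝ) (u : L2 d) {f : α → Eu d}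
    {g : α → Eu d × ℝ} (hf : Measurable f) (hg : Measurable g) :
    Measurable fun a ↦ remainder σ (u (f a)) (u (f a + step (g a)) - u (f a)) :=
  measurable_remainder σ (u.measurable.comp hf)
    ((u.measurable.comp (hf.add (measurable_step.comp hg))).sub (u.measurable.comp hf))

theorem measurable_remainderBound (s σ α : ℝ) (u : L2 d) :
    Measurable (remainderBound s σ α u) := by
  have h1 : Measurable fun r : Eu d × (Eu d × ℝ) ↦ u r.1 := u.measurable.comp measurable_fst
  have h2 : Measurable fun r : Eu d × (Eu d × ℝ) ↦ u (r.1 + step r.2) :=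
    u.measurable.comp measurable_add_step
  exact Measurable.lintegral_prod_right' (f := fun r : Eu d × (Eu d × ℝ) ↦
    (‖u r.1‖ₑ + ‖u (r.1 + step r.2)‖ₑ) ^ (2 * σ - α) * ‖u (r.1 + step r.2) - u r.1‖ₑ ^ (1 + α))
    (((h1.enorm.add h2.enorm).pow_const _).mul ((h2.sub h1).enorm.pow_const _))

theorem memLp_of_lnorm_ne_top {p : ℝ} (hp : 0 < p) {f : Eu d → ℂ}
    (hf : AEStronglyMeasurable f volume) (h : lnorm p (fun x ↦ ‖f x‖ₑ) volume ≠ ∞) :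
    MemLp f (ENNReal.ofReal p) volume :=
  ⟨hf, by rw [eLpNorm_ofReal_eq_lnorm hp]; exact h.lt_top⟩

theorem lintegral_schwartz_mul_ne_top {p : ℝ} (hp : 1 ≤ p) {T : Eu d → ℝ≥0∞} (hT : Measurable T)
    (h : lnorm p T volume ≠ ∞) (φ : 𝓢(Eu d, ℂ)) : ∫⁻ x, ‖φ x‖ₑ * T x ≠ ∞ := by
  have hp0 : 0 < p := by linarith
  have hfin : ∀ᵐ x, T x < ∞ := by
    have h1 : ∫⁻ x, T x ^ p ≠ ∞ := fun h2 ↦ h (by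
      rw [lnorm, h2, ENNReal.top_rpow_of_pos (by positivity)])
    filter_upwards [ae_lt_top (hT.pow_const p) h1] with x hx
    exact (ENNReal.rpow_lt_top_iff_of_pos hp0).1 hx
  have hen : (fun x ↦ ‖((T x).toReal : ℂ)‖ₑ) =ᵐ[volume] T := hfin.mono fun x hx ↦ by
    simp only
    rw [← ofReal_norm, Complex.norm_real, Real.norm_of_nonneg ENNReal.toReal_nonneg,
      ENNReal.ofReal_toReal hx.ne]
  have hm : MemLp (fun x ↦ ((T x).toReal : ℂ)) (ENNReal.ofReal p) volume := by
    refine memLp_of_lnorm_ne_top hp0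
      (Complex.measurable_ofReal.comp hT.ennreal_toReal).aestronglyMeasurable ?_
    rwa [lnorm_congr_ae hen]
  have hi := (integrable_schwartz_mul (by simpa using hp) hm φ).2
  rw [HasFiniteIntegral] at hi
  refine ne_top_of_le_ne_top hi.ne (le_of_eq (lintegral_congr_ae ?_))
  filter_upwards [hen] with x hx
  rw [enorm_mul, hx]

/-- The function `v = ((1 - Δ) ^ (s / 2) - 1) u` has `s` derivatives less than `u`. -/
theorem energy_le_of_fourier_eq {s : ℝ} (hs : 0 ≤ s) {u v : L2 d}
    (hv : (𝓕 v : L2 d) =ᵐ[volume] fun ξ ↦ ((symbol d s ξ - 1 : ℝ) : ℂ) * (𝓕 u : L2 d) ξ) :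
    energy (1 - s) v ≤ energy 1 u := by
  refine lintegral_mono_ae (hv.mono fun ξ hξ ↦ ?_)
  have h1 := one_le_symbol (d := d) hs ξ
  have h2 := symbol_pos (d := d) (2 * (1 - s)) ξ
  rw [hξ, enorm_mul, ENNReal.mul_rpow_of_nonneg _ _ two_pos.le, ← ofReal_norm (_ : ℂ),
    Complex.norm_real, Real.norm_of_nonneg (by linarith),
    ENNReal.ofReal_rpow_of_nonneg (by linarith) two_pos.le, ← mul_assoc,
    ← ENNReal.ofReal_mul h2.le]
  gcongr
  rw [show (2 * 1 : ℝ) = 2 * (1 - s) + (s + s) by ring, ← symbol_mul, ← symbol_mul, Real.rpow_two]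
  gcongr
  nlinarith

/-- The coefficients of the differential are in `L^k` for some `k ≥ 2`. Localized by a Schwartz
function they are square-integrable, and can be paired with the weak limit in
`tendsto_integral_mul_sub_translate`. -/
theorem memLp_two_schwartz_mul {k : ℝ} (hk : 2 ≤ k) {a : Eu d → ℂ}
    (ha : MemLp a (ENNReal.ofReal k) volume) (φ : 𝓢(Eu d, ℂ)) :
    MemLp (fun x ↦ φ x * a x) 2 volume := by
  have h : (ENNReal.ofReal k)⁻¹ ≤ 2⁻¹ := by
    rw [ENNReal.inv_le_inv, ← ENNReal.ofReal_ofNat]; exact ENNReal.ofReal_le_ofReal hk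
  have : ENNReal.HolderTriple (2⁻¹ - (ENNReal.ofReal k)⁻¹)⁻¹ (ENNReal.ofReal k) 2 := ⟨by
    rw [inv_inv, tsub_add_cancel_of_le h]⟩
  exact ha.mul (φ.memLp (2⁻¹ - (ENNReal.ofReal k)⁻¹)⁻¹ volume)

/-- The bound for `|u| ^ (2 σ) u` in `H^{s,p}` follows from Sobolev embeddings and a bound for
`remainderBound`. -/
theorem exists_eLpNorm_bessel_powerFun_le {s σ p α k c : ℝ} (hs0 : 0 < s) (hs1 : s ≤ 1) (hσ : 0 < σ)
    (hα : 0 < α) (hα1 : α ≤ 1) (hασ : α ≤ 2 * σ) (hp1 : 1 ≤ p) (hp2 : p ≤ 2) (hk : 2 ≤ k)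
    (hc : 0 < c) (hkc : 1 / k + 1 / c = 1 / p)
    (h1 : ∃ C : ℝ≥0, ∀ u : L2 d,
      lnorm (p * (2 * σ + 1)) (fun x ↦ ‖u x‖ₑ) volume ≤ C * energy 1 u ^ (1 / 2 : ℝ))
    (h2 : ∃ C : ℝ≥0, ∀ u : L2 d,
      lnorm (k * (2 * σ)) (fun x ↦ ‖u x‖ₑ) volume ≤ C * energy 1 u ^ (1 / 2 : ℝ))
    (h3 : ∃ C : ℝ≥0, ∀ v : L2 d,
      lnorm c (fun x ↦ ‖v x‖ₑ) volume ≤ C * energy (1 - s) v ^ (1 / 2 : ℝ))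
    (h4 : ∃ C : ℝ≥0, ∀ u : L2 d, energy 1 u ≠ ∞ →
      lnorm p (remainderBound s σ α u) volume ≤ C * energy 1 u ^ ((2 * σ + 1) / 2)) :
    ∃ C : ℝ≥0, ∀ u : L2 d, energy 1 u ≠ ∞ →
      MemLp (fun x ↦ powerFun σ (u x)) (ENNReal.ofReal p) volume ∧
      ∃ g : Eu d → ℂ, IsBesselPow s (fun x ↦ powerFun σ (u x)) g ∧ AEStronglyMeasurable g volume ∧
        eLpNorm g (ENNReal.ofReal p) volume ≤ C * energy 1 u ^ ((2 * σ + 1) / 2) := by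
  obtain ⟨C₁, h1⟩ := h1
  obtain ⟨C₂, h2⟩ := h2
  obtain ⟨C₃, h3⟩ := h3
  obtain ⟨C₄, h4⟩ := h4
  obtain ⟨C₀, hrem⟩ := exists_enorm_remainder_le hσ hα hα1 hασ
  have hp0 : 0 < p := by linarith
  refine ⟨C₁ ^ (2 * σ + 1) + ((1 + σ).toNNReal + σ.toNNReal) * (C₂ ^ (2 * σ) * C₃) + C₀ * C₄,
    fun u hu ↦ ?_⟩
  have hE : ∀ {r : ℝ}, 0 ≤ r → energy 1 u ^ r ≠ ∞ := fun hr ↦ ENNReal.rpow_ne_top_of_nonneg hr hu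
  have hus : energy s u ≠ ∞ := ne_top_of_le_ne_top hu (energy_mono hs1 u)
  obtain ⟨v, hv⟩ := exists_fourier_eq_symbol_sub_one_mul hs0.le u hus
  have hum := u.measurable
  have hvm := v.measurable
  have b1 : lnorm p (fun x ↦ ‖u x‖ₑ ^ (2 * σ + 1)) volume ≤
      C₁ ^ (2 * σ + 1) * energy 1 u ^ ((2 * σ + 1) / 2) := by
    rw [lnorm_rpow hp0 (by positivity)]
    refine (ENNReal.rpow_le_rpow (h1 u) (by positivity)).trans_eq ?_
    rw [ENNReal.mul_rpow_of_nonneg _ _ (by positivity), ← ENNReal.rpow_mul]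
    ring_nf
  have b2 : lnorm p (fun x ↦ ‖u x‖ₑ ^ (2 * σ) * ‖v x‖ₑ) volume ≤
      C₂ ^ (2 * σ) * C₃ * energy 1 u ^ ((2 * σ + 1) / 2) := by
    have hh := lnorm_rpow_mul_rpow_le (μ := volume) (p := p) (a := k * (2 * σ)) (b := c) (i := 2 * σ)
      (j := 1) hp0 (by positivity) hc (by positivity) zero_le_one (by
        rw [← hkc]; field_simp) hum.enorm.aemeasurable hvm.enorm.aemeasurable
    simp only [ENNReal.rpow_one] at hh
    refine hh.trans ((mul_le_mul' (ENNReal.rpow_le_rpow (h2 u) (by positivity)) ((h3 v).trans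
      (mul_le_mul_right (ENNReal.rpow_le_rpow (energy_le_of_fourier_eq hs0.le hv)
        (by positivity)) _))).trans_eq ?_)
    rw [ENNReal.mul_rpow_of_nonneg _ _ (by positivity), ← ENNReal.rpow_mul,
      show (2 * σ + 1) / 2 = 1 / 2 * (2 * σ) + 1 / 2 by ring,
      ENNReal.rpow_add_of_nonneg _ _ (by positivity) (by positivity)]
    ring
  have b4 := h4 u hu
  have hT := measurable_remainderBound s σ α u
  have hTfin : lnorm p (remainderBound s σ α u) volume ≠ ∞ :=
    ne_top_of_le_ne_top (ENNReal.mul_ne_top ENNReal.coe_ne_top (hE (by positivity))) b4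
  have hF : MemLp (fun x ↦ powerFun σ (u x)) (ENNReal.ofReal p) volume := by
    refine memLp_of_lnorm_ne_top (f := fun x ↦ powerFun σ (u x)) hp0
      ((measurable_powerFun σ).comp hum).aestronglyMeasurable ?_
    simp_rw [enorm_powerFun hσ]
    exact ne_top_of_le_ne_top (ENNReal.mul_ne_top (ENNReal.rpow_ne_top_of_nonneg (by positivity)
      ENNReal.coe_ne_top) (hE (by positivity))) b1
  have hk0 : 0 < k := by linarith
  have hpow : lnorm k (fun x ↦ ‖u x‖ₑ ^ (2 * σ)) volume ≠ ∞ := by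
    rw [lnorm_rpow hk0 (by positivity)]
    exact ENNReal.rpow_ne_top_of_nonneg (by positivity) (ne_top_of_le_ne_top
      (ENNReal.mul_ne_top ENNReal.coe_ne_top (hE (by positivity))) (h2 u))
  have ha : ∀ φ : 𝓢(Eu d, ℂ), MemLp (fun x ↦ φ x * derivLin σ (u x)) 2 volume := fun φ ↦ by
    refine memLp_two_schwartz_mul hk (memLp_of_lnorm_ne_top (f := fun x ↦ derivLin σ (u x)) hk0
      ((measurable_derivLin σ).comp hum).aestronglyMeasurable ?_) φ
    simp_rw [enorm_derivLin hσ]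
    rw [lnorm_const_mul hk0 ENNReal.ofReal_ne_top]
    exact ENNReal.mul_ne_top ENNReal.ofReal_ne_top hpow
  have hb : ∀ φ : 𝓢(Eu d, ℂ), MemLp (fun x ↦ φ x * derivConj σ (u x)) 2 volume := fun φ ↦ by
    refine memLp_two_schwartz_mul hk (memLp_of_lnorm_ne_top (f := fun x ↦ derivConj σ (u x)) hk0
      ((measurable_derivConj σ).comp hum).aestronglyMeasurable ?_) φ
    simp_rw [enorm_derivConj hσ]
    rw [lnorm_const_mul hk0 ENNReal.ofReal_ne_top]
    exact ENNReal.mul_ne_top ENNReal.ofReal_ne_top hpow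
  have hremle : ∀ x, ∫⁻ q, ‖remainder σ (u x) (u (x + step q) - u x)‖ₑ ∂levy d s ≤
      C₀ * remainderBound s σ α u x := fun x ↦ by
    rw [remainderBound, ← lintegral_const_mul' _ _ ENNReal.coe_ne_top]
    refine lintegral_mono fun q ↦ (hrem _ _).trans_eq ?_
    rw [add_sub_cancel]
  have hmr : Measurable fun r : Eu d × (Eu d × ℝ) ↦
      remainder σ (u r.1) (u (r.1 + step r.2) - u r.1) :=
    measurable_remainder_step σ u measurable_fst measurable_snd
  have hR : ∀ φ : 𝓢(Eu d, ℂ), Integrable (fun r : (Eu d × ℝ) × Eu d ↦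
      φ r.2 * remainder σ (u r.2) (u (r.2 + step r.1) - u r.2)) ((levy d s).prod volume) := fun φ ↦ by
    have hm : Measurable fun r : (Eu d × ℝ) × Eu d ↦
        φ r.2 * remainder σ (u r.2) (u (r.2 + step r.1) - u r.2) :=
      (φ.continuous.measurable.comp measurable_snd).mul
        (measurable_remainder_step σ u measurable_snd measurable_fst)
    refine ⟨hm.aestronglyMeasurable, ?_⟩
    rw [HasFiniteIntegral, lintegral_prod_symm _ hm.enorm.aemeasurable]
    refine lt_of_le_of_lt (b := ∫⁻ x, C₀ * (‖φ x‖ₑ * remainderBound s σ α u x))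
      (lintegral_mono fun x ↦ ?_) ?_
    · simp only [enorm_mul]
      rw [lintegral_const_mul' _ _ enorm_ne_top]
      refine (mul_le_mul_right (hremle x) _).trans_eq ?_
      ring
    · rw [lintegral_const_mul' _ _ ENNReal.coe_ne_top]
      exact (ENNReal.mul_ne_top ENNReal.coe_ne_top
        (lintegral_schwartz_mul_ne_top hp1 hT hTfin φ)).lt_top
  refine ⟨hF, _, isBesselPow_powerFun hs0 (by linarith) hp1 hp2 hv hF ha hb hR, ?_, ?_⟩
  · have m1 : Measurable fun x ↦ powerFun σ (u x) + derivLin σ (u x) * v x +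
        derivConj σ (u x) * starRingEnd ℂ (v x) :=
      (((measurable_powerFun σ).comp hum).add (((measurable_derivLin σ).comp hum).mul hvm)).add
        (((measurable_derivConj σ).comp hum).mul (Complex.continuous_conj.measurable.comp hvm))
    exact m1.aestronglyMeasurable.sub
      (hmr.stronglyMeasurable.integral_prod_right' (ν := levy d s)).aestronglyMeasurable
  · rw [eLpNorm_ofReal_eq_lnorm hp0]
    have hpt : ∀ x, ‖powerFun σ (u x) + derivLin σ (u x) * v x +
        derivConj σ (u x) * starRingEnd ℂ (v x) -
        ∫ q, remainder σ (u x) (u (x + step q) - u x) ∂levy d s‖ₑ ≤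
        ‖u x‖ₑ ^ (2 * σ + 1) + ((ENNReal.ofReal (1 + σ) + ENNReal.ofReal σ) *
          (‖u x‖ₑ ^ (2 * σ) * ‖v x‖ₑ)) + C₀ * remainderBound s σ α u x := fun x ↦ by
      refine (enorm_sub_le).trans (add_le_add ?_
        ((enorm_integral_le_lintegral_enorm _).trans (hremle x)))
      refine (enorm_add_le _ _).trans ((add_le_add_left (enorm_add_le _ _) _).trans ?_)
      rw [enorm_powerFun hσ, enorm_mul, enorm_mul, enorm_derivLin hσ, enorm_derivConj hσ,
        RCLike.enorm_conj, add_assoc]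
      refine add_le_add_right (le_of_eq ?_) _
      ring
    have n1 : Measurable fun x ↦ ‖u x‖ₑ ^ (2 * σ + 1) := hum.enorm.pow_const _
    have n2 : Measurable fun x ↦ (ENNReal.ofReal (1 + σ) + ENNReal.ofReal σ) *
          (‖u x‖ₑ ^ (2 * σ) * ‖v x‖ₑ) := ((hum.enorm.pow_const _).mul hvm.enorm).const_mul _
    refine (lnorm_mono hp0 hpt).trans ?_
    refine (lnorm_add_le hp1 (n1.add n2).aemeasurable (hT.const_mul _).aemeasurable).trans ?_
    refine (add_le_add_left (lnorm_add_le hp1 n1.aemeasurable n2.aemeasurable) _).trans ?_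
    rw [lnorm_const_mul hp0 (by simp), lnorm_const_mul hp0 ENNReal.coe_ne_top]
    refine (add_le_add (add_le_add b1 (mul_le_mul_right b2 _)) (mul_le_mul_right b4 _)).trans_eq ?_
    push_cast
    rw [ENNReal.coe_rpow_of_nonneg _ (by positivity), ENNReal.coe_rpow_of_nonneg _ (by positivity),
      ENNReal.ofReal, ENNReal.ofReal]
    ring

/-! ### Differences of Sobolev functions against the Lévy measure -/

theorem enorm_diff_eq (u : L2 d) (z : Eu d) :
    (fun x ↦ ‖diff z u x‖ₑ) =ᵐ[volume] fun x ↦ ‖u (x + z) - u x‖ₑ :=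
  (coeFn_diff z u).mono fun x hx ↦ by simp only [hx]

theorem energy_diff (τ : ℝ) (z : Eu d) (u : L2 d) : energy τ (diff z u) =
    ∫⁻ ξ, ENNReal.ofReal (symbol d (2 * τ) ξ) *
      (‖phase z ξ - 1‖ₑ ^ (2 : ℝ) * ‖(𝓕 u : L2 d) ξ‖ₑ ^ (2 : ℝ)) :=
  lintegral_congr_ae ((fourier_diff z u).mono fun ξ hξ ↦ by
    simp only [hξ, enorm_mul, ENNReal.mul_rpow_of_nonneg _ _ two_pos.le])

/-- The Lévy measure of order `s` costs `s / 2` derivatives of `u` in the mean square. -/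
theorem lintegral_energy_diff_le {s τ : ℝ} (hs0 : 0 < s) (hs2 : s < 2) (hτ : 2 * τ + s ≤ 2)
    (u : L2 d) : ∫⁻ q, energy τ (diff (step q) u) ∂levy d s ≤ 2 * energy 1 u := by
  have hu : Measurable (𝓕 u : L2 d) := L2.measurable _
  have hm : Measurable fun r : (Eu d × ℝ) × Eu d ↦ ENNReal.ofReal (symbol d (2 * τ) r.2) *
      (‖phase (step r.1) r.2 - 1‖ₑ ^ (2 : ℝ) * ‖(𝓕 u : L2 d) r.2‖ₑ ^ (2 : ℝ)) := by
    refine ((continuous_symbol _).measurable.comp measurable_snd).ennreal_ofReal.mul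
      (Measurable.mul ?_ ((hu.comp measurable_snd).enorm.pow_const _))
    exact ((measurable_phase (measurable_step.comp measurable_fst)
      measurable_snd).sub_const 1).enorm.pow_const _
  simp_rw [energy_diff]
  rw [lintegral_lintegral_swap hm.aemeasurable, energy, ← lintegral_const_mul' _ _ (by simp)]
  refine lintegral_mono fun ξ ↦ ?_
  have hmq : Measurable fun q : Eu d × ℝ ↦ ‖phase (step q) ξ - 1‖ₑ ^ (2 : ℝ) :=
    ((measurable_phase_step ξ).sub_const 1).enorm.pow_const _
  simp only
  rw [lintegral_const_mul' _ _ ENNReal.ofReal_ne_top, lintegral_mul_const _ hmq]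
  calc _ ≤ ENNReal.ofReal (symbol d (2 * τ) ξ) * ((2 * ENNReal.ofReal (symbol d s ξ)) *
        ‖(𝓕 u : L2 d) ξ‖ₑ ^ (2 : ℝ)) := by
        gcongr
        exact lintegral_phase_sub_one_sq_levy hs0 hs2 ξ
    _ = 2 * (ENNReal.ofReal (symbol d (2 * τ + s) ξ) * ‖(𝓕 u : L2 d) ξ‖ₑ ^ (2 : ℝ)) := by
        rw [← symbol_mul, ENNReal.ofReal_mul (symbol_pos _ _).le]; ring
    _ ≤ _ := by
        gcongr
        exact symbol_mono (by linarith) ξ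

/-- A Gagliardo type bound: the Lévy measure of order `s` integrates the square of the `L^b` norm of
differences, if `L^b` contains the Sobolev space of order `1 - s / 2`. -/
theorem exists_lintegral_lnorm_diff_sq_le (hd : 0 < d) {s τ b : ℝ} (hs0 : 0 < s) (hs2 : s < 2)
    (hτ0 : 0 ≤ τ) (hτ : 2 * τ + s ≤ 2) (hb : 0 < b) (hbτ : 1 / b = 1 / 2 - τ / d) :
    ∃ C : ℝ≥0, ∀ u : L2 d,
      ∫⁻ q, lnorm b (fun x ↦ ‖u (x + step q) - u x‖ₑ) volume ^ (2 : ℝ) ∂levy d s ≤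
        C * energy 1 u := by
  obtain ⟨C, hC⟩ := exists_lnorm_le_energy hd hτ0 hb hbτ
  refine ⟨C ^ (2 : ℝ) * 2, fun u ↦ ?_⟩
  have h : ∀ q : Eu d × ℝ, lnorm b (fun x ↦ ‖u (x + step q) - u x‖ₑ) volume ^ (2 : ℝ) ≤
      (C : ℝ≥0∞) ^ (2 : ℝ) * energy τ (diff (step q) u) := fun q ↦ by
    rw [← lnorm_congr_ae (enorm_diff_eq u (step q))]
    refine (ENNReal.rpow_le_rpow (hC _) two_pos.le).trans_eq ?_
    rw [ENNReal.mul_rpow_of_nonneg _ _ two_pos.le, ← ENNReal.rpow_mul]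
    norm_num
  refine (lintegral_mono h).trans ?_
  rw [lintegral_const_mul' _ _ (by simp)]
  refine (mul_le_mul_right (lintegral_energy_diff_le hs0 hs2 hτ u) _).trans_eq ?_
  push_cast
  rw [ENNReal.coe_rpow_of_nonneg _ two_pos.le]
  ring

theorem measurable_enorm_sub_step (u : L2 d) : Measurable fun r : Eu d × (Eu d × ℝ) ↦
    ‖u (r.1 + step r.2) - u r.1‖ₑ :=
  ((u.measurable.comp measurable_add_step).sub (u.measurable.comp measurable_fst)).enorm

theorem measurable_lnorm_sub_step (b : ℝ) (u : L2 d) : Measurable fun q : Eu d × ℝ ↦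
    lnorm b (fun x ↦ ‖u (x + step q) - u x‖ₑ) volume := by
  have h := ((measurable_enorm_sub_step u).comp measurable_swap).pow_const b
  exact (Measurable.lintegral_prod_right' (f := fun r : (Eu d × ℝ) × Eu d ↦
    ‖u (r.2 + step r.1) - u r.2‖ₑ ^ b) h).pow_const _

theorem lnorm_add_translate_le {a : ℝ} (ha : 1 ≤ a) (u : L2 d) (z : Eu d) :
    lnorm a (fun x ↦ ‖u x‖ₑ + ‖u (x + z)‖ₑ) volume ≤ 2 * lnorm a (fun x ↦ ‖u x‖ₑ) volume := by
  have hu := u.measurable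
  refine (lnorm_add_le ha hu.enorm.aemeasurable
    (hu.comp (measurable_add_const z)).enorm.aemeasurable).trans_eq ?_
  rw [two_mul]
  congr 1
  exact congrArg (· ^ (1 / a)) (lintegral_add_right_eq_self (fun x ↦ ‖u x‖ₑ ^ a) z)

/-- Minkowski's and Hölder's inequalities reduce the bound for the remainder to a bound for
differences in `L^b`. -/
theorem lnorm_remainderBound_le {s σ α p a b : ℝ} (hα : 0 ≤ α) (hασ : α ≤ 2 * σ) (hp : 1 ≤ p)
    (ha : 1 ≤ a) (hb : 0 < b) (h : (2 * σ - α) / a + (1 + α) / b = 1 / p) (u : L2 d) :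
    lnorm p (remainderBound s σ α u) volume ≤
      (2 * lnorm a (fun x ↦ ‖u x‖ₑ) volume) ^ (2 * σ - α) *
        ∫⁻ q, lnorm b (fun x ↦ ‖u (x + step q) - u x‖ₑ) volume ^ (1 + α) ∂levy d s := by
  have hu := u.measurable
  have hz : ∀ z : Eu d, Measurable fun x ↦ u (x + z) := fun z ↦ hu.comp (measurable_add_const z)
  have hD := measurable_enorm_sub_step u
  have hW : Measurable fun r : Eu d × (Eu d × ℝ) ↦ ‖u r.1‖ₑ + ‖u (r.1 + step r.2)‖ₑ :=
    (hu.comp measurable_fst).enorm.add (hu.comp measurable_add_step).enorm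
  refine (lnorm_lintegral_le hp ((hW.pow_const (2 * σ - α)).mul (hD.pow_const (1 + α)))).trans ?_
  rw [← lintegral_const_mul _ ((measurable_lnorm_sub_step b u).pow_const _)]
  refine lintegral_mono fun q ↦ ?_
  refine (lnorm_rpow_mul_rpow_le (by linarith) (by linarith) hb (by linarith) (by linarith) h
    (hu.enorm.add (hz _).enorm).aemeasurable ((hz (step q)).sub hu).enorm.aemeasurable).trans ?_
  exact mul_le_mul_left (ENNReal.rpow_le_rpow (lnorm_add_translate_le ha u _) (by linarith)) _

/-- The remainder of second order. -/
theorem exists_lnorm_remainderBound_le_of_half_le (hd : 0 < d) {s σ p a b τ : ℝ} (hs0 : 0 < s)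
    (hs2 : s < 2) (hσ : 1 / 2 ≤ σ) (hp : 1 ≤ p) (ha : 1 ≤ a) (hb : 0 < b) (hτ0 : 0 ≤ τ)
    (hτ : 2 * τ + s ≤ 2) (hbτ : 1 / b = 1 / 2 - τ / d) (h : (2 * σ - 1) / a + 2 / b = 1 / p)
    (hSob : ∃ C : ℝ≥0, ∀ u : L2 d,
      lnorm a (fun x ↦ ‖u x‖ₑ) volume ≤ C * energy 1 u ^ (1 / 2 : ℝ)) :
    ∃ C : ℝ≥0, ∀ u : L2 d, energy 1 u ≠ ∞ →
      lnorm p (remainderBound s σ 1 u) volume ≤ C * energy 1 u ^ ((2 * σ + 1) / 2) := by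
  obtain ⟨C₁, h1⟩ := hSob
  obtain ⟨C₂, h2⟩ := exists_lintegral_lnorm_diff_sq_le hd hs0 hs2 hτ0 hτ hb hbτ
  refine ⟨(2 * C₁) ^ (2 * σ - 1) * C₂, fun u _ ↦ ?_⟩
  have h3 := lnorm_remainderBound_le (s := s) (σ := σ) (α := 1) zero_le_one (by linarith) hp ha hb
    (by rw [one_add_one_eq_two]; exact h) u
  rw [one_add_one_eq_two] at h3
  refine h3.trans ((mul_le_mul' (ENNReal.rpow_le_rpow (mul_le_mul_right (h1 u) 2)
    (by linarith)) (h2 u)).trans_eq ?_)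
  have e1 : energy 1 u ^ ((2 * σ + 1) / 2) = (energy 1 u ^ (1 / 2 : ℝ)) ^ (2 * σ - 1) * energy 1 u := by
    rw [← ENNReal.rpow_mul, show (2 * σ + 1) / 2 = 1 / 2 * (2 * σ - 1) + 1 by ring,
      ENNReal.rpow_add_of_nonneg _ _ (by linarith) zero_le_one, ENNReal.rpow_one]
  rw [e1, ← mul_assoc, ← mul_assoc, ENNReal.mul_rpow_of_nonneg _ _ (by linarith), ENNReal.coe_mul,
    ENNReal.coe_rpow_of_nonneg _ (by linarith), ENNReal.coe_mul, ENNReal.coe_ofNat]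
  ring

/-! ### The Lévy measure near zero and near infinity -/

theorem lintegral_levy_snd (s : ℝ) {f : ℝ → ℝ≥0∞} (hf : Measurable f) :
    ∫⁻ q, f q.2 ∂levy d s = ∫⁻ t, f t ∂subordinator s :=
  measurePreserving_snd.lintegral_comp hf

theorem ae_pos_levy (s : ℝ) : ∀ᵐ q ∂levy d s, 0 < q.2 :=
  Measure.quasiMeasurePreserving_snd.ae (ae_pos_subordinator s)

/-- Lévy measures of different orders differ by a power of the time variable. -/
theorem lintegral_rpow_mul_subordinator {s s' : ℝ} (hs0 : 0 < s) (hs2 : s < 2) (hs0' : 0 < s')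
    (hs2' : s' < 2) {f : ℝ → ℝ≥0∞} (hf : Measurable f) :
    ∫⁻ t, ENNReal.ofReal t ^ ((s - s') / 2) * f t ∂subordinator s =
      ENNReal.ofReal (subConst s' / subConst s) * ∫⁻ t, f t ∂subordinator s' := by
  have h1 := subConst_pos hs0 hs2
  have h2 := subConst_pos hs0' hs2'
  have hm : Measurable fun t ↦ ENNReal.ofReal t ^ ((s - s') / 2) * f t :=
    (ENNReal.measurable_ofReal.pow_const _).mul hf
  rw [lintegral_subordinator _ hm,
    lintegral_subordinator _ hf, ← lintegral_const_mul' _ _ ENNReal.ofReal_ne_top]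
  refine setLIntegral_congr_fun measurableSet_Ioi fun t ht ↦ ?_
  have ht' : (0 : ℝ) < t := ht
  rw [ENNReal.ofReal_rpow_of_pos ht', ← mul_assoc, ← mul_assoc,
    ← ENNReal.ofReal_mul (by positivity), ← ENNReal.ofReal_mul (by positivity)]
  congr 2
  rw [show -1 - s' / 2 = (-1 - s / 2) + (s - s') / 2 by ring, Real.rpow_add ht']
  field_simp

theorem lintegral_rpow_mul_levy {s s' : ℝ} (hs0 : 0 < s) (hs2 : s < 2) (hs0' : 0 < s')
    (hs2' : s' < 2) {f : Eu d × ℝ → ℝ≥0∞} (hf : Measurable f) :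
    ∫⁻ q, ENNReal.ofReal q.2 ^ ((s - s') / 2) * f q ∂levy d s =
      ENNReal.ofReal (subConst s' / subConst s) * ∫⁻ q, f q ∂levy d s' := by
  have hw : Measurable fun q : Eu d × ℝ ↦ ENNReal.ofReal q.2 ^ ((s - s') / 2) * f q :=
    (measurable_snd.ennreal_ofReal.pow_const _).mul hf
  rw [levy, levy, lintegral_prod _ hw.aemeasurable, lintegral_prod _ hf.aemeasurable,
    ← lintegral_const_mul' _ _ ENNReal.ofReal_ne_top]
  refine lintegral_congr fun y ↦ ?_
  exact lintegral_rpow_mul_subordinator hs0 hs2 hs0' hs2' (hf.comp measurable_prodMk_left)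

theorem lintegral_rpow_subordinator_ne_top {s β : ℝ} (hs0 : 0 < s) (hs2 : s < 2) (hβ : s / 2 < β) :
    ∫⁻ t, ENNReal.ofReal t ^ β ∂subordinator s ≠ ∞ := by
  have hc := subConst_pos hs0 hs2
  have hG := (Real.GammaIntegral_convergent (s := β - s / 2) (by linarith)).div_const (subConst s)
  rw [lintegral_subordinator _ (ENNReal.measurable_ofReal.pow_const _)]
  refine ne_top_of_le_ne_top hG.lintegral_lt_top.ne (le_of_eq ?_)
  refine setLIntegral_congr_fun measurableSet_Ioi fun t ht ↦ ?_
  have ht' : (0 : ℝ) < t := ht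
  rw [ENNReal.ofReal_rpow_of_pos ht', ← ENNReal.ofReal_mul (by positivity),
    show β - s / 2 - 1 = (-1 - s / 2) + β by ring, Real.rpow_add ht']
  congr 1
  ring

theorem exists_lintegral_rpow_subordinator_Iio_le {s β : ℝ} (hs0 : 0 < s) (hs2 : s < 2)
    (hβ : s / 2 < β) : ∃ C : ℝ≥0, ∀ r : ℝ, 0 < r →
      ∫⁻ t in Set.Iio r, ENNReal.ofReal t ^ β ∂subordinator s ≤
        C * ENNReal.ofReal r ^ (β - s / 2) := by
  have hc := subConst_pos hs0 hs2
  refine ⟨(1 / (subConst s * (β - s / 2))).toNNReal, fun r hr ↦ ?_⟩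
  have hm : Measurable fun t : ℝ ↦ (Set.Iio r).indicator (fun t ↦ ENNReal.ofReal t ^ β) t :=
    (ENNReal.measurable_ofReal.pow_const _).indicator measurableSet_Iio
  have hi : IntegrableOn (fun t : ℝ ↦ t ^ (β - s / 2 - 1)) (Set.Ioc 0 r) :=
    (intervalIntegrable_iff_integrableOn_Ioc_of_le hr.le).1
      (intervalIntegral.intervalIntegrable_rpow' (by linarith))
  have hv : ∫ t in Set.Ioc 0 r, t ^ (β - s / 2 - 1) / subConst s =
      1 / (subConst s * (β - s / 2)) * r ^ (β - s / 2) := by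
    rw [← intervalIntegral.integral_of_le hr.le, intervalIntegral.integral_div,
      integral_rpow (Or.inl (by linarith)), sub_add_cancel, Real.zero_rpow (by linarith)]
    have : β - s / 2 ≠ 0 := by linarith
    field_simp
    ring
  rw [← lintegral_indicator measurableSet_Iio, lintegral_subordinator _ hm,
    ENNReal.ofReal_rpow_of_pos hr, ← ENNReal.ofReal.eq_1,
    ← ENNReal.ofReal_mul (div_nonneg zero_le_one (mul_nonneg hc.le (by linarith))), ← hv,
    ofReal_integral_eq_lintegral_ofReal (hi.div_const _)
      ((ae_restrict_iff' measurableSet_Ioc).2 (ae_of_all _ fun t ht ↦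
        div_nonneg (Real.rpow_nonneg ht.1.le _) hc.le)),
    ← lintegral_indicator measurableSet_Ioi, ← lintegral_indicator measurableSet_Ioc]
  refine lintegral_mono fun t ↦ ?_
  by_cases ht0 : 0 < t
  · by_cases htr : t < r
    · have ht : t ∈ Set.Ioc 0 r := ⟨ht0, htr.le⟩
      rw [Set.indicator_of_mem (show t ∈ Set.Ioi (0 : ℝ) from ht0), Set.indicator_of_mem ht,
        Set.indicator_of_mem (show t ∈ Set.Iio r from htr), ENNReal.ofReal_rpow_of_pos ht0,
        ← ENNReal.ofReal_mul (by positivity)]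
      refine ENNReal.ofReal_le_ofReal ?_
      rw [show β - s / 2 - 1 = (-1 - s / 2) + β by ring, Real.rpow_add ht0, div_mul_eq_mul_div,
        mul_assoc]
      refine div_le_div_of_nonneg_right ?_ hc.le
      exact mul_le_of_le_one_left (by positivity) (Real.exp_le_one_iff.2 (by linarith))
    · rw [Set.indicator_of_mem (show t ∈ Set.Ioi (0 : ℝ) from ht0),
        Set.indicator_of_notMem (show t ∉ Set.Iio r from htr), mul_zero]
      exact zero_le
  · rw [Set.indicator_of_notMem (show t ∉ Set.Ioi (0 : ℝ) from ht0)]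
    exact zero_le

theorem exists_subordinator_Ici_le {s : ℝ} (hs0 : 0 < s) (hs2 : s < 2) : ∃ C : ℝ≥0, ∀ r : ℝ, 0 < r →
    subordinator s (Set.Ici r) ≤ C * ENNReal.ofReal r ^ (-(s / 2)) := by
  have hc := subConst_pos hs0 hs2
  refine ⟨(1 / (subConst s * (s / 2))).toNNReal, fun r hr ↦ ?_⟩
  have hm : Measurable fun t : ℝ ↦ (Set.Ici r).indicator (1 : ℝ → ℝ≥0∞) t :=
    measurable_one.indicator measurableSet_Ici
  have hi : IntegrableOn (fun t : ℝ ↦ t ^ (-1 - s / 2)) (Set.Ioi r) :=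
    integrableOn_Ioi_rpow_of_lt (by linarith) hr
  have hv : ∫ t in Set.Ioi r, t ^ (-1 - s / 2) / subConst s =
      1 / (subConst s * (s / 2)) * r ^ (-(s / 2)) := by
    rw [integral_div, integral_Ioi_rpow_of_lt (by linarith) hr,
      show -1 - s / 2 + 1 = -(s / 2) by ring]
    field_simp
  rw [← lintegral_indicator_one measurableSet_Ici, lintegral_subordinator _ hm,
    ENNReal.ofReal_rpow_of_pos hr, ← ENNReal.ofReal.eq_1,
    ← ENNReal.ofReal_mul (by positivity), ← hv,
    ofReal_integral_eq_lintegral_ofReal (hi.div_const _)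
      ((ae_restrict_iff' measurableSet_Ioi).2 (ae_of_all _ fun t ht ↦
        div_nonneg (Real.rpow_nonneg (hr.le.trans (le_of_lt ht)) _) hc.le)),
    ← setLIntegral_congr (Ioi_ae_eq_Ici (a := r)).symm,
    ← lintegral_indicator measurableSet_Ioi, ← lintegral_indicator measurableSet_Ici]
  refine lintegral_mono fun t ↦ ?_
  by_cases htr : r ≤ t
  · have ht0 : 0 < t := hr.trans_le htr
    rw [Set.indicator_of_mem (show t ∈ Set.Ioi (0 : ℝ) from ht0),
      Set.indicator_of_mem (show t ∈ Set.Ici r from htr),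
      Set.indicator_of_mem (show t ∈ Set.Ici r from htr), Pi.one_apply, mul_one]
    refine ENNReal.ofReal_le_ofReal ?_
    refine div_le_div_of_nonneg_right ?_ hc.le
    exact mul_le_of_le_one_left (Real.rpow_nonneg ht0.le _) (Real.exp_le_one_iff.2 (by linarith))
  · rw [Set.indicator_apply]
    split_ifs
    · rw [Set.indicator_of_notMem (show t ∉ Set.Ici r from htr), mul_zero]
      exact zero_le
    · exact zero_le

/-! ### Remainders of order less than two -/

/-- Hölder's inequality, with the weight `w ^ (-β)` for the square of `D`. The condition on the
exponents makes the weights cancel. -/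
theorem lintegral_rpow_le_weighted {Q : Type*} [MeasurableSpace Q] {μ : Measure Q} {α β β' : ℝ}
    (hα : 0 ≤ α) (hα1 : α ≤ 1) (h : β * (1 + α) = β' * (1 - α)) {D w : Q → ℝ≥0∞}
    (hD : Measurable D) (hw : Measurable w) (hw0 : ∀ᵐ q ∂μ, w q ≠ 0) (hwt : ∀ᵐ q ∂μ, w q ≠ ∞) :
    ∫⁻ q, D q ^ (1 + α) ∂μ ≤ (∫⁻ q, w q ^ (-β) * D q ^ (2 : ℝ) ∂μ) ^ ((1 + α) / 2) *
      (∫⁻ q, w q ^ β' ∂μ) ^ ((1 - α) / 2) := by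
  have h1 := ENNReal.lintegral_mul_norm_pow_le (μ := μ)
    ((hw.pow_const (-β)).mul (hD.pow_const (2 : ℝ))).aemeasurable (hw.pow_const β').aemeasurable
    (p := (1 + α) / 2) (q := (1 - α) / 2) (by linarith) (by linarith) (by ring)
  refine le_trans (le_of_eq (lintegral_congr_ae ?_)) h1
  filter_upwards [hw0, hwt] with q h0 ht
  simp only [Pi.mul_apply]
  rw [ENNReal.mul_rpow_of_nonneg _ _ (by linarith), ← ENNReal.rpow_mul, ← ENNReal.rpow_mul,
    ← ENNReal.rpow_mul, mul_right_comm, ← ENNReal.rpow_add _ _ h0 ht,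
    show -β * ((1 + α) / 2) + β' * ((1 - α) / 2) = 0 by linarith, ENNReal.rpow_zero, one_mul]
  congr 1
  ring

/-- The power `1 + α` of the differences in `L²`, for the Lévy measure of order `1`. By Hölder's
inequality it is bounded by the squares for the larger order `1 + 1 / (1 + α)` and the integral of
`t ^ β` with `β = 1 / (2 * (1 - α))`, which converges for the order `1` since `1 / 2 < β`. -/
theorem exists_lintegral_lnorm_rpow_le (hd : 0 < d) {α : ℝ} (hα : 0 < α) (hα1 : α < 1) :
    ∃ C : ℝ≥0, ∀ u : L2 d,
      ∫⁻ q, lnorm 2 (fun x ↦ ‖u (x + step q) - u x‖ₑ) volume ^ (1 + α) ∂levy d 1 ≤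
        C * energy 1 u ^ ((1 + α) / 2) := by
  have hs1 : 1 + 1 / (1 + α) < 2 := by
    have : 1 / (1 + α) < 1 := by rw [div_lt_one (by linarith)]; linarith
    linarith
  have hs0 : 0 < 1 + 1 / (1 + α) := by positivity
  obtain ⟨C, hC⟩ := exists_lintegral_lnorm_diff_sq_le hd hs0 hs1 le_rfl (by linarith) two_pos
    (by rw [zero_div, sub_zero])
  have hK : ∫⁻ t, ENNReal.ofReal t ^ (1 / (2 * (1 - α))) ∂subordinator 1 ≠ ∞ := by
    refine lintegral_rpow_subordinator_ne_top one_pos one_lt_two ?_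
    rw [div_lt_div_iff₀ two_pos (by linarith)]
    linarith
  set K := ∫⁻ t, ENNReal.ofReal t ^ (1 / (2 * (1 - α))) ∂subordinator 1
  set c := subConst (1 + 1 / (1 + α)) / subConst 1
  have hM : ∀ r : ℝ, 0 ≤ r → ∀ x : ℝ≥0∞, x ≠ ∞ → ∃ y : ℝ≥0, (y : ℝ≥0∞) = x ^ r := fun r hr x hx ↦
    ⟨(x ^ r).toNNReal, ENNReal.coe_toNNReal (ENNReal.rpow_ne_top_of_nonneg hr hx)⟩
  obtain ⟨y, hy⟩ := hM ((1 - α) / 2) (by linarith) K hK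
  obtain ⟨z, hz⟩ := hM ((1 + α) / 2) (by linarith) (ENNReal.ofReal c * C)
    (ENNReal.mul_ne_top ENNReal.ofReal_ne_top ENNReal.coe_ne_top)
  refine ⟨z * y, fun u ↦ ?_⟩
  have hDm := measurable_lnorm_sub_step 2 u
  have hw : Measurable fun q : Eu d × ℝ ↦ ENNReal.ofReal q.2 := measurable_snd.ennreal_ofReal
  refine (lintegral_rpow_le_weighted (β := 1 / (2 * (1 + α))) (β' := 1 / (2 * (1 - α))) hα.le hα1.le
    (by have : 1 - α ≠ 0 := by linarith
        field_simp) hDm hw ((ae_pos_levy 1).mono fun q hq ↦ by simpa using hq)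
    (ae_of_all _ fun q ↦ ENNReal.ofReal_ne_top)).trans ?_
  rw [lintegral_levy_snd 1 (f := fun t ↦ ENNReal.ofReal t ^ (1 / (2 * (1 - α))))
    (ENNReal.measurable_ofReal.pow_const _), ← hy.trans rfl,
    show -(1 / (2 * (1 + α))) = (1 - (1 + 1 / (1 + α))) / 2 by field_simp; ring,
    lintegral_rpow_mul_levy one_pos one_lt_two hs0 hs1 (hDm.pow_const _)]
  rw [ENNReal.coe_mul, hz, mul_right_comm, ← ENNReal.mul_rpow_of_nonneg _ _ (by linarith), mul_assoc]
  exact mul_le_mul_left (ENNReal.rpow_le_rpow (mul_le_mul_right (hC u) _) (by linarith)) _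

/-- The remainder of order `1 + α`, `α < 1`, with differences in `L²`. -/
theorem exists_lnorm_remainderBound_le_of_lt_one (hd : 0 < d) {σ α p a : ℝ} (hα : 0 < α)
    (hα1 : α < 1) (hασ : α ≤ 2 * σ) (hp : 1 ≤ p) (ha : 1 ≤ a)
    (h : (2 * σ - α) / a + (1 + α) / 2 = 1 / p)
    (hSob : α < 2 * σ → ∃ C : ℝ≥0, ∀ u : L2 d,
      lnorm a (fun x ↦ ‖u x‖ₑ) volume ≤ C * energy 1 u ^ (1 / 2 : ℝ)) :
    ∃ C : ℝ≥0, ∀ u : L2 d, energy 1 u ≠ ∞ →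
      lnorm p (remainderBound 1 σ α u) volume ≤ C * energy 1 u ^ ((2 * σ + 1) / 2) := by
  obtain ⟨C₂, h2⟩ := exists_lintegral_lnorm_rpow_le hd hα hα1
  rcases hασ.eq_or_lt with rfl | hlt
  · refine ⟨C₂, fun u _ ↦ (lnorm_remainderBound_le hα.le le_rfl hp ha two_pos h u).trans ?_⟩
    rw [sub_self, ENNReal.rpow_zero, one_mul, add_comm (2 * σ)]
    exact h2 u
  obtain ⟨C₁, h1⟩ := hSob hlt
  refine ⟨(2 * C₁) ^ (2 * σ - α) * C₂, fun u _ ↦ ?_⟩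
  refine (lnorm_remainderBound_le hα.le hασ hp ha two_pos h u).trans
    ((mul_le_mul' (ENNReal.rpow_le_rpow (mul_le_mul_right (h1 u) 2)
    (by linarith)) (h2 u)).trans_eq ?_)
  rw [show (2 * σ + 1) / 2 = 1 / 2 * (2 * σ - α) + (1 + α) / 2 by ring,
    ENNReal.rpow_add_of_nonneg _ _ (by linarith) (by linarith), ENNReal.rpow_mul, ← mul_assoc,
    ← mul_assoc, ENNReal.mul_rpow_of_nonneg _ _ (by linarith), ENNReal.coe_mul,
    ENNReal.coe_rpow_of_nonneg _ (by linarith), ENNReal.coe_mul, ENNReal.coe_ofNat]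
  ring

/-- Optimization over the splitting parameter: in `ℝ≥0∞` an additive bound with a free parameter
becomes a product bound. -/
theorem le_rpow_mul_rpow_of_forall_le {α : ℝ} (hα : 0 < α) (hα1 : α < 1) {T A B : ℝ≥0∞} {C : ℝ≥0}
    (h0 : A = 0 ∨ B = 0 → T = 0)
    (h : ∀ r : ℝ, 0 < r → T ≤ C * (A ^ ((1 + α) / 2) * ENNReal.ofReal r ^ (α / 4) +
      B ^ ((1 + α) / 2) * ENNReal.ofReal r ^ (-((1 - α) / 4)))) :
    T ≤ 2 * C * (A ^ ((1 + α) * (1 - α) / 2) * B ^ ((1 + α) * α / 2)) := by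
  rcases eq_or_ne T 0 with hT | hT
  · rw [hT]; exact zero_le
  have hA0 : A ≠ 0 := fun hA ↦ hT (h0 (Or.inl hA))
  have hB0 : B ≠ 0 := fun hB ↦ hT (h0 (Or.inr hB))
  have hC0 : (C : ℝ≥0∞) ≠ 0 := fun hC ↦ hT (by simpa [hC] using h 1 one_pos)
  have hi : 0 < (1 + α) * (1 - α) / 2 := by nlinarith
  have hj : 0 < (1 + α) * α / 2 := by positivity
  by_cases hfin : A = ∞ ∨ B = ∞
  · have : A ^ ((1 + α) * (1 - α) / 2) * B ^ ((1 + α) * α / 2) = ∞ := by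
      have hA' : A ^ ((1 + α) * (1 - α) / 2) ≠ 0 := by simp [hA0, hi, hi.not_gt]
      have hB' : B ^ ((1 + α) * α / 2) ≠ 0 := by simp [hB0, hj, hj.not_gt]
      rcases hfin with rfl | rfl
      · rw [ENNReal.top_rpow_of_pos hi, ENNReal.top_mul hB']
      · rw [ENNReal.top_rpow_of_pos hj, ENNReal.mul_top hA']
    rw [this, ENNReal.mul_top (by simpa using hC0)]
    exact le_top
  push Not at hfin
  obtain ⟨hAt, hBt⟩ := hfin
  obtain ⟨a, rfl⟩ : ∃ a : ℝ, A = ENNReal.ofReal a := ⟨A.toReal, (ENNReal.ofReal_toReal hAt).symm⟩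
  obtain ⟨b, rfl⟩ : ∃ b : ℝ, B = ENNReal.ofReal b := ⟨B.toReal, (ENNReal.ofReal_toReal hBt).symm⟩
  have ha : 0 < a := by simpa using hA0
  have hb : 0 < b := by simpa using hB0
  -- the value of `r` for which both terms agree
  have hr : 0 < (b / a) ^ (2 * (1 + α)) := by positivity
  refine (h _ hr).trans (le_of_eq ?_)
  have e1 : a ^ ((1 + α) / 2) * ((b / a) ^ (2 * (1 + α))) ^ (α / 4) =
      a ^ ((1 + α) * (1 - α) / 2) * b ^ ((1 + α) * α / 2) := by
    rw [← Real.rpow_mul (by positivity), Real.div_rpow hb.le ha.le, ← mul_div_assoc,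
      mul_div_right_comm, ← Real.rpow_sub ha]
    ring_nf
  have e2 : b ^ ((1 + α) / 2) * ((b / a) ^ (2 * (1 + α))) ^ (-((1 - α) / 4)) =
      a ^ ((1 + α) * (1 - α) / 2) * b ^ ((1 + α) * α / 2) := by
    rw [← Real.rpow_mul (by positivity), Real.div_rpow hb.le ha.le,
      div_eq_mul_inv (b ^ (2 * (1 + α) * -((1 - α) / 4))),
      ← Real.rpow_neg ha.le, ← mul_assoc, ← Real.rpow_add hb, mul_comm]
    ring_nf
  rw [ENNReal.ofReal_rpow_of_pos ha, ENNReal.ofReal_rpow_of_pos hb, ENNReal.ofReal_rpow_of_pos hr,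
    ENNReal.ofReal_rpow_of_pos hr, ENNReal.ofReal_rpow_of_pos ha, ENNReal.ofReal_rpow_of_pos hb,
    ← ENNReal.ofReal_mul (by positivity), ← ENNReal.ofReal_mul (by positivity),
    ← ENNReal.ofReal_mul (by positivity), e1, e2]
  ring

/-- The square function of the differences of `u`, for the Lévy measure of order `s`. -/
noncomputable def squareFun (s : ℝ) (u : L2 d) (x : Eu d) : ℝ≥0∞ :=
  ∫⁻ q, ‖u (x + step q) - u x‖ₑ ^ (2 : ℝ) ∂levy d s

theorem measurable_squareFun (s : ℝ) (u : L2 d) : Measurable (squareFun s u) :=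
  Measurable.lintegral_prod_right' (f := fun r : Eu d × (Eu d × ℝ) ↦
    ‖u (r.1 + step r.2) - u r.1‖ₑ ^ (2 : ℝ)) ((measurable_enorm_sub_step u).pow_const _)

theorem exists_lnorm_squareFun_le (hd : 0 < d) {s τ b : ℝ} (hs0 : 0 < s) (hs2 : s < 2)
    (hτ0 : 0 ≤ τ) (hτ : 2 * τ + s ≤ 2) (hb : 2 ≤ b) (hbτ : 1 / b = 1 / 2 - τ / d) :
    ∃ C : ℝ≥0, ∀ u : L2 d, lnorm (b / 2) (squareFun s u) volume ≤ C * energy 1 u := by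
  obtain ⟨C, hC⟩ := exists_lintegral_lnorm_diff_sq_le hd hs0 hs2 hτ0 hτ (by linarith) hbτ
  refine ⟨C, fun u ↦ (lnorm_lintegral_le (by linarith)
    ((measurable_enorm_sub_step u).pow_const (2 : ℝ))).trans ((le_of_eq ?_).trans (hC u))⟩
  refine lintegral_congr fun q ↦ ?_
  rw [lnorm_rpow (by linarith) two_pos, div_mul_cancel₀ _ two_ne_zero]

/-- Interpolation of the integral of `D ^ (1 + α)` for the Lévy measure of order `1` between
integrals of `D ^ 2` for Lévy measures of order larger than and equal to `1`. Each of the parts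
`t < r` and `t ≥ r` of the Lévy measure is handled by Hölder's inequality. -/
theorem exists_lintegral_rpow_levy_le {α : ℝ} (hα : 0 < α) (hα1 : α < 1) :
    ∃ C : ℝ≥0, ∀ D : Eu d × ℝ → ℝ≥0∞, Measurable D →
      ∫⁻ q, D q ^ (1 + α) ∂levy d 1 ≤
        C * ((∫⁻ q, D q ^ (2 : ℝ) ∂levy d (1 + 1 / (1 + α))) ^ ((1 + α) * (1 - α) / 2) *
          (∫⁻ q, D q ^ (2 : ℝ) ∂levy d 1) ^ ((1 + α) * α / 2)) := by
  have hs1 : 1 + 1 / (1 + α) < 2 := by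
    have : 1 / (1 + α) < 1 := by rw [div_lt_one (by linarith)]; linarith
    linarith
  have hs0 : 0 < 1 + 1 / (1 + α) := by positivity
  have hα' : 0 < 1 - α := by linarith
  obtain ⟨C₁, h1⟩ := exists_lintegral_rpow_subordinator_Iio_le (s := 1) (β := 1 / (2 * (1 - α)))
    one_pos one_lt_two (by rw [div_lt_div_iff₀ two_pos (by linarith)]; linarith)
  obtain ⟨C₂, h2⟩ := exists_subordinator_Ici_le (s := 1) one_pos one_lt_two
  set c := (subConst (1 + 1 / (1 + α)) / subConst 1).toNNReal with hc
  have hcp := div_pos (subConst_pos hs0 hs1) (subConst_pos one_pos one_lt_two)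
  set M : ℝ≥0 := max (c ^ ((1 + α) / 2) * C₁ ^ ((1 - α) / 2)) (C₂ ^ ((1 - α) / 2)) with hM
  refine ⟨2 * M, fun D hDm ↦ ?_⟩
  have hw : Measurable fun q : Eu d × ℝ ↦ ENNReal.ofReal q.2 := measurable_snd.ennreal_ofReal
  have hw0 : ∀ᵐ q ∂levy d 1, ENNReal.ofReal q.2 ≠ 0 := (ae_pos_levy 1).mono fun q hq ↦ by simpa using hq
  have hA : ∫⁻ q, ENNReal.ofReal q.2 ^ (-(1 / (2 * (1 + α)))) * D q ^ (2 : ℝ) ∂levy d 1 =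
      c * ∫⁻ q, D q ^ (2 : ℝ) ∂levy d (1 + 1 / (1 + α)) := by
    rw [show -(1 / (2 * (1 + α))) = (1 - (1 + 1 / (1 + α))) / 2 by field_simp; ring,
      lintegral_rpow_mul_levy one_pos one_lt_two hs0 hs1 (hDm.pow_const _), hc]
    rfl
  rw [ENNReal.coe_mul, ENNReal.coe_ofNat]
  refine le_rpow_mul_rpow_of_forall_le hα hα1 ?_ fun r hr ↦ ?_
  · have hz : (∀ᵐ q ∂levy d 1, D q = 0) → ∫⁻ q, D q ^ (1 + α) ∂levy d 1 = 0 := fun h ↦ by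
      rw [lintegral_eq_zero_iff (hDm.pow_const _)]
      filter_upwards [h] with q hq
      rw [hq, ENNReal.zero_rpow_of_pos (by linarith)]; rfl
    rintro (h | h)
    · have hm : Measurable fun q ↦ ENNReal.ofReal q.2 ^ (-(1 / (2 * (1 + α)))) * D q ^ (2 : ℝ) :=
        (hw.pow_const _).mul (hDm.pow_const _)
      rw [h, mul_zero, lintegral_eq_zero_iff hm] at hA
      refine hz ?_
      filter_upwards [hA] with q hq
      have h3 : ENNReal.ofReal q.2 ^ (-(1 / (2 * (1 + α)))) ≠ 0 := by
        rw [ENNReal.rpow_neg]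
        exact ENNReal.inv_ne_zero.2 (ENNReal.rpow_ne_top_of_nonneg (by positivity)
          ENNReal.ofReal_ne_top)
      have h4 := (mul_eq_zero.1 hq).resolve_left h3
      exact (ENNReal.rpow_eq_zero_iff_of_pos two_pos).1 h4
    · have h3 := (lintegral_eq_zero_iff (hDm.pow_const _)).1 h
      exact hz (h3.mono fun q hq ↦ (ENNReal.rpow_eq_zero_iff_of_pos two_pos).1 hq)
  · have hS : MeasurableSet {q : Eu d × ℝ | q.2 < r} := measurableSet_lt measurable_snd measurable_const
    rw [← lintegral_add_compl _ hS]
    -- small jumps are compared with the measure of the larger order, large jumps are treated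
    -- without a weight
    have k1 := lintegral_rpow_le_weighted (μ := (levy d 1).restrict {q | q.2 < r})
      (β := 1 / (2 * (1 + α))) (β' := 1 / (2 * (1 - α))) hα.le hα1.le
      (by field_simp) hDm hw (ae_restrict_of_ae hw0)
      (ae_of_all _ fun q ↦ ENNReal.ofReal_ne_top)
    have k2 := lintegral_rpow_le_weighted (μ := (levy d 1).restrict {q | q.2 < r}ᶜ)
      (β := 0) (β' := 0) hα.le hα1.le (by ring) hDm hw (ae_restrict_of_ae hw0)
      (ae_of_all _ fun q ↦ ENNReal.ofReal_ne_top)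
    have k3 : ∫⁻ q in {q : Eu d × ℝ | q.2 < r}, ENNReal.ofReal q.2 ^ (1 / (2 * (1 - α))) ∂levy d 1 ≤
        C₁ * ENNReal.ofReal r ^ (1 / (2 * (1 - α)) - 1 / 2) := by
      refine le_trans (le_of_eq ?_) (h1 r hr)
      rw [← lintegral_indicator hS, ← lintegral_indicator measurableSet_Iio,
        ← lintegral_levy_snd (d := d) 1 ((ENNReal.measurable_ofReal.pow_const _).indicator
          measurableSet_Iio)]
      rfl
    have k4 : ∫⁻ q in {q : Eu d × ℝ | q.2 < r}ᶜ, ENNReal.ofReal q.2 ^ (0 : ℝ) ∂levy d 1 ≤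
        C₂ * ENNReal.ofReal r ^ (-(1 / 2 : ℝ)) := by
      refine le_trans (le_of_eq ?_) (h2 r hr)
      simp only [ENNReal.rpow_zero, lintegral_one, Measure.restrict_apply_univ]
      rw [← lintegral_indicator_one hS.compl, ← lintegral_indicator_one measurableSet_Ici,
        ← lintegral_levy_snd (d := d) 1 (measurable_one.indicator measurableSet_Ici)]
      refine lintegral_congr fun q ↦ ?_
      simp [Set.indicator_apply]
    have k5 : ∫⁻ q in {q : Eu d × ℝ | q.2 < r}, ENNReal.ofReal q.2 ^ (-(1 / (2 * (1 + α)))) *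
        D q ^ (2 : ℝ) ∂levy d 1 ≤ c * ∫⁻ q, D q ^ (2 : ℝ) ∂levy d (1 + 1 / (1 + α)) :=
      (setLIntegral_le_lintegral _ _).trans_eq hA
    have k6 : ∫⁻ q in {q : Eu d × ℝ | q.2 < r}ᶜ, ENNReal.ofReal q.2 ^ (-(0 : ℝ)) *
        D q ^ (2 : ℝ) ∂levy d 1 ≤ ∫⁻ q, D q ^ (2 : ℝ) ∂levy d 1 := by
      simp only [neg_zero, ENNReal.rpow_zero, one_mul]
      exact setLIntegral_le_lintegral _ _
    have l1 := k1.trans (mul_le_mul' (ENNReal.rpow_le_rpow k5 (by linarith))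
      (ENNReal.rpow_le_rpow k3 (by linarith)))
    have l2 := k2.trans (mul_le_mul' (ENNReal.rpow_le_rpow k6 (by linarith))
      (ENNReal.rpow_le_rpow k4 (by linarith)))
    rw [ENNReal.mul_rpow_of_nonneg _ _ (by linarith), ENNReal.mul_rpow_of_nonneg _ _ (by linarith),
      ← ENNReal.rpow_mul, show (1 / (2 * (1 - α)) - 1 / 2) * ((1 - α) / 2) = α / 4 by
        field_simp; ring] at l1
    rw [ENNReal.mul_rpow_of_nonneg _ _ (by linarith), ← ENNReal.rpow_mul,
      show -(1 / 2) * ((1 - α) / 2) = -((1 - α) / 4) by ring] at l2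
    have m1 : (c : ℝ≥0∞) ^ ((1 + α) / 2) * (C₁ : ℝ≥0∞) ^ ((1 - α) / 2) ≤ M := by
      rw [← ENNReal.coe_rpow_of_nonneg _ (by linarith), ← ENNReal.coe_rpow_of_nonneg _ (by linarith),
        ← ENNReal.coe_mul]
      exact ENNReal.coe_le_coe.2 (le_max_left _ _)
    have m2 : (C₂ : ℝ≥0∞) ^ ((1 - α) / 2) ≤ M := by
      rw [← ENNReal.coe_rpow_of_nonneg _ (by linarith)]
      exact ENNReal.coe_le_coe.2 (le_max_right _ _)
    rw [mul_add]
    refine add_le_add (l1.trans ?_) (l2.trans ?_)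
    · rw [mul_mul_mul_comm]
      exact mul_le_mul_left m1 _
    · rw [mul_left_comm]
      exact mul_le_mul_left m2 _

/-- At the end point `α = 2 σ` the majorant contains only the differences of `u`. -/
theorem exists_remainderBound_le_squareFun {α : ℝ} (hα : 0 < α) (hα1 : α < 1) :
    ∃ C : ℝ≥0, ∀ (u : L2 d) (x : Eu d), remainderBound 1 (α / 2) α u x ≤
      C * (squareFun (1 + 1 / (1 + α)) u x ^ ((1 + α) * (1 - α) / 2) *
        squareFun 1 u x ^ ((1 + α) * α / 2)) := by
  obtain ⟨C, hC⟩ := exists_lintegral_rpow_levy_le (d := d) hα hα1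
  refine ⟨C, fun u x ↦ ?_⟩
  have hD : Measurable fun q : Eu d × ℝ ↦ ‖u (x + step q) - u x‖ₑ :=
    ((u.measurable.comp (measurable_step.const_add x)).sub_const _).enorm
  have h := hC _ hD
  simp only [remainderBound, mul_div_cancel₀ α two_ne_zero, sub_self, ENNReal.rpow_zero, one_mul]
  exact h

/-- The remainder of order `1 + 2 σ`, `σ < 1 / 2`, in dimension three. -/
theorem exists_lnorm_remainderBound_le_three {σ : ℝ} (hσ : 0 < σ) (hσ1 : σ < 1 / 2) :
    ∃ C : ℝ≥0, ∀ u : L2 3, energy 1 u ≠ ∞ →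
      lnorm (6 / (2 * σ + 3)) (remainderBound 1 σ (2 * σ) u) volume ≤
        C * energy 1 u ^ ((2 * σ + 1) / 2) := by
  obtain ⟨α, rfl⟩ : ∃ α, σ = α / 2 := ⟨2 * σ, by ring⟩
  rw [mul_div_cancel₀ _ two_ne_zero]
  have hα : 0 < α := by linarith
  have hα1 : α < 1 := by linarith
  have hs1 : 1 + 1 / (1 + α) < 2 := by
    have : 1 / (1 + α) < 1 := by rw [div_lt_one (by linarith)]; linarith
    linarith
  have hs0 : 0 < 1 + 1 / (1 + α) := by positivity
  obtain ⟨C₀, h0⟩ := exists_remainderBound_le_squareFun (d := 3) hα hα1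
  -- `b` is the Sobolev exponent of order `τ = 1 - s / 2` in dimension three, here for
  -- `s = 1 + 1 / (1 + α)` and in the next step for `s = 1`
  obtain ⟨C₁, h1⟩ := exists_lnorm_squareFun_le (d := 3) (by norm_num) hs0 hs1
    (τ := 1 - (1 + 1 / (1 + α)) / 2) (b := 6 / (1 + (1 + 1 / (1 + α)))) (by linarith) (by linarith)
    (by rw [le_div_iff₀ (by linarith)]; linarith) (by field_simp; push_cast; ring)
  obtain ⟨C₂, h2⟩ := exists_lnorm_squareFun_le (d := 3) (by norm_num) one_pos one_lt_two
    (τ := 1 / 2) (b := 3) (by norm_num) (by norm_num) (by norm_num) (by norm_num)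
  refine ⟨C₀ * (C₁ ^ ((1 + α) * (1 - α) / 2) * C₂ ^ ((1 + α) * α / 2)), fun u _ ↦ ?_⟩
  have hi : 0 ≤ (1 + α) * (1 - α) / 2 := by nlinarith
  have hj : 0 ≤ (1 + α) * α / 2 := by positivity
  refine (lnorm_mono (by positivity) (h0 u)).trans ?_
  rw [lnorm_const_mul (by positivity) ENNReal.coe_ne_top]
  refine (mul_le_mul_right (lnorm_rpow_mul_rpow_le
    (a := 6 / (1 + (1 + 1 / (1 + α))) / 2) (b := 3 / 2) (by positivity) (by positivity) (by norm_num)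
    hi hj (by field_simp; ring) (measurable_squareFun _ u).aemeasurable
    (measurable_squareFun _ u).aemeasurable) _).trans ?_
  refine (mul_le_mul_right (mul_le_mul' (ENNReal.rpow_le_rpow (h1 u) hi)
    (ENNReal.rpow_le_rpow (h2 u) hj)) _).trans_eq ?_
  rw [ENNReal.mul_rpow_of_nonneg _ _ hi, ENNReal.mul_rpow_of_nonneg _ _ hj, mul_mul_mul_comm,
    ← ENNReal.rpow_add_of_nonneg _ _ hi hj, ENNReal.coe_mul, ENNReal.coe_mul,
    ENNReal.coe_rpow_of_nonneg _ hi, ENNReal.coe_rpow_of_nonneg _ hj,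
    show (1 + α) * (1 - α) / 2 + (1 + α) * α / 2 = (α + 1) / 2 by ring, ← mul_assoc]

/-! ### Transfer to the spaces `H^{s,p}` -/

theorem IsGivenBy.congr_ae {T : 𝓢'(Eu d, ℂ)} {f g : Eu d → ℂ} (h : IsGivenBy T f)
    (hfg : f =ᵐ[volume] g) : IsGivenBy T g := fun φ ↦ by
  have hae : (fun x ↦ φ x * f x) =ᵐ[volume] fun x ↦ φ x * g x :=
    hfg.mono fun x hx ↦ by simp only [hx]
  exact ⟨(h φ).1.congr hae, (h φ).2.trans (integral_congr_ae hae)⟩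

theorem IsBesselPow.congr_ae_left {s : ℝ} {f f' g : Eu d → ℂ} (h : IsBesselPow s f g)
    (hf : f =ᵐ[volume] f') : IsBesselPow s f' g := by
  obtain ⟨T, h1, h2⟩ := h
  exact ⟨T, h1.congr_ae hf, h2⟩

/-- The function `(1 - Δ) ^ (s / 2) f` is unique up to null sets. -/
theorem IsBesselPow.ae_eq {s : ℝ} {f g g' : Eu d → ℂ} (h : IsBesselPow s f g)
    (h' : IsBesselPow s f g') : g =ᵐ[volume] g' := by
  obtain ⟨T, h1, h2⟩ := h
  obtain ⟨T', h1', h2'⟩ := h'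
  refine ae_eq_of_integral_schwartz_mul_eq
    (locallyIntegrable_of_integrable_schwartz_mul fun φ ↦ (h2 φ).1)
    (locallyIntegrable_of_integrable_schwartz_mul fun φ ↦ (h2' φ).1) fun φ ↦ ?_
  rw [← (h2 φ).2, ← (h2' φ).2, besselPow_apply, besselPow_apply, (h1 _).2, (h1' _).2]

/-- The energy of order `1` is the square of the `L²` norm of `(1 - Δ) ^ (1 / 2) u`. -/
theorem energy_eq_of_isBesselPow {u g : Eu d → ℂ} (hu : MemLp u 2 volume)
    (hg : MemLp g 2 volume) (h : IsBesselPow 1 u g) :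
    energy 1 (hu.toLp u) = eLpNorm g 2 volume ^ (2 : ℝ) := by
  obtain ⟨T, h1, h2⟩ := h
  have hU := hu.coeFn_toLp
  have hG := hg.coeFn_toLp
  obtain ⟨U, hUdef⟩ : ∃ U : L2 d, U = hu.toLp u := ⟨_, rfl⟩
  obtain ⟨G, hGdef⟩ : ∃ G : L2 d, G = hg.toLp g := ⟨_, rfl⟩
  rw [← hUdef] at hU ⊢
  rw [← hGdef] at hG
  have key : (𝓕 G : L2 d) =ᵐ[volume] fun ξ ↦ (symbol d 1 ξ : ℂ) * (𝓕 U : L2 d) ξ := by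
    refine ae_eq_of_integral_schwartz_mul_eq (L2.locallyIntegrable _)
      ((L2.locallyIntegrable _).continuous_mul
        (Complex.continuous_ofReal.comp (continuous_symbol 1))) fun φ ↦ ?_
    have e1 : ∫ x, (𝓕 φ : 𝓢(Eu d, ℂ)) x * G x = ∫ x, besselSchwartz 1 (𝓕 φ) x * U x := by
      have e2 := (h2.congr_ae hG.symm (𝓕 φ)).2
      rw [besselPow_apply, (h1.congr_ae hU.symm _).2] at e2
      exact e2.symm
    rw [integral_schwartz_mul_fourier, e1, besselSchwartz, FourierTransform.fourierInv_fourier_eq,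
      ← integral_schwartz_mul_fourier]
    congr 1 with ξ
    rw [smulLeftCLM_symbol_apply]
    ring
  have e3 : eLpNorm g 2 volume = eLpNorm G 2 volume := (eLpNorm_congr_ae hG).symm
  rw [e3, eLpNorm_two_eq_lnorm, lnorm_two_rpow, ← lintegral_enorm_fourier_sq, energy]
  refine lintegral_congr_ae (key.mono fun ξ hξ ↦ ?_)
  have hp := symbol_pos (d := d) 1 ξ
  simp only
  rw [hξ, enorm_mul, ENNReal.mul_rpow_of_nonneg _ _ two_pos.le,
    ← ofReal_norm (symbol d 1 ξ : ℂ),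
    Complex.norm_real, Real.norm_of_nonneg hp.le, ENNReal.ofReal_rpow_of_nonneg hp.le two_pos.le,
    Real.rpow_two, sq, symbol_mul]
  norm_num

/-- Passage from bounds in terms of `energy`, for `u` in the Hilbert space `L2 d`, to the norms of
`H^{s,p}`. -/
theorem exists_normH_powerF_le {s σ p : ℝ} (hσ : 0 < σ)
    (h : ∃ C : ℝ≥0, ∀ u : L2 d, energy 1 u ≠ ∞ →
      MemLp (fun x ↦ powerFun σ (u x)) (ENNReal.ofReal p) volume ∧
      ∃ g : Eu d → ℂ, IsBesselPow s (fun x ↦ powerFun σ (u x)) g ∧ AEStronglyMeasurable g volume ∧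
        eLpNorm g (ENNReal.ofReal p) volume ≤ C * energy 1 u ^ ((2 * σ + 1) / 2)) :
    ∃ C : ℝ≥0, ∀ u : Eu d → ℂ, MemH 1 2 u →
      MemH s (ENNReal.ofReal p) (powerF σ u) ∧
        normH s (ENNReal.ofReal p) (powerF σ u) ≤ C * normH 1 2 u ^ (2 * σ + 1) := by
  obtain ⟨C, h⟩ := h
  refine ⟨C, fun u ⟨hu, g₀, hg₀, hg₀m⟩ ↦ ?_⟩
  have hE := energy_eq_of_isBesselPow hu hg₀m hg₀
  have hEt : energy 1 (hu.toLp u) ≠ ∞ := by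
    rw [hE]; exact ENNReal.rpow_ne_top_of_nonneg two_pos.le hg₀m.2.ne
  obtain ⟨hF, g, hg, hgm, hgle⟩ := h _ hEt
  have hae : (fun x ↦ powerFun σ ((hu.toLp u : L2 d) x)) =ᵐ[volume] powerF σ u :=
    hu.coeFn_toLp.mono fun x hx ↦ by simp only [hx, powerFun, powerF]
  have hB := hg.congr_ae_left hae
  have hgt : eLpNorm g (ENNReal.ofReal p) volume < ∞ := hgle.trans_lt
    (ENNReal.mul_ne_top ENNReal.coe_ne_top (ENNReal.rpow_ne_top_of_nonneg (by positivity) hEt)).lt_top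
  refine ⟨⟨hF.ae_eq hae, g, hB, hgm, hgt⟩, ?_⟩
  refine (iInf₂_le g hB).trans (hgle.trans (mul_le_mul_right ?_ _))
  rw [hE, ← ENNReal.rpow_mul, mul_div_cancel₀ _ two_ne_zero]
  refine ENNReal.rpow_le_rpow (le_iInf₂ fun g' hg' ↦ ?_) (by positivity)
  rw [eLpNorm_congr_ae (hg₀.ae_eq hg')]

/-- The Sobolev embedding `H¹ ⊆ L^b` for all `b` between `2` and the Sobolev exponent. -/
theorem exists_lnorm_le_energy_one (hd : 0 < d) {b : ℝ} (hb : 2 ≤ b)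
    (hbd : (1 / 2 - 1 / b) * d ≤ 1) : ∃ C : ℝ≥0, ∀ u : L2 d,
      lnorm b (fun x ↦ ‖u x‖ₑ) volume ≤ C * energy 1 u ^ (1 / 2 : ℝ) := by
  have hd' : (0 : ℝ) < d := by exact_mod_cast hd
  have hb' : 1 / b ≤ 1 / 2 := one_div_le_one_div_of_le two_pos hb
  obtain ⟨C, hC⟩ := exists_lnorm_le_energy hd (τ := (1 / 2 - 1 / b) * d) (b := b)
    (mul_nonneg (by linarith) hd'.le) (by linarith) (by field_simp; ring)
  exact ⟨C, fun u ↦ (hC u).trans (mul_le_mul_right (ENNReal.rpow_le_rpow (energy_mono hbd u)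
    (by norm_num)) _)⟩

theorem exists_normH_powerF_le_two {σ : ℝ} (hσ : 0 < σ) :
    ∃ C : ℝ≥0, ∀ u : Eu 2 → ℂ, MemH 1 2 u →
      MemH 1 (ENNReal.ofReal (exponentTwo σ)) (powerF σ u) ∧
        normH 1 (ENNReal.ofReal (exponentTwo σ)) (powerF σ u) ≤ C * normH 1 2 u ^ (2 * σ + 1) := by
  have hS : ∀ {b : ℝ}, 2 ≤ b → ∃ C : ℝ≥0, ∀ u : L2 2,
      lnorm b (fun x ↦ ‖u x‖ₑ) volume ≤ C * energy 1 u ^ (1 / 2 : ℝ) := fun {b} hb ↦ by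
    refine exists_lnorm_le_energy_one two_pos hb ?_
    have : 0 < 1 / b := by positivity
    push_cast
    linarith
  have h3 : ∃ C : ℝ≥0, ∀ v : L2 2,
      lnorm 2 (fun x ↦ ‖v x‖ₑ) volume ≤ C * energy (1 - 1) v ^ (1 / 2 : ℝ) :=
    exists_lnorm_le_energy two_pos (by norm_num) two_pos (by norm_num)
  refine exists_normH_powerF_le hσ ?_
  rw [exponentTwo]
  split_ifs with hσ1
  · refine exists_eLpNorm_bessel_powerFun_le (α := 2 * σ) (k := 1 / σ) (c := 2) one_pos le_rfl hσ
      (by linarith) (by linarith) le_rfl ?_ ?_ ?_ two_pos ?_ (hS ?_) (hS ?_) h3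
      (exists_lnorm_remainderBound_le_of_lt_one (a := 2) two_pos (by linarith) (by linarith) le_rfl ?_
        one_le_two ?_ fun h ↦ absurd h (lt_irrefl _))
    · rw [le_div_iff₀ (by linarith)]; linarith
    · rw [div_le_iff₀ (by linarith)]; linarith
    · rw [le_div_iff₀ hσ]; linarith
    · field_simp
    · rw [div_mul_cancel₀ _ (by linarith)]
    · rw [div_mul_eq_mul_div, one_mul, mul_div_cancel_right₀ _ hσ.ne']
    · rw [le_div_iff₀ (by linarith)]; linarith
    · field_simp; ring
  · have hσ2 : 1 / 2 ≤ σ := not_lt.1 hσ1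
    -- Every `α < 1 / 2` would do. With differences in `L²` and `1 / p = 3 / 4` Hölder's inequality
    -- asks for `(2 σ - α) / a = 1 / 4 - α / 2`, so `α = 1 / 4` gives `a = 16 σ - 2 ≥ 6`.
    refine exists_eLpNorm_bessel_powerFun_le (α := 1 / 4) (k := 4) (c := 2) one_pos le_rfl hσ
      (by norm_num) (by norm_num) (by linarith) (by norm_num) (by norm_num) (by norm_num) two_pos
      (by norm_num) (hS (by linarith)) (hS (by linarith)) h3
      (exists_lnorm_remainderBound_le_of_lt_one (a := 16 * σ - 2) two_pos (by norm_num) (by norm_num)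
        (by linarith) (by norm_num) (by linarith) ?_ fun _ ↦ hS (by linarith))
    have h16 : 16 * σ - 2 ≠ 0 := by linarith
    rw [show 2 * σ - 1 / 4 = (16 * σ - 2) * (1 / 8) by ring, mul_div_cancel_left₀ _ h16]
    norm_num

/-- The exponent `6 / (2 * σ + 1 + 2 * s)` is that of the product of `|u| ^ (2 σ)`, in `L^(3 / σ)`,
and `v = ((1 - Δ) ^ (s / 2) - 1) u`, in `L^(6 / (1 + 2 s))` as it has `1 - s` derivatives in `L²`.
-/
theorem exists_normH_powerF_le_three {s σ : ℝ} (hs0 : 0 < s) (hs1 : s ≤ 1) (hσ : 0 < σ)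
    (hσ1 : σ ≤ 3 / 2) (h : 1 / 2 ≤ σ ∨ s = 1) (h2 : 2 * σ + 1 + 2 * s ≤ 6) (h3 : 2 ≤ 2 * σ + 2 * s) :
    ∃ C : ℝ≥0, ∀ u : Eu 3 → ℂ, MemH 1 2 u →
      MemH s (ENNReal.ofReal (6 / (2 * σ + 1 + 2 * s))) (powerF σ u) ∧
        normH s (ENNReal.ofReal (6 / (2 * σ + 1 + 2 * s))) (powerF σ u) ≤
          C * normH 1 2 u ^ (2 * σ + 1) := by
  have h30 : 0 < 3 := by norm_num
  have hS : ∀ {b : ℝ}, 2 ≤ b → b ≤ 6 → ∃ C : ℝ≥0, ∀ u : L2 3,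
      lnorm b (fun x ↦ ‖u x‖ₑ) volume ≤ C * energy 1 u ^ (1 / 2 : ℝ) := fun {b} hb hb6 ↦ by
    refine exists_lnorm_le_energy_one h30 hb ?_
    have : 1 / 6 ≤ 1 / b := one_div_le_one_div_of_le (by linarith) hb6
    push_cast
    linarith
  have hp1 : 1 ≤ 6 / (2 * σ + 1 + 2 * s) := by rw [le_div_iff₀ (by linarith)]; linarith
  have hp2 : 6 / (2 * σ + 1 + 2 * s) ≤ 2 := by rw [div_le_iff₀ (by linarith)]; linarith
  refine exists_normH_powerF_le hσ ?_
  obtain ⟨α, hα, hα1, hασ, h4⟩ : ∃ α : ℝ, 0 < α ∧ α ≤ 1 ∧ α ≤ 2 * σ ∧ ∃ C : ℝ≥0, ∀ u : L2 3,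
      energy 1 u ≠ ∞ → lnorm (6 / (2 * σ + 1 + 2 * s)) (remainderBound s σ α u) volume ≤
        C * energy 1 u ^ ((2 * σ + 1) / 2) := by
    rcases le_or_gt (1 / 2) σ with hσ2 | hσ2
    · refine ⟨1, one_pos, le_rfl, by linarith, exists_lnorm_remainderBound_le_of_half_le (a := 6)
        (b := 6 / (1 + s)) (τ := 1 - s / 2) h30 hs0 (by linarith) hσ2 hp1 (by norm_num) (by positivity)
        (by linarith) (by linarith) ?_ ?_ (hS (by norm_num) le_rfl)⟩
      · field_simp; push_cast; ring
      · field_simp; ring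
    · obtain rfl : s = 1 := h.resolve_left (not_le.2 hσ2)
      refine ⟨2 * σ, by linarith, by linarith, le_rfl, ?_⟩
      rw [show 2 * σ + 1 + 2 * 1 = 2 * σ + 3 by ring]
      exact exists_lnorm_remainderBound_le_three hσ hσ2
  refine exists_eLpNorm_bessel_powerFun_le (k := 3 / σ) (c := 6 / (1 + 2 * s)) hs0 hs1 hσ hα hα1 hασ
    hp1 hp2 ?_ (by positivity) ?_ (hS ?_ ?_) (hS ?_ ?_) ?_ h4
  · rw [le_div_iff₀ hσ]; linarith
  · field_simp; ring
  · rw [div_mul_eq_mul_div, le_div_iff₀ (by linarith)]; linarith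
  · rw [div_mul_eq_mul_div, div_le_iff₀ (by linarith)]; linarith
  · rw [div_mul_eq_mul_div, le_div_iff₀ hσ]; linarith
  · rw [div_mul_eq_mul_div, div_le_iff₀ hσ]; linarith
  · exact exists_lnorm_le_energy h30 (by linarith) (by positivity) (by field_simp; push_cast; ring)

theorem one_lt_exponentTwo {σ : ℝ} (hσ : 0 < σ) : 1 < exponentTwo σ := by
  rw [exponentTwo]
  split_ifs
  · rw [lt_div_iff₀ (by linarith)]; linarith
  · norm_num

theorem exponentTwo_lt_two {σ : ℝ} (hσ : 0 < σ) : exponentTwo σ < 2 := by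
  rw [exponentTwo]
  split_ifs
  · rw [div_lt_iff₀ (by linarith)]; linarith
  · norm_num

end BesselSobolev

theorem lemmaC1 :
    -- dimension two
    (∀ σ : ℝ, 0 < σ →
      (1 < BesselSobolev.exponentTwo σ ∧ BesselSobolev.exponentTwo σ < 2) ∧
      ∃ C : ℝ≥0, ∀ u : EuclideanSpace ℝ (Fin 2) → ℂ, BesselSobolev.MemH 1 2 u →
        BesselSobolev.MemH 1 (ENNReal.ofReal (BesselSobolev.exponentTwo σ))
          (BesselSobolev.powerF σ u) ∧
        BesselSobolev.normH 1 (ENNReal.ofReal (BesselSobolev.exponentTwo σ))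
          (BesselSobolev.powerF σ u) ≤ C * BesselSobolev.normH 1 2 u ^ (2 * σ + 1)) ∧
    -- dimension three, one derivative
    (∀ σ : ℝ, 0 < σ → σ ≤ 3 / 2 →
      ∃ C : ℝ≥0, ∀ u : EuclideanSpace ℝ (Fin 3) → ℂ, BesselSobolev.MemH 1 2 u →
        BesselSobolev.MemH 1 (ENNReal.ofReal (6 / (2 * σ + 3))) (BesselSobolev.powerF σ u) ∧
        BesselSobolev.normH 1 (ENNReal.ofReal (6 / (2 * σ + 3))) (BesselSobolev.powerF σ u)
          ≤ C * BesselSobolev.normH 1 2 u ^ (2 * σ + 1)) ∧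
    -- dimension three, `2 - σ` derivatives
    (∀ σ : ℝ, 1 ≤ σ → σ ≤ 3 / 2 →
      ∃ C : ℝ≥0, ∀ u : EuclideanSpace ℝ (Fin 3) → ℂ, BesselSobolev.MemH 1 2 u →
        BesselSobolev.MemH (2 - σ) (ENNReal.ofReal (6 / 5)) (BesselSobolev.powerF σ u) ∧
        BesselSobolev.normH (2 - σ) (ENNReal.ofReal (6 / 5)) (BesselSobolev.powerF σ u)
          ≤ C * BesselSobolev.normH 1 2 u ^ (2 * σ + 1)) := by
  refine ⟨fun σ hσ ↦ ⟨⟨BesselSobolev.one_lt_exponentTwo hσ, BesselSobolev.exponentTwo_lt_two hσ⟩,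
    BesselSobolev.exists_normH_powerF_le_two hσ⟩, fun σ hσ hσ1 ↦ ?_, fun σ hσ hσ1 ↦ ?_⟩
  · rw [show 2 * σ + 3 = 2 * σ + 1 + 2 * 1 by ring]
    exact BesselSobolev.exists_normH_powerF_le_three one_pos le_rfl hσ hσ1 (Or.inr rfl) (by linarith)
      (by linarith)
  · have h := BesselSobolev.exists_normH_powerF_le_three (s := 2 - σ) (σ := σ) (by linarith)
      (by linarith) (by linarith) hσ1 (Or.inl (by linarith)) (by linarith) (by linarith)
    rwa [show 2 * σ + 1 + 2 * (2 - σ) = 5 by ring] at h
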